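/- Consider the white noise model $dY(t)=f(t)\,dt+n^{-1/2}dW(t)$, $-\frac12\le t\le\frac12$, or the Gaussian sequence model $Y(i)=f(i)+n^{-1/2}z_i$, $i\in\mathcal M$ ($z_i$ i.i.d. standard normal, $\mathcal M$ finite or countable). Let $P_f$, $E_f$ denote probability and expectation when the parameter is $f$, let $\|\cdot\|_2$ be the $L_2(-\frac12,\frac12)$ norm, respectively the $\ell_2$ norm, and let $T$ be a linear functional. Write $z_\alpha=\Phi^{-1}(1-\alpha)$ and $$\omega(\varepsilon,\mathcal F,\mathcal G)=\sup\{Tg-Tf:\|g-f\|_2\le\varepsilon,\ f\in\mathcal F,\ g\in\mathcal G\},\qquad \omega_+(\varepsilon,\mathcal F,\mathcal G)=\sup\{|Tg-Tf|:\|g-f\|_2\le\varepsilon,\ f\in\mathcal F,\ g\in\mathcal G\}.$$ Let $\mathcal I_{\alpha,\mathcal F}$ be the set of confidence intervals for $Tf$ with coverage probability at least $1-\alpha$ for every $f\in\mathcal F$. For an interval $CI$ of length $L(CI)$ put $L(CI,\mathcal G)=\sup_{f\in\mathcal G}E_fL(CI)$ and $L^*_\alpha(\mathcal G,\mathcal F)=\inf_{CI\in\mathcal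 I_{\alpha,\mathcal F}}L(CI,\mathcal G)$. Let $0<\alpha<\frac12$, let $\mathcal F_1,\dots,\mathcal F_k$ ($k\ge1$) be nonempty convex sets of square integrable (respectively square summable) parameters, put $\mathcal G_m=\bigcup_{l=1}^m\mathcal F_l$, $\mathcal F=\mathcal G_k$, $\mathcal H_m=\mathrm{C.Hull}(\mathcal G_m)$ (the convex hull), and suppose that Condition C holds: there are constants $C_2\ge C_1>0$ and $\varepsilon_0$ such that for $1\le j\le k$ and $0<\varepsilon<\varepsilon_0$ $$\omega(\varepsilon,\mathcal H_j,\mathcal H_k)\le C_1\omega(\varepsilon,\mathcal G_j,\mathcal G_k)\le C_2\omega(\varepsilon,\mathcal F_j,\mathcal F_k),\qquad \omega(\varepsilon,\mathcal H_k,\mathcal H_j)\le C_1\omega(\varepsilon,\mathcal G_k,\mathcal G_j)\le C_2\omega(\varepsilon,\mathcal F_k,\mathcal F_j).$$ Suppose that $z_{\alpha/2}/\sqrt n<\varepsilon_0$. Define an interval $CI^*$ as follows. Set $\omega'_{i,j}=\omega(z_{\alpha/2}/\sqrt n,\mathcal H_i,\mathcal H_j)$ and $\xi'_j=\omega_+(z_{\alpha/2}/\sqrt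 n,\mathcal H_j,\mathcal H_k)$. For $1\le i,j\le k$ let $\hat T'_{i,j}$ be a linear estimator (possibly with a constant term) with $\mathrm{Var}(\hat T'_{i,j})\le\omega_{i,j}'^2/z_{\alpha/2}^2$, $\inf_{f\in\mathcal G_j}(E_f\hat T'_{i,j}-Tf)\ge-\frac12\omega'_{i,j}$ and $\sup_{f\in\mathcal G_i}(E_f\hat T'_{i,j}-Tf)\le\frac12\omega'_{i,j}$. Let $CI^*_j$ be the interval with midpoint $\frac12(\hat T'_{j,k}+\hat T'_{k,j})$ and half length $(\hat T'_{j,k}-\hat T'_{k,j})_++\kappa\,\xi'_j$, where $\kappa=2$ if $\alpha\le0.2$ and $\kappa=3$ if $\alpha>0.2$. Let $0=j_0<j_1<\dots<j_m=k$ be the subsequence with $\xi'_{j_i}\ge2\xi'_{j_{i-1}}$ for $2\le i\le m$ and $\xi'_{j_i}<2\xi'_j$ for all $j_{i-1}<j<j_i$, $1\le i\le m$. Let $\hat\jmath$ be the index of a shortest interval among $CI^*_{j_1},\dots,CI^*_{j_m}$, and put $CI^*=CI^*_{\hat\jmath}$. Then such estimators, and hence such intervals $CI^*$, exist, and every such $CI^*$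 has coverage probability at least $1-\alpha$ for all $f\in\mathcal F$, that is, $CI^*\in\mathcal I_{\alpha,\mathcal F}$, and satisfies, simultaneously for all $1\le j\le k$, $$L^*_\alpha(\mathcal F_j,\mathcal F)\le L(CI^*,\mathcal F_j)\le C\,L^*_\alpha(\mathcal F_j,\mathcal F),\qquad c\,\omega_+\Big(\frac{z_{\alpha/2}}{\sqrt n},\mathcal F_j,\mathcal F\Big)\le L(CI^*,\mathcal F_j)\le C\,\omega_+\Big(\frac{z_{\alpha/2}}{\sqrt n},\mathcal F_j,\mathcal F\Big),$$ where the constants $c,C>0$ depend only on $\alpha$ and on the constant $C_2$ of Condition C; in particular they are independent of $k$, $n$ and the parameter spaces. -/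

import Mathlib

open MeasureTheory ProbabilityTheory Filter Topology
open scoped ENNReal NNReal

noncomputable section

namespace NearlyNested

/-! ### The two Gaussian models -/

/-- The time interval `[-1/2, 1/2]`. -/
abbrev TimeInterval : Type := Set.Icc (-(1 / 2) : ℝ) (1 / 2)

/-- Lebesgue measure on `[-1/2, 1/2]`. -/
def lebesgueTime : Measure TimeInterval := Measure.comap Subtype.val volume

/-- The observed path of `dY(t) = f(t) dt + n^{-1/2} dW(t)`, `-1/2 ≤ t ≤ 1/2`, that is
`Y(t) = ∫_{-1/2}^t f(s) ds + n^{-1/2} W(t)`, where `W(t) = B(t + 1/2)` for a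
Brownian motion `B` started at time `0`. -/
def whiteNoisePath {Ω : Type} (n : ℝ) (B : ℝ≥0 → Ω → ℝ) (f : TimeInterval → ℝ)
    (ω : Ω) : TimeInterval → ℝ :=
  fun t => (∫ s in Set.Iic t, f s ∂lebesgueTime)
    + (Real.sqrt n)⁻¹ * B (Real.toNNReal ((t : ℝ) + 1 / 2)) ω

/-- The observed sequence `Y(i) = f(i) + n^{-1/2} z_i`. -/
def noisySequence {Ω M : Type} (n : ℝ) (z : M → Ω → ℝ) (f : M → ℝ) (ω : Ω) : M → ℝ :=
  fun i => f i + (Real.sqrt n)⁻¹ * z i ω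

/-- `IsGaussianModel n ι ν P` says that `P f` is the distribution of the observation with unknown
parameter `f : ι → ℝ` and noise level `n^{-1/2}` in one of the two Gaussian models; `ν` is the
measure whose `L²(ν)` norm is the norm `‖·‖₂` of the model.

* white noise with drift: `ι = [-1/2, 1/2]` and `ν` is Lebesgue measure;
* Gaussian sequence model: `ι = M` is finite or countably infinite, `ν` is counting measure, and
  the `z_i` are i.i.d. standard normal.

The data are a random element of `ι → ℝ`, with the product σ-algebra. -/
inductive IsGaussianModel (n : ℝ) : ∀ (ι : Type) [MeasurableSpace ι],
    Measure ι → ((ι → ℝ) → Measure (ι → ℝ)) → Prop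
  | whiteNoise {Ω : Type} [MeasurableSpace Ω] (μ : Measure Ω) [IsProbabilityMeasure μ]
      (B : ℝ≥0 → Ω → ℝ) (hmeas : ∀ t, Measurable (B t)) (hB : IsBrownianReal B μ) :
      IsGaussianModel n TimeInterval lebesgueTime
        (fun f => μ.map (whiteNoisePath n B f))
  | sequence {Ω : Type} [MeasurableSpace Ω] (μ : Measure Ω) [IsProbabilityMeasure μ]
      {M : Type} [Countable M] [MeasurableSpace M] [DiscreteMeasurableSpace M]
      (z : M → Ω → ℝ) (hmeas : ∀ i, Measurable (z i)) (hindep : iIndepFun z μ)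
      (hlaw : ∀ i, HasLaw (z i) (gaussianReal 0 1) μ) :
      IsGaussianModel n M Measure.count
        (fun f => μ.map (noisySequence n z f))

/-! ### Moduli of continuity -/

/-- `z_α = Φ⁻¹(1 - α)`, the upper `α` quantile of the standard normal distribution. -/
def zq (α : ℝ) : ℝ := sInf {x : ℝ | 1 - α ≤ cdf (gaussianReal 0 1) x}

section Generic

variable {ι : Type} [MeasurableSpace ι]

/-- The ordered modulus
`ω(ε, F, G) = sup {Tg - Tf : ‖g - f‖₂ ≤ ε, f ∈ F, g ∈ G}`, a supremum in `[-∞, ∞]`. -/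
def orderedModulus (ν : Measure ι) (T : (ι → ℝ) →ₗ[ℝ] ℝ) (ε : ℝ) (F G : Set (ι → ℝ)) : EReal :=
  sSup {x : EReal | ∃ f ∈ F, ∃ g ∈ G,
    eLpNorm (g - f) 2 ν ≤ ENNReal.ofReal ε ∧ x = ((T g - T f : ℝ) : EReal)}

/-- The between class modulus
`ω₊(ε, F, G) = sup {|Tg - Tf| : ‖g - f‖₂ ≤ ε, f ∈ F, g ∈ G}`. -/
def betweenModulus (ν : Measure ι) (T : (ι → ℝ) →ₗ[ℝ] ℝ) (ε : ℝ) (F G : Set (ι → ℝ)) : EReal :=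
  sSup {x : EReal | ∃ f ∈ F, ∃ g ∈ G,
    eLpNorm (g - f) 2 ν ≤ ENNReal.ofReal ε ∧ x = ((|T g - T f| : ℝ) : EReal)}

/-- `G_m = F_1 ∪ ⋯ ∪ F_m`. -/
def partialUnion (F : ℕ → Set (ι → ℝ)) (m : ℕ) : Set (ι → ℝ) :=
  ⋃ l ∈ Finset.Icc 1 m, F l

/-- `C.Hull(G_m)`. -/
def hullUnion (F : ℕ → Set (ι → ℝ)) (m : ℕ) : Set (ι → ℝ) :=
  convexHull ℝ (partialUnion F m)

/-- Condition C for `F_1, …, F_k` with constants `C₁`, `C₂` and range `0 < ε < ε₀`. -/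
def ConditionC (ν : Measure ι) (T : (ι → ℝ) →ₗ[ℝ] ℝ) (F : ℕ → Set (ι → ℝ)) (k : ℕ)
    (C₁ C₂ ε₀ : ℝ) : Prop :=
  ∀ j, 1 ≤ j → j ≤ k → ∀ ε : ℝ, 0 < ε → ε < ε₀ →
    (orderedModulus ν T ε (hullUnion F j) (hullUnion F k)
        ≤ (C₁ : EReal) * orderedModulus ν T ε (partialUnion F j) (partialUnion F k) ∧
      (C₁ : EReal) * orderedModulus ν T ε (partialUnion F j) (partialUnion F k)
        ≤ (C₂ : EReal) * orderedModulus ν T ε (F j) (F k)) ∧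
    (orderedModulus ν T ε (hullUnion F k) (hullUnion F j)
        ≤ (C₁ : EReal) * orderedModulus ν T ε (partialUnion F k) (partialUnion F j) ∧
      (C₁ : EReal) * orderedModulus ν T ε (partialUnion F k) (partialUnion F j)
        ≤ (C₂ : EReal) * orderedModulus ν T ε (F k) (F j))

/-! ### Confidence intervals -/

/-- A confidence interval based on the data: to each data point `y` an interval `CI y` of the real
line (possibly empty, unbounded, not closed), jointly measurably. -/
structure IsInterval (CI : (ι → ℝ) → Set ℝ) : Prop where
  ordConnected : ∀ y, (CI y).OrdConnected
  measurable : MeasurableSet {p : (ι → ℝ) × ℝ | p.2 ∈ CI p.1}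

/-- The class `I_{α, F}` of confidence intervals for `Tf` with coverage probability at least
`1 - α` over `F`. -/
def confidenceIntervals (P : (ι → ℝ) → Measure (ι → ℝ)) (T : (ι → ℝ) →ₗ[ℝ] ℝ) (α : ℝ)
    (F : Set (ι → ℝ)) : Set ((ι → ℝ) → Set ℝ) :=
  {CI | IsInterval CI ∧ ∀ f ∈ F, ENNReal.ofReal (1 - α) ≤ P f {y | T f ∈ CI y}}

/-- The maximum expected length `L(CI, G) = sup_{f ∈ G} E_f L(CI)`. -/
def maxExpectedLength (P : (ι → ℝ) → Measure (ι → ℝ)) (CI : (ι → ℝ) → Set ℝ)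
    (G : Set (ι → ℝ)) : ℝ≥0∞ :=
  ⨆ f ∈ G, ∫⁻ y, volume (CI y) ∂(P f)

/-- The benchmark `L*_α(F₁, F) = inf_{CI ∈ I_{α, F}} L(CI, F₁)`. -/
def optimalLength (P : (ι → ℝ) → Measure (ι → ℝ)) (T : (ι → ℝ) →ₗ[ℝ] ℝ) (α : ℝ)
    (F₁ F : Set (ι → ℝ)) : ℝ≥0∞ :=
  ⨅ CI ∈ confidenceIntervals P T α F, maxExpectedLength P CI F₁

/-! ### Linear estimators with controlled bias and variance -/

/-- Linear estimators: `a + ∫ w dY` with `w ∈ L²` in the white noise model and `a + ∑ w_i Y(i)`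
with `w ∈ ℓ²` in the sequence model. The stochastic integral and the infinite sum are mean square
limits of finite combinations `a_m + ∑_t c_m(t) Y(t)`, under every `P_f`. -/
def IsLinearEstimator (ν : Measure ι) (P : (ι → ℝ) → Measure (ι → ℝ))
    (S : (ι → ℝ) → ℝ) : Prop :=
  Measurable S ∧ ∃ (a : ℕ → ℝ) (c : ℕ → ι →₀ ℝ), ∀ f : ι → ℝ, MemLp f 2 ν →
    Tendsto (fun m => eLpNorm (fun y => S y - (a m + (c m).sum fun t x => x * y t)) 2 (P f))
      atTop (𝓝 0)

/-- `ω'_{i,j} = ω(z_{α/2} / √n, C.Hull(G_i), C.Hull(G_j))`. -/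
def hullModulus (ν : Measure ι) (T : (ι → ℝ) →ₗ[ℝ] ℝ) (n α : ℝ) (F : ℕ → Set (ι → ℝ))
    (i j : ℕ) : EReal :=
  orderedModulus ν T (zq (α / 2) / Real.sqrt n) (hullUnion F i) (hullUnion F j)

/-- `S` is an estimator `T̂'_{i,j}`: a linear estimator with
`Var S ≤ ω'_{i,j}² / z_{α/2}²`, with bias at least `-ω'_{i,j} / 2` on `G_j`, and with bias at most
`ω'_{i,j} / 2` on `G_i`. -/
structure IsBalancedEstimator (ν : Measure ι) (P : (ι → ℝ) → Measure (ι → ℝ))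
    (T : (ι → ℝ) →ₗ[ℝ] ℝ) (n α : ℝ) (F : ℕ → Set (ι → ℝ)) (i j : ℕ)
    (S : (ι → ℝ) → ℝ) : Prop where
  linear : IsLinearEstimator ν P S
  variance_le : ∀ f : ι → ℝ, MemLp f 2 ν →
    ((variance S (P f) : ℝ) : EReal)
      ≤ ((1 / zq (α / 2) ^ 2 : ℝ) : EReal) * hullModulus ν T n α F i j ^ 2
  bias_ge : ∀ f ∈ partialUnion F j,
    -(((1 / 2 : ℝ) : EReal) * hullModulus ν T n α F i j)
      ≤ (((∫ y, S y ∂(P f)) - T f : ℝ) : EReal)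
  bias_le : ∀ f ∈ partialUnion F i,
    (((∫ y, S y ∂(P f)) - T f : ℝ) : EReal)
      ≤ ((1 / 2 : ℝ) : EReal) * hullModulus ν T n α F i j

/-! ### The adaptive confidence interval -/

/-- `ξ'_j = ω₊(z_{α/2} / √n, C.Hull(G_j), C.Hull(G_k))`. -/
def xi (ν : Measure ι) (T : (ι → ℝ) →ₗ[ℝ] ℝ) (n α : ℝ) (F : ℕ → Set (ι → ℝ))
    (k j : ℕ) : EReal :=
  betweenModulus ν T (zq (α / 2) / Real.sqrt n) (hullUnion F j) (hullUnion F k)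

/-- The factor of `ξ'_j` in the half length of the interval: `2` when `α ≤ 0.2`, otherwise `3`. -/
def widthFactor (α : ℝ) : ℝ := if α ≤ 1 / 5 then 2 else 3

/-- `(T̂'_{j,k} - T̂'_{k,j})₊ + 2 ξ'_j` (with `3 ξ'_j` instead when `α > 0.2`), for a family
`That` of estimators. -/
def halfLength (ν : Measure ι) (T : (ι → ℝ) →ₗ[ℝ] ℝ) (n α : ℝ) (F : ℕ → Set (ι → ℝ)) (k : ℕ)
    (That : ℕ → ℕ → (ι → ℝ) → ℝ) (j : ℕ) (y : ι → ℝ) : EReal :=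
  ((max (That j k y - That k j y) 0 : ℝ) : EReal) + (widthFactor α : EReal) * xi ν T n α F k j

/-- The interval `CI*_j`, centred at `(T̂'_{j,k} + T̂'_{k,j}) / 2`. It is the whole line when
`ξ'_j = ∞`. -/
def pilotInterval (ν : Measure ι) (T : (ι → ℝ) →ₗ[ℝ] ℝ) (n α : ℝ) (F : ℕ → Set (ι → ℝ)) (k : ℕ)
    (That : ℕ → ℕ → (ι → ℝ) → ℝ) (j : ℕ) (y : ι → ℝ) : Set ℝ :=
  {x : ℝ |
    (((That j k y + That k j y) / 2 : ℝ) : EReal) - halfLength ν T n α F k That j y ≤ (x : EReal) ∧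
    (x : EReal) ≤ (((That j k y + That k j y) / 2 : ℝ) : EReal) + halfLength ν T n α F k That j y}

/-- `J 1 < ⋯ < J m = k` is the subsequence of `1, …, k` with `ξ_{J i} ≥ 2 ξ_{J (i-1)}` and
`ξ_{J i} < 2 ξ_l` for all `J (i-1) < l < J i`, for `1 ≤ i ≤ m`, where `J 0 = 0` and `ξ_0 = 0`
(so that the first inequality is void for `i = 1`). -/
structure IsDoublingSubsequence (ξ : ℕ → EReal) (k m : ℕ) (J : ℕ → ℕ) : Prop where
  zero : J 0 = 0
  last : J m = k
  strictMono : ∀ i < m, J i < J (i + 1)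
  doubling : ∀ i, 1 ≤ i → i < m → 2 * ξ (J i) ≤ ξ (J (i + 1))
  gap : ∀ i < m, ∀ l, J i < l → l < J (i + 1) → ξ (J (i + 1)) < 2 * ξ l

/-- `CI` is the adaptive confidence interval `CI* = CI*_ĵ`, for estimators `T̂'_{i,j}` with the
bias and variance bounds, where `ĵ` is the index of a shortest interval among the `CI*_j` along
the subsequence (ties are broken in any measurable way). -/
def IsAdaptiveInterval (ν : Measure ι) (P : (ι → ℝ) → Measure (ι → ℝ))
    (T : (ι → ℝ) →ₗ[ℝ] ℝ) (n α : ℝ) (F : ℕ → Set (ι → ℝ)) (k : ℕ)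
    (CI : (ι → ℝ) → Set ℝ) : Prop :=
  ∃ (That : ℕ → ℕ → (ι → ℝ) → ℝ) (m : ℕ) (J : ℕ → ℕ) (jhat : (ι → ℝ) → ℕ),
    (∀ i j, 1 ≤ i → i ≤ k → 1 ≤ j → j ≤ k → IsBalancedEstimator ν P T n α F i j (That i j)) ∧
    IsDoublingSubsequence (xi ν T n α F k) k m J ∧
    Measurable jhat ∧
    (∀ y, (∃ i, 1 ≤ i ∧ i ≤ m ∧ jhat y = J i) ∧
      ∀ i, 1 ≤ i → i ≤ m →
        volume (pilotInterval ν T n α F k That (jhat y) y)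
          ≤ volume (pilotInterval ν T n α F k That (J i) y)) ∧
    CI = fun y => pilotInterval ν T n α F k That (jhat y) y

end Generic

end NearlyNested

end

/-! Upper bound. Both models are Gaussian shift models (`IsGaussianModel.exists_isShiftModel`), so
every linear estimator is Gaussian. For convex classes, Hahn-Banach separation of the pairs `(g - f,
Tg - Tf)` from a box produces a weight `w` whose norm and bias are both controlled by the ordered
modulus (`exists_inner_dominating`); a suitable constant term then balances the bias, which gives
the required estimators.

Write `x` for `ξ'_j`, `τ` for `Tf` and `z` for `z_{α/2}`. Over all of `G_k`, `U = T̂'_{j,k}` has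
bias at least `-x/2`, `V = T̂'_{k,j}` has bias at most `x/2`, and both standard deviations are at
most `x/z`. Hence one pilot interval misses `τ` with small probability (`miss_le`), and with far
smaller probability when the half length of means `(EU - EV)₊ + κx` is large compared with `x`
(`miss_far_le`). Let `M` be the smallest half length of means along the subsequence. Scales with `κx
> 3M` are selected only if the interval attaining `M` is unusually long. Among the remaining scales,
doubling makes `x` at most `2^{-d}` times the largest one at distance `d` from the top. The four
nearest scales cost a Gaussian tail each side, and the others form a summable series. The total is
at most `2 P(Z > z) = α`, whatever the number of classes (`measure_shortest_misses_le`,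
`sum_missBound_le`). The two values of `κ` are what this numerical inequality needs for `z ≥ 1.2`
and `z ≥ 0.65`.

On `F_j` the selected interval is no longer than the one at the first subsequence index at or beyond
`j`. At that index both estimators have two-sided bias bounds on `F_j`, and its scale is at most
`2ξ'_j`; so the expected length is `O(ξ'_j)`, which Condition C bounds by `C₂` times the modulus
between `F_j` and `F_k`.

Lower bound. Parameters at distance `δ/√n` give laws within `δ + δ²/2` of each other on every event,
so an interval covering at both must often contain both values of `T` (`le_expectedLength`). Pairs
at distance `z/√n` are contracted to distance `δ/√n` by mixing them with a pair at distance
`δ/(2√n)` whose oscillation is almost nonnegative. Such pairs exist, even for disjoint classes,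
because the hulls are nested and Condition C transfers nonnegativity of the modulus to `F_j` and
`F_k`. -/

namespace NearlyNested

/-! ### Tails of the standard normal distribution -/

/-- The upper tail `P(Z > x)` of a standard normal variable. -/
noncomputable def normalTail (x : ℝ) : ℝ := (gaussianReal 0 1).real (Set.Ioi x)

lemma normalTail_nonneg (x : ℝ) : 0 ≤ normalTail x := measureReal_nonneg

lemma normalTail_anti : Antitone normalTail := fun _ _ h =>
  measureReal_mono (Set.Ioi_subset_Ioi h)

lemma stdPDF_eq (t : ℝ) :
    gaussianPDFReal 0 1 t = (√(2 * Real.pi))⁻¹ * Real.exp (-t ^ 2 / 2) := by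
  simp [gaussianPDFReal_def]

lemma normalTail_eq_integral (x : ℝ) :
    normalTail x = ∫ t in Set.Ioi x, gaussianPDFReal 0 1 t := by
  rw [normalTail, measureReal_def, gaussianReal_apply_eq_integral 0 one_ne_zero,
    ENNReal.toReal_ofReal]
  exact setIntegral_nonneg measurableSet_Ioi fun t _ => gaussianPDFReal_nonneg _ _ _

lemma normalTail_sub (x y : ℝ) :
    normalTail x - normalTail y = ∫ t in x..y, gaussianPDFReal 0 1 t := by
  rw [normalTail_eq_integral, normalTail_eq_integral]
  exact intervalIntegral.integral_Ioi_sub_Ioi' (integrable_gaussianPDFReal 0 1).integrableOn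
    (integrable_gaussianPDFReal 0 1).integrableOn

/-- After the substitution `t ↦ t + h` the density is multiplied by `exp (-th - h²/2)`, which is
largest at the endpoint `t = x`. -/
lemma normalTail_add_le (x : ℝ) {h : ℝ} (hh : 0 ≤ h) :
    normalTail (x + h) ≤ Real.exp (-(x * h) - h ^ 2 / 2) * normalTail x := by
  have e : normalTail (x + h) = ∫ t in Set.Ioi x, gaussianPDFReal 0 1 (t + h) := by
    rw [normalTail_eq_integral, ← (measurePreserving_add_right volume h).setIntegral_preimage_emb
      (measurableEmbedding_addRight h)]
    congr 2
    ext t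
    simp
  rw [e, normalTail_eq_integral, ← integral_const_mul]
  refine setIntegral_mono_on ((integrable_gaussianPDFReal 0 1).comp_add_right h).integrableOn
    ((integrable_gaussianPDFReal 0 1).integrableOn.const_mul _) measurableSet_Ioi fun t ht => ?_
  rw [stdPDF_eq, stdPDF_eq, mul_left_comm, ← Real.exp_add]
  gcongr
  nlinarith [mul_nonneg hh (sub_nonneg.2 (le_of_lt (Set.mem_Ioi.1 ht)))]

lemma normalTail_mul_le {a z : ℝ} (ha : 1 ≤ a) (hz : 0 ≤ z) :
    normalTail (a * z) ≤ Real.exp (-((a ^ 2 - 1) * z ^ 2 / 2)) * normalTail z := by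
  have := normalTail_add_le z (h := (a - 1) * z) (mul_nonneg (by linarith) hz)
  convert this using 2
  · ring
  · congr 1; ring

/-- Widening the offset from `c` to `h` adds the density over `(x - h, x - c)` and removes it over
`(x + c, x + h)`; the density at `x - s` dominates that at `x + s`. This lets an unknown bias be
replaced by its extreme value. -/
lemma normalTail_add_normalTail_le {x c h : ℝ} (hc : |c| ≤ h) (hx : h ≤ x) :
    normalTail (x - c) + normalTail (x + c) ≤ normalTail (x - h) + normalTail (x + h) := by
  wlog hc0 : 0 ≤ c generalizing c
  · have := this (c := -c) (by rwa [abs_neg]) (by linarith)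
    simp only [sub_neg_eq_add, ← sub_eq_add_neg] at this
    linarith
  rw [abs_of_nonneg hc0] at hc
  have h1 : normalTail (x - h) - normalTail (x - c)
      = ∫ s in c..h, gaussianPDFReal 0 1 (x - s) := by
    rw [normalTail_sub, intervalIntegral.integral_comp_sub_left]
  have h2 : normalTail (x + c) - normalTail (x + h)
      = ∫ s in c..h, gaussianPDFReal 0 1 (x + s) := by
    rw [normalTail_sub, intervalIntegral.integral_comp_add_left]
  have hcont : Continuous (gaussianPDFReal 0 1) := by
    simp_rw [funext stdPDF_eq]
    fun_prop
  have h3 : ∫ s in c..h, gaussianPDFReal 0 1 (x + s)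
      ≤ ∫ s in c..h, gaussianPDFReal 0 1 (x - s) := by
    refine intervalIntegral.integral_mono_on hc
      (Continuous.intervalIntegrable (by fun_prop) _ _)
      (Continuous.intervalIntegrable (by fun_prop) _ _) fun s hs => ?_
    rw [stdPDF_eq, stdPDF_eq]
    refine mul_le_mul_of_nonneg_left (Real.exp_le_exp.2 ?_) (by positivity)
    nlinarith [hs.1, hs.2, mul_nonneg (sub_nonneg.2 hx) (sub_nonneg.2 (hc0.trans hs.1)),
      mul_nonneg (hc0.trans (hs.1.trans hs.2)) (hc0.trans hs.1)]
  linarith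

lemma normalTail_zero : normalTail 0 = 1 / 2 := by
  have hna : NullSingletonClass (gaussianReal 0 1) := nullSingletonClass_gaussianReal one_ne_zero
  have h1 : (gaussianReal 0 1).real (Set.Iio 0) = normalTail 0 := by
    have := gaussianReal_map_neg (μ := 0) (v := 1)
    rw [neg_zero] at this
    rw [normalTail]
    conv_rhs => rw [← this]
    rw [measureReal_def, measureReal_def, Measure.map_apply (by fun_prop) measurableSet_Ioi]
    congr 2
    ext t
    simp
  have h2 : (gaussianReal 0 1).real (Set.Iio 0) = (gaussianReal 0 1).real (Set.Iic 0) :=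
    measureReal_congr Iio_ae_eq_Iic
  have h3 := probReal_compl_eq_one_sub (μ := gaussianReal 0 1) (s := Set.Iic (0 : ℝ))
    measurableSet_Iic
  rw [Set.compl_Iic] at h3
  change normalTail 0 = _ at h3
  linarith

lemma normalTail_eq_one_sub_cdf (x : ℝ) : normalTail x = 1 - cdf (gaussianReal 0 1) x := by
  rw [cdf_eq_real, ← probReal_compl_eq_one_sub measurableSet_Iic, Set.compl_Iic, normalTail]

lemma normalTail_continuous : Continuous normalTail := by
  have : normalTail = fun x => normalTail 0 - ∫ t in (0 : ℝ)..x, gaussianPDFReal 0 1 t := by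
    funext x
    rw [← normalTail_sub]
    ring
  rw [this]
  exact continuous_const.sub (intervalIntegral.continuous_primitive
    (fun _ _ => (integrable_gaussianPDFReal 0 1).intervalIntegrable) 0)

/-- Integrates the majorant `1 - t²/2 + t⁴/8` of `exp (-t²/2)` over `[0, x]`. The constant `0.39906`
exceeds `1/√(2π)`, as `π > 3.14` already shows. -/
lemma lt_normalTail {x : ℝ} (hx : 0 ≤ x) :
    1 / 2 - 0.39906 * (x - x ^ 3 / 6 + x ^ 5 / 40) ≤ normalTail x := by
  have h1 := normalTail_sub 0 x
  have hs : (√(2 * Real.pi))⁻¹ ≤ 0.39906 := by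
    rw [inv_le_comm₀ (by positivity) (by norm_num)]
    apply Real.le_sqrt_of_sq_le
    have := Real.pi_gt_d2
    norm_num at this ⊢
    linarith
  have hexp : ∀ u : ℝ, 0 ≤ u → Real.exp (-u) ≤ 1 - u + u ^ 2 / 2 := by
    intro u hu
    have h2 := Real.sum_le_exp_of_nonneg hu 4
    simp only [Finset.sum_range_succ, Finset.sum_range_zero, Nat.factorial] at h2
    norm_num at h2
    rw [Real.exp_neg, inv_le_comm₀ (Real.exp_pos _) (by nlinarith [sq_nonneg (u - 1)])]
    refine le_trans ?_ h2
    rw [inv_le_iff_one_le_mul₀ (by nlinarith [sq_nonneg (u - 1)])]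
    nlinarith [pow_nonneg hu 3, pow_nonneg hu 4, pow_nonneg hu 5, sq_nonneg (u ^ 2 - u)]
  have h3 : ∫ t in (0 : ℝ)..x, gaussianPDFReal 0 1 t
      ≤ ∫ t in (0 : ℝ)..x, 0.39906 * (1 - t ^ 2 / 2 + t ^ 4 / 8) := by
    refine intervalIntegral.integral_mono_on hx
      (integrable_gaussianPDFReal 0 1).intervalIntegrable
      (Continuous.intervalIntegrable (by fun_prop) _ _) fun t _ => ?_
    rw [stdPDF_eq]
    have := hexp (t ^ 2 / 2) (by positivity)
    rw [← neg_div] at this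
    refine mul_le_mul hs (this.trans (le_of_eq (by ring))) (Real.exp_pos _).le (by norm_num)
  have h4 : ∫ t in (0 : ℝ)..x, 0.39906 * (1 - t ^ 2 / 2 + t ^ 4 / 8)
      = 0.39906 * (x - x ^ 3 / 6 + x ^ 5 / 40) := by
    rw [intervalIntegral.integral_const_mul, intervalIntegral.integral_add,
      intervalIntegral.integral_sub, intervalIntegral.integral_div, intervalIntegral.integral_div,
      integral_pow, integral_pow]
    · norm_num
      ring
    all_goals exact Continuous.intervalIntegrable (by fun_prop) _ _
  rw [normalTail_zero] at h1
  linarith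

/-! ### Quantiles -/

lemma normalTail_zq {β : ℝ} (h0 : 0 < β) (h1 : β < 1) : normalTail (zq β) = β := by
  set S : Set ℝ := {x : ℝ | 1 - β ≤ cdf (gaussianReal 0 1) x} with hS
  have hmem : ∀ x, x ∈ S ↔ normalTail x ≤ β := by
    intro x
    rw [hS, Set.mem_ofPred_eq, normalTail_eq_one_sub_cdf]
    constructor <;> intro h <;> linarith
  have htop : Tendsto normalTail atTop (𝓝 0) := by
    have := (tendsto_cdf_atTop (gaussianReal 0 1)).const_sub 1
    rw [sub_self] at this
    exact this.congr fun x => (normalTail_eq_one_sub_cdf x).symm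
  have hbot : Tendsto normalTail atBot (𝓝 1) := by
    have := (tendsto_cdf_atBot (gaussianReal 0 1)).const_sub 1
    rw [sub_zero] at this
    exact this.congr fun x => (normalTail_eq_one_sub_cdf x).symm
  have hne : S.Nonempty := by
    obtain ⟨x, hx⟩ := (htop.eventually (gt_mem_nhds h0)).exists
    exact ⟨x, (hmem x).2 hx.le⟩
  obtain ⟨y, hy⟩ := (hbot.eventually (lt_mem_nhds h1)).exists
  have hbdd : BddBelow S := by
    refine ⟨y, fun x hx => ?_⟩
    by_contra hlt
    have := normalTail_anti (not_le.1 hlt).le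
    have := (hmem x).1 hx
    linarith
  have hclosed : IsClosed S := by
    have : S = normalTail ⁻¹' Set.Iic β := by
      ext x
      exact hmem x
    rw [this]
    exact isClosed_Iic.preimage normalTail_continuous
  have hin : zq β ∈ S := hclosed.csInf_mem hne hbdd
  refine le_antisymm ((hmem _).1 hin) ?_
  by_contra hlt
  obtain ⟨x, hx, hx'⟩ : ∃ x, x < zq β ∧ normalTail x < β := by
    have := (normalTail_continuous.tendsto (zq β)).eventually (gt_mem_nhds (not_le.1 hlt))
    have h2 : ∀ᶠ x in 𝓝[<] zq β, normalTail x < β := this.filter_mono nhdsWithin_le_nhds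
    obtain ⟨x, hx⟩ := (h2.and self_mem_nhdsWithin).exists
    exact ⟨x, hx.2, hx.1⟩
  exact absurd (csInf_le hbdd ((hmem x).2 hx'.le)) (not_le.2 hx)

lemma lt_zq_of_lt_normalTail {β x : ℝ} (h0 : 0 < β) (h1 : β < 1) (hx : β < normalTail x) :
    x < zq β := by
  by_contra h
  have := normalTail_anti (not_lt.1 h)
  rw [normalTail_zq h0 h1] at this
  linarith

/-- With `β = α / 2`, this covers every `α < 1/2`; the next bound covers `α ≤ 1/5`. They correspond
to width factors `3` and `2`. -/
lemma zq_gt_of_lt_quarter {β : ℝ} (h0 : 0 < β) (h1 : β < 1 / 4) : 0.65 < zq β :=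
  lt_zq_of_lt_normalTail h0 (by linarith)
    (lt_of_lt_of_le (by norm_num; linarith) (lt_normalTail (by norm_num)))

lemma zq_gt_of_le_tenth {β : ℝ} (h0 : 0 < β) (h1 : β ≤ 1 / 10) : 1.2 < zq β :=
  lt_zq_of_lt_normalTail h0 (by linarith)
    (lt_of_lt_of_le (by norm_num; linarith) (lt_normalTail (by norm_num)))

/-! ### Gaussian deviation inequalities -/

section Deviation

variable {Ω : Type*} {mΩ : MeasurableSpace Ω} {μ : Measure Ω} {X : Ω → ℝ}

lemma measureReal_lt_le_normalTail (hX : HasGaussianLaw X μ) {σ a t : ℝ} (hσ : 0 ≤ σ)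
    (ha : 0 ≤ a) (hvar : Var[X; μ] ≤ σ ^ 2) (ht : t ≤ μ[X] - a * σ) :
    μ.real {ω | X ω < t} ≤ normalTail a := by
  have hlaw := hX.map_eq_gaussianReal
  have hXm := hX.aemeasurable
  have e1 : μ.real {ω | X ω < t} = (gaussianReal μ[X] Var[X; μ].toNNReal).real (Set.Iio t) := by
    rw [← hlaw, measureReal_def, measureReal_def,
      Measure.map_apply_of_aemeasurable hXm measurableSet_Iio]
    rfl
  rw [e1]
  rcases eq_or_ne Var[X; μ].toNNReal 0 with h0 | h0
  · rw [h0, gaussianReal_zero_var, measureReal_def, Measure.dirac_apply' _ measurableSet_Iio]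
    rw [Set.indicator_of_notMem]
    · simpa using normalTail_nonneg a
    · simp only [Set.mem_Iio, not_lt]
      nlinarith [mul_nonneg ha hσ]
  · set v := Var[X; μ] with hv
    have hvpos : 0 < v := by
      by_contra h
      exact h0 (Real.toNNReal_of_nonpos (not_lt.1 h))
    set s := √v with hs
    have hspos : 0 < s := Real.sqrt_pos.2 hvpos
    have hsσ : s ≤ σ := Real.sqrt_le_iff.2 ⟨hσ, hvar⟩
    -- The minus sign turns the lower tail of `X` directly into an upper tail of the standard
    -- normal.
    have hmap : gaussianReal μ[X] v.toNNReal = (gaussianReal 0 1).map (fun x => μ[X] - s * x) := by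
      have h1 := gaussianReal_map_const_mul (μ := 0) (v := 1) s
      have h2 := gaussianReal_map_const_sub (μ := s * 0)
        (v := .mk (s ^ 2) (sq_nonneg _) * 1) μ[X]
      rw [← h1, Measure.map_map (by fun_prop) (by fun_prop)] at h2
      change Measure.map (fun x => μ[X] - s * x) _ = _ at h2
      rw [h2, mul_zero, sub_zero, mul_one]
      congr 1
      ext
      simp [hs, Real.sq_sqrt hvpos.le, hvpos.le]
    rw [hmap, measureReal_def, Measure.map_apply (by fun_prop) measurableSet_Iio, normalTail,
      ← measureReal_def]
    refine measureReal_mono fun x hx => ?_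
    simp only [Set.mem_preimage, Set.mem_Iio, Set.mem_Ioi] at hx ⊢
    by_contra hle
    have : s * x ≤ s * a := mul_le_mul_of_nonneg_left (not_lt.1 hle) hspos.le
    nlinarith [mul_le_mul_of_nonneg_left hsσ ha]

end Deviation

/-! ### Total error budget -/

/-- Bound for the noncoverage probability of the pilot interval whose half length is at distance
`d` from the critical dyadic scale. -/
noncomputable def missBound (κ z : ℝ) (d : ℕ) : ℝ :=
  if d < 4 then normalTail ((κ - 1 / 2) * z) + normalTail ((κ + 1 / 2) * z)
  else 2 * normalTail (((κ - 1) / 4 + 4 * κ / 3 * 2 ^ (d - 4)) * z)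

lemma missBound_nonneg (κ z : ℝ) (d : ℕ) : 0 ≤ missBound κ z d := by
  have := normalTail_nonneg
  unfold missBound
  split_ifs <;> [exact add_nonneg (this _) (this _); exact mul_nonneg two_pos.le (this _)]

/-- Since `2^r ≥ 1 + r`, the squared coefficient grows by at least `8r`. With `z² ≥ 0.4225` this
gains a factor `exp (-r) ≤ 2^{-r}`, so the far scales sum geometrically. -/
lemma normalTail_far_le {κ z : ℝ} (hκ : 2 ≤ κ) (hz : 0.65 ≤ z) (r : ℕ) :
    normalTail (((κ - 1) / 4 + 4 * κ / 3 * 2 ^ r) * z)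
      ≤ (1 / 2) ^ r * (Real.exp (-((((κ - 1) / 4 + 4 * κ / 3) ^ 2 - 1) * z ^ 2 / 2))
        * normalTail z) := by
  have hp : (1 : ℝ) + r ≤ 2 ^ r := by
    have := one_add_mul_le_pow (a := (1 : ℝ)) (by norm_num) r
    norm_num at this
    linarith
  have hr : (0 : ℝ) ≤ r := r.cast_nonneg
  have hz2 : 0.4225 ≤ z ^ 2 := by nlinarith
  refine (normalTail_mul_le (by nlinarith) (by linarith)).trans ?_
  rw [← mul_assoc]
  refine mul_le_mul_of_nonneg_right ?_ (normalTail_nonneg z)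
  have e : ((1 : ℝ) / 2) ^ r ≥ Real.exp (-r) := by
    rw [show (-(r : ℝ)) = r * (-1) by ring, Real.exp_nat_mul]
    refine pow_le_pow_left₀ (Real.exp_pos _).le ?_ r
    rw [Real.exp_neg, one_div]
    refine inv_anti₀ two_pos ?_
    have := Real.add_one_le_exp (1 : ℝ)
    linarith
  refine le_trans ?_ (mul_le_mul_of_nonneg_right e (Real.exp_pos _).le)
  rw [← Real.exp_add, Real.exp_le_exp]
  set p : ℝ := 2 ^ r
  have h1 : 4 * κ / 3 * r ≤ 4 * κ / 3 * (p - 1) := by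
    refine mul_le_mul_of_nonneg_left (by linarith) (by linarith)
  have h2 : 8 * r ≤ ((κ - 1) / 4 + 4 * κ / 3 * p) ^ 2 - ((κ - 1) / 4 + 4 * κ / 3) ^ 2 := by
    have : ((κ - 1) / 4 + 4 * κ / 3 * p) ^ 2 - ((κ - 1) / 4 + 4 * κ / 3) ^ 2
      = (4 * κ / 3 * (p - 1)) * ((κ - 1) / 2 + 4 * κ / 3 * (p + 1)) := by ring
    rw [this]
    have h3 : 8 / 3 * r ≤ 4 * κ / 3 * r := by nlinarith
    have h4 : 3 ≤ (κ - 1) / 2 + 4 * κ / 3 * (p + 1) := by nlinarith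
    nlinarith
  nlinarith

/-- Nine terms of the exponential series reduce each numerical bound below to rational arithmetic.
-/
lemma exp_neg_le_inv {x c y : ℝ} (hc : 0 < c) (hy : 0 ≤ y) (hxy : y ≤ x)
    (h : c ≤ ∑ i ∈ Finset.range 9, y ^ i / (i.factorial : ℝ)) : Real.exp (-x) ≤ c⁻¹ := by
  rw [Real.exp_neg]
  exact inv_anti₀ hc (h.trans ((Real.sum_le_exp_of_nonneg hy 9).trans (Real.exp_le_exp.2 hxy)))

/-- Every term is compared with `normalTail z` through `normalTail_mul_le`. The four near scales,
the geometric series of far scales and the last tail have total coefficient below `1.90` for `κ = 2`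
and below `1.98` for `κ = 3`, uniformly in `N`. -/
lemma sum_missBound_le (κ z : ℝ) (hκz : (κ = 2 ∧ 1.2 ≤ z) ∨ (κ = 3 ∧ 0.65 ≤ z)) (N : ℕ) :
    ∑ d ∈ Finset.range N, missBound κ z d + normalTail (κ * z) ≤ 2 * normalTail z := by
  have hκ2 : 2 ≤ κ := by rcases hκz with h | h <;> linarith [h.1]
  have hz0 : 0.65 ≤ z := by
    rcases hκz with h | h
    · have := h.2; norm_num at this ⊢; linarith
    · exact h.2
  have hQ := normalTail_nonneg z
  set E := Real.exp (-((((κ - 1) / 4 + 4 * κ / 3) ^ 2 - 1) * z ^ 2 / 2)) with hE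
  have hE0 : 0 ≤ E := (Real.exp_pos _).le
  have hgeo : ∀ M : ℕ, ∑ r ∈ Finset.range M, ((1 : ℝ) / 2) ^ r ≤ 2 := by
    intro M
    have := sum_geometric_two_le M
    exact this
  have hsum : ∑ d ∈ Finset.range N, missBound κ z d
      ≤ 4 * (normalTail ((κ - 1 / 2) * z) + normalTail ((κ + 1 / 2) * z))
        + 4 * (E * normalTail z) := by
    calc ∑ d ∈ Finset.range N, missBound κ z d
        ≤ ∑ d ∈ Finset.range (4 + N), missBound κ z d :=
          Finset.sum_le_sum_of_subset_of_nonneg (Finset.range_mono (by omega))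
            fun _ _ _ => missBound_nonneg _ _ _
      _ = ∑ d ∈ Finset.range 4, missBound κ z d
          + ∑ r ∈ Finset.range N, missBound κ z (4 + r) := Finset.sum_range_add _ _ _
      _ ≤ _ := by
          refine add_le_add (le_of_eq ?_) ?_
          · simp only [Finset.sum_range_succ, Finset.sum_range_zero, missBound]
            norm_num
            ring
          · calc ∑ r ∈ Finset.range N, missBound κ z (4 + r)
                ≤ ∑ r ∈ Finset.range N, (1 / 2 : ℝ) ^ r * (2 * (E * normalTail z)) := by
                  refine Finset.sum_le_sum fun r _ => ?_
                  have := normalTail_far_le hκ2 hz0 r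
                  simp only [missBound, show ¬ (4 + r < 4) by omega, if_false,
                    Nat.add_sub_cancel_left]
                  linarith
              _ ≤ 2 * (2 * (E * normalTail z)) := by
                  rw [← Finset.sum_mul]
                  exact mul_le_mul_of_nonneg_right (hgeo N) (by positivity)
              _ = _ := by ring
  have t1 := normalTail_mul_le (a := κ - 1 / 2) (z := z) (by linarith) (by linarith)
  have t2 := normalTail_mul_le (a := κ + 1 / 2) (z := z) (by linarith) (by linarith)
  have t3 := normalTail_mul_le (a := κ) (z := z) (by linarith) (by linarith)
  rcases hκz with ⟨rfl, hz⟩ | ⟨rfl, hz⟩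
  · have hz2 : 1.44 ≤ z ^ 2 := by nlinarith
    have e1 : Real.exp (-(((2 - 1 / 2 : ℝ) ^ 2 - 1) * z ^ 2 / 2)) ≤ (2.45)⁻¹ :=
      exp_neg_le_inv (y := 0.9) (by norm_num) (by norm_num) (by nlinarith)
        (by simp only [Finset.sum_range_succ, Finset.sum_range_zero, Nat.factorial]; norm_num)
    have e2 : Real.exp (-(((2 + 1 / 2 : ℝ) ^ 2 - 1) * z ^ 2 / 2)) ≤ (40)⁻¹ :=
      exp_neg_le_inv (y := 3.78) (by norm_num) (by norm_num) (by nlinarith)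
        (by simp only [Finset.sum_range_succ, Finset.sum_range_zero, Nat.factorial]; norm_num)
    have e3 : Real.exp (-(((2 : ℝ) ^ 2 - 1) * z ^ 2 / 2)) ≤ (8.5)⁻¹ :=
      exp_neg_le_inv (y := 2.16) (by norm_num) (by norm_num) (by nlinarith)
        (by simp only [Finset.sum_range_succ, Finset.sum_range_zero, Nat.factorial]; norm_num)
    have e4 : E ≤ (100)⁻¹ :=
      exp_neg_le_inv (y := 5.4) (by norm_num) (by norm_num) (by nlinarith)
        (by simp only [Finset.sum_range_succ, Finset.sum_range_zero, Nat.factorial]; norm_num)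
    have := mul_le_mul_of_nonneg_right e1 hQ
    have := mul_le_mul_of_nonneg_right e2 hQ
    have := mul_le_mul_of_nonneg_right e3 hQ
    have := mul_le_mul_of_nonneg_right e4 hQ
    norm_num at *
    linarith
  · have hz2 : 0.4225 ≤ z ^ 2 := by nlinarith
    have e1 : Real.exp (-(((3 - 1 / 2 : ℝ) ^ 2 - 1) * z ^ 2 / 2)) ≤ (3.02)⁻¹ :=
      exp_neg_le_inv (y := 1.109) (by norm_num) (by norm_num) (by nlinarith)
        (by simp only [Finset.sum_range_succ, Finset.sum_range_zero, Nat.factorial]; norm_num)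
    have e2 : Real.exp (-(((3 + 1 / 2 : ℝ) ^ 2 - 1) * z ^ 2 / 2)) ≤ (10.5)⁻¹ :=
      exp_neg_le_inv (y := 2.376) (by norm_num) (by norm_num) (by nlinarith)
        (by simp only [Finset.sum_range_succ, Finset.sum_range_zero, Nat.factorial]; norm_num)
    have e3 : Real.exp (-(((3 : ℝ) ^ 2 - 1) * z ^ 2 / 2)) ≤ (5.4)⁻¹ :=
      exp_neg_le_inv (y := 1.69) (by norm_num) (by norm_num) (by nlinarith)
        (by simp only [Finset.sum_range_succ, Finset.sum_range_zero, Nat.factorial]; norm_num)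
    have e4 : E ≤ (50)⁻¹ :=
      exp_neg_le_inv (y := 4.06) (by norm_num) (by norm_num) (by nlinarith)
        (by simp only [Finset.sum_range_succ, Finset.sum_range_zero, Nat.factorial]; norm_num)
    have := mul_le_mul_of_nonneg_right e1 hQ
    have := mul_le_mul_of_nonneg_right e2 hQ
    have := mul_le_mul_of_nonneg_right e3 hQ
    have := mul_le_mul_of_nonneg_right e4 hQ
    norm_num at *
    linarith

/-! ### Mean square limits of Gaussian variables -/

section MeanSquare

variable {Ω : Type*} {mΩ : MeasurableSpace Ω} {μ : Measure Ω}

lemma memLp_two_of_tendsto {X : ℕ → Ω → ℝ} {S : Ω → ℝ} (hX : ∀ m, MemLp (X m) 2 μ)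
    (hS : AEStronglyMeasurable S μ)
    (h : Tendsto (fun m => eLpNorm (S - X m) 2 μ) atTop (𝓝 0)) : MemLp S 2 μ := by
  obtain ⟨m, hm⟩ := (h.eventually (gt_mem_nhds ENNReal.zero_lt_top)).exists
  have : MemLp (S - X m) 2 μ := ⟨hS.sub (hX m).1, hm⟩
  simpa using this.add (hX m)

lemma tendsto_toLp {X : ℕ → Ω → ℝ} {S : Ω → ℝ} (hX : ∀ m, MemLp (X m) 2 μ)
    (hS : MemLp S 2 μ) (h : Tendsto (fun m => eLpNorm (S - X m) 2 μ) atTop (𝓝 0)) :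
    Tendsto (fun m => (hX m).toLp (X m)) atTop (𝓝 (hS.toLp S)) := by
  rw [Lp.tendsto_Lp_iff_tendsto_eLpNorm'']
  exact h.congr fun m => eLpNorm_sub_comm _ _ _ _

lemma inner_toLp_eq_integral {X Y : Ω → ℝ} (hX : MemLp X 2 μ) (hY : MemLp Y 2 μ) :
    inner ℝ (hX.toLp X) (hY.toLp Y) = ∫ ω, X ω * Y ω ∂μ := by
  rw [L2.inner_def]
  refine integral_congr_ae ?_
  filter_upwards [hX.coeFn_toLp, hY.coeFn_toLp] with ω h1 h2
  rw [h1, h2]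
  simp [mul_comm]

lemma tendsto_integral_mul {X Y : ℕ → Ω → ℝ} {S R : Ω → ℝ} (hX : ∀ m, MemLp (X m) 2 μ)
    (hS : MemLp S 2 μ) (h : Tendsto (fun m => eLpNorm (S - X m) 2 μ) atTop (𝓝 0))
    (hY : ∀ m, MemLp (Y m) 2 μ)
    (hR : MemLp R 2 μ) (h' : Tendsto (fun m => eLpNorm (R - Y m) 2 μ) atTop (𝓝 0)) :
    Tendsto (fun m => ∫ ω, X m ω * Y m ω ∂μ) atTop (𝓝 (∫ ω, S ω * R ω ∂μ)) := by
  have := (tendsto_toLp hX hS h).inner (𝕜 := ℝ) (tendsto_toLp hY hR h')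
  simpa only [inner_toLp_eq_integral] using this

variable [IsProbabilityMeasure μ]

lemma tendsto_integral_of_meanSquare {X : ℕ → Ω → ℝ} {S : Ω → ℝ} (hX : ∀ m, MemLp (X m) 2 μ)
    (hS : MemLp S 2 μ) (h : Tendsto (fun m => eLpNorm (S - X m) 2 μ) atTop (𝓝 0)) :
    Tendsto (fun m => ∫ ω, X m ω ∂μ) atTop (𝓝 (∫ ω, S ω ∂μ)) := by
  simpa using tendsto_integral_mul hX hS h (Y := fun _ _ => 1) (R := fun _ => 1)
    (fun _ => memLp_const 1) (memLp_const 1) (by simp)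

lemma tendsto_covariance {X Y : ℕ → Ω → ℝ} {S R : Ω → ℝ} (hX : ∀ m, MemLp (X m) 2 μ)
    (hS : MemLp S 2 μ) (h : Tendsto (fun m => eLpNorm (S - X m) 2 μ) atTop (𝓝 0))
    (hY : ∀ m, MemLp (Y m) 2 μ)
    (hR : MemLp R 2 μ) (h' : Tendsto (fun m => eLpNorm (R - Y m) 2 μ) atTop (𝓝 0)) :
    Tendsto (fun m => cov[X m, Y m; μ]) atTop (𝓝 cov[S, R; μ]) := by
  rw [covariance_eq_sub hS hR]
  simp_rw [fun m => covariance_eq_sub (hX m) (hY m)]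
  exact (tendsto_integral_mul hX hS h hY hR h').sub
    ((tendsto_integral_of_meanSquare hX hS h).mul (tendsto_integral_of_meanSquare hY hR h'))

lemma tendsto_variance {X : ℕ → Ω → ℝ} {S : Ω → ℝ} (hX : ∀ m, MemLp (X m) 2 μ)
    (hS : MemLp S 2 μ) (h : Tendsto (fun m => eLpNorm (S - X m) 2 μ) atTop (𝓝 0)) :
    Tendsto (fun m => Var[X m; μ]) atTop (𝓝 Var[S; μ]) := by
  have := tendsto_covariance hX hS h hX hS h
  rw [covariance_self hS.1.aemeasurable] at this
  exact this.congr fun m => covariance_self (hX m).1.aemeasurable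

/-- Mean square limits of real Gaussian variables are Gaussian. -/
lemma hasGaussianLaw_of_tendsto {X : ℕ → Ω → ℝ} {S : Ω → ℝ} (hX : ∀ m, HasGaussianLaw (X m) μ)
    (hS : AEStronglyMeasurable S μ)
    (h : Tendsto (fun m => eLpNorm (S - X m) 2 μ) atTop (𝓝 0)) : HasGaussianLaw S μ := by
  have hX2 : ∀ m, MemLp (X m) 2 μ := fun m => (hX m).memLp_two
  have hS2 := memLp_two_of_tendsto hX2 hS h
  rw [hasGaussianLaw_iff_charFun_map_eq hS.aemeasurable]
  intro t
  have hin : ∀ x : ℝ, inner ℝ t x = t * x := fun x => by simp [mul_comm]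
  simp_rw [hin]
  have h' : Tendsto (fun m => eLpNorm (X m - S) 2 μ) atTop (𝓝 0) :=
    h.congr fun m => eLpNorm_sub_comm _ _ _ _
  -- Along an almost surely convergent subsequence, dominated convergence gives one limit of the
  -- characteristic functions; convergence of means and variances gives the Gaussian one.
  obtain ⟨ns, hns, hae⟩ := (tendstoInMeasure_of_tendsto_eLpNorm two_ne_zero
    (fun m => (hX2 m).1) hS h').exists_seq_tendsto_ae
  have hchar : ∀ {Y : Ω → ℝ}, AEMeasurable Y μ → charFun (μ.map Y) t
      = ∫ ω, Complex.exp (t * Y ω * Complex.I) ∂μ := by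
    intro Y hY
    rw [charFun_apply_real, integral_map hY (by fun_prop)]
  have lim1 : Tendsto (fun i => charFun (μ.map (X (ns i))) t) atTop (𝓝 (charFun (μ.map S) t)) := by
    rw [hchar hS.aemeasurable]
    simp_rw [fun i => hchar (hX (ns i)).aemeasurable]
    refine tendsto_integral_of_dominated_convergence (fun _ => 1) (fun i => ?_)
      (integrable_const 1) (fun i => ?_) ?_
    · have := (hX (ns i)).aemeasurable
      exact AEMeasurable.aestronglyMeasurable (by fun_prop)
    · refine ae_of_all _ fun ω => le_of_eq ?_
      rw [← Complex.ofReal_mul, Complex.norm_exp_ofReal_mul_I]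
    · filter_upwards [hae] with ω hω
      have : Continuous fun x : ℝ => Complex.exp (t * x * Complex.I) := by fun_prop
      exact (this.tendsto _).comp hω
  have lim2 : Tendsto (fun i => charFun (μ.map (X (ns i))) t) atTop
      (𝓝 (Complex.exp ((∫ ω, t * S ω ∂μ : ℝ) * Complex.I
        - (Var[fun ω => t * S ω; μ] : ℝ) / 2))) := by
    simp_rw [fun i => (hX (ns i)).charFun_map_eq t, hin, variance_const_mul, integral_const_mul]
    have m1 := (tendsto_integral_of_meanSquare hX2 hS2 h).comp hns.tendsto_atTop
    have m2 := (tendsto_variance hX2 hS2 h).comp hns.tendsto_atTop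
    have : Continuous fun p : ℝ × ℝ => Complex.exp (((t * p.1 : ℝ) : ℂ) * Complex.I
        - ((t ^ 2 * p.2 : ℝ) : ℂ) / 2) := by fun_prop
    exact (this.tendsto _).comp (m1.prodMk_nhds m2)
  exact tendsto_nhds_unique lim1 lim2

/-- A linear functional of finitely many coordinates is again a mean square limit of Gaussian
variables, so the one-dimensional statement suffices. -/
lemma isGaussianProcess_of_tendsto {T : Type*} {X : ℕ → T → Ω → ℝ} {S : T → Ω → ℝ}
    (hX : ∀ m, IsGaussianProcess (X m) μ) (hS : ∀ t, AEMeasurable (S t) μ)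
    (h : ∀ t, Tendsto (fun m => eLpNorm (S t - X m t) 2 μ) atTop (𝓝 0)) :
    IsGaussianProcess S μ where
  hasGaussianLaw I := by
    classical
    have hmeas : AEMeasurable (fun ω => I.restrict (S · ω)) μ :=
      aemeasurable_pi_lambda _ fun i => hS i
    refine ⟨⟨fun L => ?_⟩⟩
    have hL : ∀ x : I → ℝ, L x = ∑ i, L (Pi.single i 1) * x i := by
      intro x
      conv_lhs => rw [← Finset.univ_sum_single x, map_sum]
      refine Finset.sum_congr rfl fun i _ => ?_
      rw [show Pi.single i (x i) = x i • (Pi.single i 1 : I → ℝ) by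
        rw [← Pi.single_smul]; simp, map_smul, smul_eq_mul, mul_comm]
    have hg : HasGaussianLaw (fun ω => L (I.restrict (S · ω))) μ := by
      refine hasGaussianLaw_of_tendsto (X := fun m ω => L (I.restrict (X m · ω)))
        (fun m => ((hX m).hasGaussianLaw I).map_fun L)
        (L.continuous.measurable.comp_aemeasurable hmeas).aestronglyMeasurable ?_
      have hle : ∀ m, eLpNorm ((fun ω => L (I.restrict (S · ω)))
          - fun ω => L (I.restrict (X m · ω))) 2 μ
          ≤ ∑ i : I, ‖L (Pi.single i 1)‖ₑ * eLpNorm (S i - X m i) 2 μ := by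
        intro m
        have e : ((fun ω => L (I.restrict (S · ω))) - fun ω => L (I.restrict (X m · ω)))
            = ∑ i : I, L (Pi.single i 1) • (S i - X m i) := by
          funext ω
          rw [Pi.sub_apply, hL (I.restrict (S · ω)), hL (I.restrict (X m · ω)),
            ← Finset.sum_sub_distrib, Finset.sum_apply]
          refine Finset.sum_congr rfl fun i _ => ?_
          simp [mul_sub]
        rw [e]
        refine (eLpNorm_sum_le (fun i _ => ?_) (by norm_num)).trans
          (Finset.sum_le_sum fun i _ => (eLpNorm_const_smul _ _ _ _).le)
        exact (((hS i).sub ((hX m).aemeasurable i)).aestronglyMeasurable).const_smul _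
      refine tendsto_of_tendsto_of_tendsto_of_le_of_le tendsto_const_nhds ?_
        (fun _ => zero_le) hle
      have : Tendsto (fun m => ∑ i : I, ‖L (Pi.single i 1)‖ₑ * eLpNorm (S i - X m i) 2 μ) atTop
          (𝓝 (∑ i : I, ‖L (Pi.single i 1)‖ₑ * 0)) :=
        tendsto_finsetSum _ fun i _ => ENNReal.Tendsto.const_mul (h i)
          (Or.inr (by simp))
      simpa using this
    have key := hg.map_eq_gaussianReal
    rw [integral_map hmeas (by fun_prop), variance_map (by fun_prop) hmeas,
      AEMeasurable.map_map_of_aemeasurable (by fun_prop) hmeas]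
    exact key

/-- Cauchy-Schwarz, from the discriminant of the nonnegative quadratic `t ↦ Var[X + tY]`. -/
lemma abs_covariance_le {X Y : Ω → ℝ} (hX : MemLp X 2 μ) (hY : MemLp Y 2 μ) {σ τ : ℝ}
    (hσ : 0 ≤ σ) (hτ : 0 ≤ τ) (h1 : Var[X; μ] ≤ σ ^ 2) (h2 : Var[Y; μ] ≤ τ ^ 2) :
    |cov[X, Y; μ]| ≤ σ * τ := by
  have hq : ∀ t : ℝ, 0 ≤ Var[Y; μ] * (t * t) + 2 * cov[X, Y; μ] * t + Var[X; μ] := by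
    intro t
    have := variance_nonneg (X + t • Y) μ
    rw [variance_add hX (hY.const_smul t), variance_smul, covariance_smul_right] at this
    linarith
  have hd := discrim_le_zero hq
  rw [discrim] at hd
  refine abs_le_of_sq_le_sq ?_ (by positivity)
  have := mul_le_mul h1 h2 (variance_nonneg _ _) (sq_nonneg σ)
  nlinarith

/-- The triangle inequality for standard deviations. It is used for two estimators computed from the
same data, whose correlation is arbitrary. -/
lemma variance_linear_comb_le {X Y : Ω → ℝ} (hX : MemLp X 2 μ) (hY : MemLp Y 2 μ) {σ τ : ℝ}
    (hσ : 0 ≤ σ) (hτ : 0 ≤ τ) (h1 : Var[X; μ] ≤ σ ^ 2) (h2 : Var[Y; μ] ≤ τ ^ 2) (a b : ℝ) :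
    Var[fun ω => a * X ω + b * Y ω; μ] ≤ (|a| * σ + |b| * τ) ^ 2 := by
  have e : (fun ω => a * X ω + b * Y ω) = a • X + b • Y := by
    funext ω
    simp
  rw [e, variance_add (hX.const_smul a) (hY.const_smul b), variance_smul, variance_smul,
    covariance_smul_left, covariance_smul_right]
  have h3 := abs_covariance_le hX hY hσ hτ h1 h2
  have h4 : a * (b * cov[X, Y; μ]) ≤ |a| * (|b| * (σ * τ)) := by
    refine (le_abs_self _).trans ?_
    rw [abs_mul, abs_mul]
    gcongr
  have h5 := mul_le_mul_of_nonneg_left h1 (sq_nonneg a)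
  have h6 := mul_le_mul_of_nonneg_left h2 (sq_nonneg b)
  have h7 := sq_abs a
  have h8 := sq_abs b
  calc _ ≤ a ^ 2 * σ ^ 2 + 2 * (|a| * (|b| * (σ * τ))) + b ^ 2 * τ ^ 2 := by linarith
    _ = _ := by rw [← h7, ← h8]; ring

end MeanSquare

/-! ### Gaussian shift models -/

/-- `P` is a Gaussian shift model: `P f` is the centred Gaussian measure `Q` with covariances
`⟪φ s, φ t⟫ / n`, shifted by `t ↦ ⟪φ t, f⟫`, where the `φ t` span a dense subspace of `L²(ν)`. -/
structure IsShiftModel {ι : Type} [MeasurableSpace ι] (n : ℝ) (ν : Measure ι)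
    (P : (ι → ℝ) → Measure (ι → ℝ)) (φ : ι → Lp ℝ 2 ν) (Q : Measure (ι → ℝ)) : Prop where
  gaussian : IsGaussianProcess (fun t (y : ι → ℝ) => y t) Q
  mean_zero : ∀ t, ∫ y, y t ∂Q = 0
  cov_eq : ∀ s t, cov[fun y => y s, fun y => y t; Q] = n⁻¹ * inner ℝ (φ s) (φ t)
  dense : (Submodule.span ℝ (Set.range φ)).topologicalClosure = ⊤
  shift : ∀ f (hf : MemLp f 2 ν), P f = Q.map (fun y t => inner ℝ (φ t) (hf.toLp f) + y t)

/-- A finite linear combination of the observations. -/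
noncomputable def finComb {ι : Type} (c : ι →₀ ℝ) (y : ι → ℝ) : ℝ := c.sum fun t x => x * y t

section FinComb

variable {ι : Type}

lemma finComb_eq_sum (c : ι →₀ ℝ) : finComb c = fun y => ∑ t ∈ c.support, c t * y t := rfl

@[fun_prop]
lemma measurable_finComb (c : ι →₀ ℝ) : Measurable (finComb c) := by
  rw [finComb_eq_sum]
  fun_prop

lemma finComb_add (c d : ι →₀ ℝ) (y : ι → ℝ) :
    finComb (c + d) y = finComb c y + finComb d y := by
  simp only [finComb]
  exact Finsupp.sum_add_index' (by simp) (by intros; ring)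

lemma finComb_smul (a : ℝ) (c : ι →₀ ℝ) (y : ι → ℝ) :
    finComb (a • c) y = a * finComb c y := by
  simp only [finComb]
  rw [Finsupp.sum_smul_index' (by simp), Finsupp.mul_sum]
  simp [mul_assoc]

lemma finComb_sub (c d : ι →₀ ℝ) (y : ι → ℝ) :
    finComb (c - d) y = finComb c y - finComb d y := by
  rw [sub_eq_add_neg, show -d = (-1 : ℝ) • d by simp, finComb_add, finComb_smul]
  ring

end FinComb

lemma eLpNorm_two_eq {Ω : Type*} {mΩ : MeasurableSpace Ω} {μ : Measure Ω} {X : Ω → ℝ}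
    (hX : MemLp X 2 μ) : eLpNorm X 2 μ = ENNReal.ofReal (√(∫ ω, X ω * X ω ∂μ)) := by
  rw [← inner_toLp_eq_integral hX hX, real_inner_self_eq_norm_sq, Real.sqrt_sq (norm_nonneg _),
    Lp.norm_toLp, ENNReal.ofReal_toReal hX.2.ne]

lemma isGaussian_const_add {Ω : Type*} {mΩ : MeasurableSpace Ω} {μ : Measure Ω} {X : Ω → ℝ}
    (hX : HasGaussianLaw X μ) (a : ℝ) : HasGaussianLaw (fun ω => a + X ω) μ := by
  have := hX.isGaussian_map
  refine ⟨?_⟩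
  have e : μ.map (fun ω => a + X ω) = (μ.map X).map (fun x => a + x) := by
    rw [AEMeasurable.map_map_of_aemeasurable (by fun_prop) hX.aemeasurable]
    rfl
  rw [e]
  infer_instance

namespace IsShiftModel

variable {ι : Type} [MeasurableSpace ι] {n : ℝ} {ν : Measure ι}
  {P : (ι → ℝ) → Measure (ι → ℝ)} {φ : ι → Lp ℝ 2 ν} {Q : Measure (ι → ℝ)}

lemma prob_center (H : IsShiftModel n ν P φ Q) : IsProbabilityMeasure Q :=
  H.gaussian.isProbabilityMeasure

lemma measurable_shift (F : Lp ℝ 2 ν) :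
    Measurable (fun (y : ι → ℝ) t => inner ℝ (φ t) F + y t) :=
  measurable_pi_lambda _ fun t => by fun_prop

lemma prob (H : IsShiftModel n ν P φ Q) {f : ι → ℝ} (hf : MemLp f 2 ν) :
    IsProbabilityMeasure (P f) := by
  have := H.prob_center
  rw [H.shift f hf]
  exact Measure.isProbabilityMeasure_map (measurable_shift _).aemeasurable

lemma isGaussianProcess_finComb (H : IsShiftModel n ν P φ Q) :
    IsGaussianProcess (fun (c : ι →₀ ℝ) y => finComb c y) Q :=
  IsGaussianProcess.of_isGaussianProcess H.gaussian fun c =>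
    ⟨c.support, ∑ t : c.support, c t • ContinuousLinearMap.proj t, fun y => by
      rw [finComb_eq_sum, sum_apply]
      simp only [smul_apply, ContinuousLinearMap.proj_apply, smul_eq_mul,
        Finset.restrict_def]
      exact (Finset.sum_coe_sort c.support fun t => c t * y t).symm⟩

lemma hasGaussianLaw_finComb (H : IsShiftModel n ν P φ Q) (c : ι →₀ ℝ) :
    HasGaussianLaw (finComb c) Q :=
  H.isGaussianProcess_finComb.hasGaussianLaw_eval c

lemma integral_finComb (H : IsShiftModel n ν P φ Q) (c : ι →₀ ℝ) : ∫ y, finComb c y ∂Q = 0 := by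
  rw [finComb_eq_sum, integral_finsetSum]
  · simp [integral_const_mul, H.mean_zero]
  · exact fun t _ => (H.gaussian.hasGaussianLaw_eval t).integrable.const_mul _

lemma covariance_finComb (H : IsShiftModel n ν P φ Q) (c d : ι →₀ ℝ) :
    cov[finComb c, finComb d; Q] = n⁻¹ * inner ℝ (Finsupp.linearCombination ℝ φ c)
      (Finsupp.linearCombination ℝ φ d) := by
  have := H.prob_center
  have hm : ∀ (c : ι →₀ ℝ) t, MemLp (fun y : ι → ℝ => c t * y t) 2 Q := fun c t =>
    (H.gaussian.hasGaussianLaw_eval t).memLp_two.const_mul _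
  rw [finComb_eq_sum, finComb_eq_sum,
    covariance_fun_sum_fun_sum' (fun t _ => hm c t) (fun t _ => hm d t)]
  simp_rw [covariance_const_mul_left, covariance_const_mul_right, H.cov_eq]
  rw [Finsupp.linearCombination_apply, Finsupp.linearCombination_apply, Finsupp.sum, Finsupp.sum,
    sum_inner, Finset.mul_sum]
  refine Finset.sum_congr rfl fun s _ => ?_
  rw [inner_sum, Finset.mul_sum]
  refine Finset.sum_congr rfl fun t _ => ?_
  rw [real_inner_smul_left, real_inner_smul_right]
  ring

lemma finComb_shift (c : ι →₀ ℝ) (F : Lp ℝ 2 ν) (y : ι → ℝ) :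
    finComb c (fun t => inner ℝ (φ t) F + y t)
      = inner ℝ (Finsupp.linearCombination ℝ φ c) F + finComb c y := by
  simp only [finComb_eq_sum, mul_add, Finset.sum_add_distrib]
  rw [Finsupp.linearCombination_apply, Finsupp.sum, sum_inner]
  simp [real_inner_smul_left]

lemma hasGaussianLaw_finComb_shift (H : IsShiftModel n ν P φ Q) {f : ι → ℝ} (hf : MemLp f 2 ν)
    (c : ι →₀ ℝ) : HasGaussianLaw (finComb c) (P f) := by
  refine ⟨?_⟩
  rw [H.shift f hf, Measure.map_map (measurable_finComb c) (measurable_shift _)]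
  have := (isGaussian_const_add (H.hasGaussianLaw_finComb c)
    (inner ℝ (Finsupp.linearCombination ℝ φ c) (hf.toLp f))).isGaussian_map
  convert this using 2
  funext y
  exact finComb_shift c _ y

lemma integral_finComb_shift (H : IsShiftModel n ν P φ Q) {f : ι → ℝ} (hf : MemLp f 2 ν)
    (c : ι →₀ ℝ) : ∫ y, finComb c y ∂(P f)
      = inner ℝ (Finsupp.linearCombination ℝ φ c) (hf.toLp f) := by
  have := H.prob_center
  rw [H.shift f hf, integral_map (measurable_shift _).aemeasurable (by fun_prop)]
  simp_rw [finComb_shift]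
  rw [integral_add (integrable_const _) (H.hasGaussianLaw_finComb c).integrable,
    H.integral_finComb]
  simp

lemma variance_finComb_shift (H : IsShiftModel n ν P φ Q) {f : ι → ℝ} (hf : MemLp f 2 ν)
    (c : ι →₀ ℝ) : Var[finComb c; P f] = n⁻¹ * ‖Finsupp.linearCombination ℝ φ c‖ ^ 2 := by
  have := H.prob_center
  rw [H.shift f hf, variance_map (by fun_prop) (measurable_shift _).aemeasurable]
  have e : finComb c ∘ (fun (y : ι → ℝ) t => inner ℝ (φ t) (hf.toLp f) + y t)
      = fun y => inner ℝ (Finsupp.linearCombination ℝ φ c) (hf.toLp f) + finComb c y :=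
    funext fun y => finComb_shift c _ y
  rw [e, variance_const_add (by fun_prop), ← covariance_self (by fun_prop), H.covariance_finComb,
    real_inner_self_eq_norm_sq]

/-- The second moment is squared mean plus variance, both proportional to the squared norm of the
weight up to a factor depending on `f`. As `f` enters only through that factor, one sequence of
weights converges under every parameter at once. -/
lemma eLpNorm_finComb_sub_le (H : IsShiftModel n ν P φ Q) {f : ι → ℝ} (hf : MemLp f 2 ν)
    (c d : ι →₀ ℝ) : eLpNorm (finComb c - finComb d) 2 (P f) ≤ ENNReal.ofReal
      (√(‖hf.toLp f‖ ^ 2 + |n⁻¹|) * ‖Finsupp.linearCombination ℝ φ c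
        - Finsupp.linearCombination ℝ φ d‖) := by
  have := H.prob hf
  have e : finComb c - finComb d = finComb (c - d) := funext fun y => (finComb_sub c d y).symm
  have hL2 := (H.hasGaussianLaw_finComb_shift hf (c - d)).memLp_two
  rw [e, ← map_sub, eLpNorm_two_eq hL2]
  refine ENNReal.ofReal_le_ofReal ?_
  rw [← Real.sqrt_sq (norm_nonneg (Finsupp.linearCombination ℝ φ (c - d))),
    ← Real.sqrt_mul (by positivity)]
  refine Real.sqrt_le_sqrt ?_
  have h1 := variance_eq_sub hL2
  rw [H.integral_finComb_shift hf, H.variance_finComb_shift hf] at h1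
  have h2 : ∫ y, (finComb (c - d) ^ 2) y ∂(P f)
      = ∫ y, finComb (c - d) y * finComb (c - d) y ∂(P f) := by
    simp [sq]
  rw [h2] at h1
  have h3 := abs_real_inner_le_norm (Finsupp.linearCombination ℝ φ (c - d)) (hf.toLp f)
  have h4 := sq_le_sq' (by linarith [neg_abs_le (inner ℝ (Finsupp.linearCombination ℝ φ (c - d)) (hf.toLp f))]) ((le_abs_self _).trans h3)
  have h5 := mul_le_mul_of_nonneg_right (le_abs_self n⁻¹)
    (sq_nonneg ‖Finsupp.linearCombination ℝ φ (c - d)‖)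
  nlinarith

/-- The stochastic integral of `w ∈ L²` as a measurable function of the data, simultaneously
under all parameters. -/
lemma exists_stochasticIntegral (H : IsShiftModel n ν P φ Q) (w : Lp ℝ 2 ν) :
    ∃ S : (ι → ℝ) → ℝ, Measurable S ∧ ∃ c : ℕ → ι →₀ ℝ,
      Tendsto (fun m => Finsupp.linearCombination ℝ φ (c m)) atTop (𝓝 w) ∧
      ∀ f : ι → ℝ, MemLp f 2 ν →
        Tendsto (fun m => eLpNorm (S - finComb (c m)) 2 (P f)) atTop (𝓝 0) := by
  have hw : w ∈ closure (Submodule.span ℝ (Set.range φ) : Set (Lp ℝ 2 ν)) := by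
    rw [← Submodule.topologicalClosure_coe, H.dense]
    trivial
  -- A geometric rate fixed in advance makes the approximants converge almost surely under each `P
  -- f`, so a single pointwise limit represents the stochastic integral for all `f`. Where the
  -- sequence diverges, `limUnder` takes an arbitrary value, on a null set for each square
  -- integrable `f`.
  have hex : ∀ m : ℕ, ∃ c : ι →₀ ℝ, ‖Finsupp.linearCombination ℝ φ c - w‖ < (1 / 2) ^ m := by
    intro m
    obtain ⟨b, hb, hd⟩ := Metric.mem_closure_iff.1 hw ((1 / 2) ^ m) (by positivity)
    obtain ⟨c, rfl⟩ := (Finsupp.mem_span_range_iff_exists_finsupp).1 hb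
    refine ⟨c, ?_⟩
    rw [← dist_eq_norm, dist_comm]
    exact hd
  choose c hc using hex
  refine ⟨fun y => limUnder atTop fun m => finComb (c m) y,
    (StronglyMeasurable.limUnder fun m => (measurable_finComb (c m)).stronglyMeasurable).measurable,
    c, ?_, fun f hf => ?_⟩
  · rw [tendsto_iff_norm_sub_tendsto_zero]
    refine squeeze_zero (fun _ => norm_nonneg _) (fun m => (hc m).le) ?_
    exact tendsto_pow_atTop_nhds_zero_of_lt_one (by norm_num) (by norm_num)
  · set K := √(‖hf.toLp f‖ ^ 2 + |n⁻¹|)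
    -- `K + 1` instead of `K`: the Cauchy bounds must be strict even if `K = 0`.
    have hB : ∑' i : ℕ, ENNReal.ofReal ((K + 1) * (2 * (1 / 2 : ℝ) ^ i)) ≠ ∞ :=
      Summable.tsum_ofReal_ne_top
        (((summable_geometric_of_lt_one (by norm_num) (by norm_num)).mul_left 2).mul_left _)
    have hcau : ∀ N p q : ℕ, N ≤ p → N ≤ q →
        eLpNorm (finComb (c p) - finComb (c q)) 2 (P f)
          < ENNReal.ofReal ((K + 1) * (2 * (1 / 2 : ℝ) ^ N)) := by
      intro N p q hp hq
      refine (H.eLpNorm_finComb_sub_le hf _ _).trans_lt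
        ((ENNReal.ofReal_lt_ofReal_iff (by positivity)).2 ?_)
      have hpow : ∀ r, N ≤ r → ((1 : ℝ) / 2) ^ r ≤ (1 / 2) ^ N := fun r hr =>
        pow_le_pow_of_le_one (by norm_num) (by norm_num) hr
      have h1 : ‖Finsupp.linearCombination ℝ φ (c p) - Finsupp.linearCombination ℝ φ (c q)‖
          < 2 * (1 / 2 : ℝ) ^ N := by
        have := norm_sub_le_norm_sub_add_norm_sub (Finsupp.linearCombination ℝ φ (c p)) w
          (Finsupp.linearCombination ℝ φ (c q))
        rw [norm_sub_rev w] at this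
        linarith [hc p, hc q, hpow p hp, hpow q hq]
      have hK : 0 ≤ K := Real.sqrt_nonneg _
      refine (mul_le_mul_of_nonneg_left h1.le hK).trans_lt ?_
      have : (0 : ℝ) < 2 * (1 / 2 : ℝ) ^ N := by positivity
      nlinarith
    have hmeas : ∀ m, AEStronglyMeasurable (finComb (c m)) (P f) := fun m =>
      (measurable_finComb (c m)).aestronglyMeasurable
    have hlim := Lp.ae_tendsto_of_cauchy_eLpNorm hmeas (by norm_num) hB hcau
    have := Lp.cauchy_tendsto_of_tendsto hmeas (fun y => limUnder atTop fun m => finComb (c m) y)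
      hB hcau (by
        filter_upwards [hlim] with y hy
        exact tendsto_nhds_limUnder hy)
    exact this.congr fun m => eLpNorm_sub_comm _ _ _ _

/-- Linear estimators `a + ∫ w dY` with prescribed `w ∈ L²`. -/
lemma exists_linearEstimator (H : IsShiftModel n ν P φ Q) (w : Lp ℝ 2 ν) (a : ℝ) :
    ∃ S : (ι → ℝ) → ℝ, IsLinearEstimator ν P S ∧
      ∀ f (hf : MemLp f 2 ν), ∫ y, S y ∂(P f) = a + inner ℝ w (hf.toLp f) ∧
        Var[S; P f] = n⁻¹ * ‖w‖ ^ 2 := by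
  obtain ⟨S, hS, c, hc, hlim⟩ := H.exists_stochasticIntegral w
  refine ⟨fun y => a + S y, ⟨by fun_prop, fun _ => a, c, fun f hf => ?_⟩, fun f hf => ?_⟩
  · refine (hlim f hf).congr fun m => ?_
    congr 1
    funext y
    change S y - finComb (c m) y = a + S y - (a + finComb (c m) y)
    ring
  · have := H.prob hf
    have h1 : ∀ m, MemLp (finComb (c m)) 2 (P f) := fun m =>
      (H.hasGaussianLaw_finComb_shift hf (c m)).memLp_two
    have h2 := memLp_two_of_tendsto h1 hS.aestronglyMeasurable (hlim f hf)
    constructor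
    · rw [integral_add (integrable_const _) (h2.integrable (by norm_num)), integral_const]
      have h3 := tendsto_integral_of_meanSquare h1 h2 (hlim f hf)
      simp_rw [H.integral_finComb_shift hf] at h3
      have h4 := tendsto_nhds_unique h3 (hc.inner (𝕜 := ℝ) tendsto_const_nhds)
      rw [h4]
      simp
    · rw [variance_const_add hS.aestronglyMeasurable]
      have h3 := tendsto_variance h1 h2 (hlim f hf)
      simp_rw [H.variance_finComb_shift hf] at h3
      exact tendsto_nhds_unique h3 ((hc.norm.pow 2).const_mul _)

lemma hasGaussianLaw_of_isLinearEstimator (H : IsShiftModel n ν P φ Q) {S : (ι → ℝ) → ℝ}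
    (hS : IsLinearEstimator ν P S) {f : ι → ℝ} (hf : MemLp f 2 ν) : HasGaussianLaw S (P f) := by
  have := H.prob hf
  obtain ⟨hm, a, c, h⟩ := hS
  exact hasGaussianLaw_of_tendsto
    (fun m => isGaussian_const_add (H.hasGaussianLaw_finComb_shift hf (c m)) (a m))
    hm.aestronglyMeasurable (h f hf)

end IsShiftModel

/-- This is the source of joint Gaussianity: each combination of two linear estimators is a linear
estimator, hence Gaussian. -/
lemma IsLinearEstimator.linear_comb {ι : Type} [MeasurableSpace ι] {ν : Measure ι}
    {P : (ι → ℝ) → Measure (ι → ℝ)} {S R : (ι → ℝ) → ℝ} (hS : IsLinearEstimator ν P S)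
    (hR : IsLinearEstimator ν P R) (s r : ℝ) :
    IsLinearEstimator ν P (fun y => s * S y + r * R y) := by
  obtain ⟨hSm, a, c, hc⟩ := hS
  obtain ⟨hRm, b, d, hd⟩ := hR
  refine ⟨by fun_prop, fun m => s * a m + r * b m, fun m => s • c m + r • d m, fun f hf => ?_⟩
  have hle : ∀ m, eLpNorm (fun y => s * S y + r * R y
      - (s * a m + r * b m + finComb (s • c m + r • d m) y)) 2 (P f)
      ≤ ‖s‖ₑ * eLpNorm (fun y => S y - (a m + finComb (c m) y)) 2 (P f)
        + ‖r‖ₑ * eLpNorm (fun y => R y - (b m + finComb (d m) y)) 2 (P f) := by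
    intro m
    have e : (fun y => s * S y + r * R y - (s * a m + r * b m + finComb (s • c m + r • d m) y))
        = s • (fun y => S y - (a m + finComb (c m) y))
          + r • (fun y => R y - (b m + finComb (d m) y)) := by
      funext y
      simp only [finComb_add, finComb_smul, Pi.add_apply, Pi.smul_apply, smul_eq_mul]
      ring
    rw [e]
    refine (eLpNorm_add_le ?_ ?_ (by norm_num)).trans
      (add_le_add (eLpNorm_const_smul _ _ _ _).le (eLpNorm_const_smul _ _ _ _).le)
    · exact Measurable.aestronglyMeasurable (by fun_prop)
    · exact Measurable.aestronglyMeasurable (by fun_prop)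
  refine tendsto_of_tendsto_of_tendsto_of_le_of_le tendsto_const_nhds ?_ (fun _ => zero_le) hle
  have := (ENNReal.Tendsto.const_mul (a := ‖s‖ₑ) (hc f hf) (Or.inr (by simp))).add
    (ENNReal.Tendsto.const_mul (a := ‖r‖ₑ) (hd f hf) (Or.inr (by simp)))
  rw [mul_zero, mul_zero, add_zero] at this
  exact this

/-! ### Total variation bound between shifts -/

lemma integral_sq_stdGaussian : ∫ x, x ^ 2 ∂(gaussianReal 0 1) = 1 := by
  have h := variance_eq_sub (μ := gaussianReal 0 1) (X := fun x => x)
    (memLp_id_gaussianReal' 2 (by norm_num))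
  rw [variance_fun_id_gaussianReal, integral_id_gaussianReal] at h
  simpa using h.symm

/-- The likelihood ratio `exp (δx - δ²/2)` is at least `1 + δx - δ²/2`, and `-x ≤ (1 + x²)/2`. So
the loss of density is at most the standard density times `δ²/2 + δ(1 + x²)/2`, whose integral is `δ
+ δ²/2`. -/
lemma stdGaussian_le_shift {δ : ℝ} (hδ : 0 ≤ δ) {B : Set ℝ} (hB : MeasurableSet B) :
    gaussianReal 0 1 B ≤ gaussianReal 0 1 ((fun z => z + δ) ⁻¹' B)
      + ENNReal.ofReal (δ + δ ^ 2 / 2) := by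
  rw [← Measure.map_apply (by fun_prop) hB, gaussianReal_map_add_const, zero_add,
    gaussianReal_apply_eq_integral _ one_ne_zero, gaussianReal_apply_eq_integral _ one_ne_zero,
    ← ENNReal.ofReal_add (setIntegral_nonneg hB fun t _ => gaussianPDFReal_nonneg _ _ _)
      (by positivity)]
  refine ENNReal.ofReal_le_ofReal ?_
  have hsq : Integrable (fun x : ℝ => x ^ 2) (gaussianReal 0 1) :=
    (memLp_id_gaussianReal' 2 (by norm_num)).integrable_sq
  have h1x : Integrable (fun x : ℝ => 1 + x ^ 2) (gaussianReal 0 1) :=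
    (integrable_const 1).add hsq
  have h2x : Integrable (fun x : ℝ => δ * (1 + x ^ 2) / 2) (gaussianReal 0 1) :=
    (h1x.const_mul δ).div_const 2
  have hi : Integrable (fun x : ℝ => δ ^ 2 / 2 + δ * (1 + x ^ 2) / 2) (gaussianReal 0 1) :=
    (integrable_const _).add h2x
  have hval : ∫ x, gaussianPDFReal 0 1 x * (δ ^ 2 / 2 + δ * (1 + x ^ 2) / 2) = δ + δ ^ 2 / 2 := by
    have h := integral_gaussianReal_eq_integral_smul (μ := 0) (v := 1) one_ne_zero
      (f := fun x : ℝ => δ ^ 2 / 2 + δ * (1 + x ^ 2) / 2)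
    simp only [smul_eq_mul] at h
    rw [← h, integral_add (integrable_const _) h2x, integral_const, integral_div,
      integral_const_mul, integral_add (integrable_const _) hsq, integral_sq_stdGaussian]
    simp
    ring
  have hint : Integrable fun x => gaussianPDFReal 0 1 x * (δ ^ 2 / 2 + δ * (1 + x ^ 2) / 2) := by
    rw [gaussianReal_of_var_ne_zero _ one_ne_zero] at hi
    have := (integrable_withDensity_iff_integrable_smul' (measurable_gaussianPDF 0 1)
      (ae_of_all _ fun x => gaussianPDF_lt_top)).1 hi
    simpa [toReal_gaussianPDF] using this
  have hpt : ∀ x, gaussianPDFReal 0 1 x - gaussianPDFReal δ 1 x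
      ≤ gaussianPDFReal 0 1 x * (δ ^ 2 / 2 + δ * (1 + x ^ 2) / 2) := by
    intro x
    have e : gaussianPDFReal δ 1 x
        = gaussianPDFReal 0 1 x * Real.exp (δ * x - δ ^ 2 / 2) := by
      rw [show δ = 0 + δ by ring, ← gaussianPDFReal_sub, stdPDF_eq, stdPDF_eq, mul_assoc,
        ← Real.exp_add]
      congr 2
      ring
    have h1 := Real.add_one_le_exp (δ * x - δ ^ 2 / 2)
    have h2 : 1 - Real.exp (δ * x - δ ^ 2 / 2) ≤ δ ^ 2 / 2 + δ * (1 + x ^ 2) / 2 := by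
      nlinarith [mul_nonneg hδ (sq_nonneg (1 + x))]
    rw [e]
    have := mul_le_mul_of_nonneg_left h2 (gaussianPDFReal_nonneg 0 1 x)
    linarith
  have h0 : ∫ x in B, (gaussianPDFReal 0 1 x - gaussianPDFReal δ 1 x) ≤ δ + δ ^ 2 / 2 := by
    refine (setIntegral_mono ((integrable_gaussianPDFReal 0 1).sub
      (integrable_gaussianPDFReal δ 1)).integrableOn hint.integrableOn hpt).trans ?_
    rw [← hval]
    exact setIntegral_le_integral hint (ae_of_all _ fun x =>
      mul_nonneg (gaussianPDFReal_nonneg _ _ _) (by positivity))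
  rw [integral_sub (integrable_gaussianPDFReal 0 1).integrableOn
    (integrable_gaussianPDFReal δ 1).integrableOn] at h0
  linarith

lemma prod_map_le_shift {R Y : Type*} [MeasurableSpace R] [MeasurableSpace Y] (ρ : Measure R)
    [IsProbabilityMeasure ρ] {Ψ : R × ℝ → Y} (hΨ : Measurable Ψ) {δ : ℝ} (hδ : 0 ≤ δ)
    {A : Set Y} (hA : MeasurableSet A) :
    (ρ.prod (gaussianReal 0 1)).map Ψ A
      ≤ (ρ.prod (gaussianReal 0 1)).map (fun p => Ψ (p.1, p.2 + δ)) A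
        + ENNReal.ofReal (δ + δ ^ 2 / 2) := by
  have hΨ' : Measurable fun p : R × ℝ => Ψ (p.1, p.2 + δ) := hΨ.comp (by fun_prop)
  rw [Measure.map_apply hΨ hA, Measure.map_apply hΨ' hA, Measure.prod_apply (hΨ hA),
    Measure.prod_apply (hΨ' hA)]
  calc _ ≤ ∫⁻ r, (gaussianReal 0 1 (Prod.mk r ⁻¹' ((fun p : R × ℝ => Ψ (p.1, p.2 + δ)) ⁻¹' A))
        + ENNReal.ofReal (δ + δ ^ 2 / 2)) ∂ρ := by
        refine lintegral_mono fun r => ?_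
        exact stdGaussian_le_shift hδ (measurable_prodMk_left (hΨ hA))
    _ = _ := by
        rw [lintegral_add_right _ measurable_const]
        simp

namespace IsShiftModel

variable {ι : Type} [MeasurableSpace ι] {n : ℝ} {ν : Measure ι}
  {P : (ι → ℝ) → Measure (ι → ℝ)} {φ : ι → Lp ℝ 2 ν} {Q : Measure (ι → ℝ)}

lemma center_eq (H : IsShiftModel n ν P φ Q) : P 0 = Q := by
  rw [H.shift 0 MemLp.zero]
  have : (fun (y : ι → ℝ) t => inner ℝ (φ t) ((MemLp.zero : MemLp (0 : ι → ℝ) 2 ν).toLp 0) + y t)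
      = id := by
    funext y t
    rw [MemLp.toLp_zero, inner_zero_right, zero_add]
    rfl
  rw [this, Measure.map_id]

/-- Decomposition of the noise along a direction `w`: an independent remainder plus a standard
normal multiple of the covariance with `w`. -/
lemma exists_decomposition (H : IsShiftModel n ν P φ Q) (hn : 0 < n) {w : Lp ℝ 2 ν}
    (hw : ‖w‖ = 1) :
    ∃ ρ : Measure (ι → ℝ), IsProbabilityMeasure ρ ∧
      Q = (ρ.prod (gaussianReal 0 1)).map
        (fun p t => p.1 t + (√n)⁻¹ * inner ℝ (φ t) w * p.2) := by
  have hQ := H.prob_center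
  obtain ⟨S, hS, c, hc, hlim⟩ := H.exists_stochasticIntegral w
  have hS0 := hlim 0 MemLp.zero
  rw [H.center_eq] at hS0
  set k : ι → ℝ := fun t => (√n)⁻¹ * inner ℝ (φ t) w
  set Z : (ι → ℝ) → ℝ := fun y => √n * S y with hZ
  set R : ι → (ι → ℝ) → ℝ := fun t y => y t - k t * Z y with hR
  have hsn : √n * √n = n := Real.mul_self_sqrt hn.le
  have hsn0 : 0 < √n := Real.sqrt_pos.2 hn
  have hfin : ∀ m, MemLp (finComb (c m)) 2 Q := fun m => (H.hasGaussianLaw_finComb _).memLp_two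
  have hS2 : MemLp S 2 Q := memLp_two_of_tendsto hfin hS.aestronglyMeasurable hS0
  have hZm : Measurable Z := by fun_prop
  have hZ2 : MemLp Z 2 Q := hS2.const_mul _
  have hRm : ∀ t, Measurable (R t) := fun t => by fun_prop
  have hy2 : ∀ t, MemLp (fun y : ι → ℝ => y t) 2 Q := fun t =>
    (H.gaussian.hasGaussianLaw_eval t).memLp_two
  -- The observations together with `Z` form a Gaussian process, because `Z` is a mean square limit
  -- of finite combinations of the observations.
  have hG : IsGaussianProcess (Sum.elim (fun t (y : ι → ℝ) => y t) (fun _ : Unit => Z)) Q := by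
    refine isGaussianProcess_of_tendsto
      (X := fun m => Sum.elim (fun t (y : ι → ℝ) => y t)
        (fun _ : Unit => fun y => √n * finComb (c m) y)) (fun m => ?_) ?_ ?_
    · have := H.isGaussianProcess_finComb.comp_right
        (Sum.elim (fun t => Finsupp.single t 1) fun _ : Unit => √n • c m)
      have e : (fun (c : ι →₀ ℝ) y => finComb c y) ∘
          (Sum.elim (fun t => Finsupp.single t 1) fun _ : Unit => √n • c m)
          = Sum.elim (fun t (y : ι → ℝ) => y t)
            (fun _ : Unit => fun y => √n * finComb (c m) y) := by
        funext s y
        rcases s with t | u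
        · simp [finComb]
        · simp [finComb_smul]
      rwa [e] at this
    · rintro (t | u)
      · exact (measurable_pi_apply t).aemeasurable
      · exact hZm.aemeasurable
    · rintro (t | u)
      · simp
      · have h1 : ∀ m, eLpNorm (Z - fun y => √n * finComb (c m) y) 2 Q
            = ‖√n‖ₑ * eLpNorm (S - finComb (c m)) 2 Q := by
          intro m
          rw [← eLpNorm_const_smul]
          congr 1
          funext y
          simp [hZ, mul_sub]
        have h2 := ENNReal.Tendsto.const_mul (a := ‖√n‖ₑ) hS0 (Or.inr (by simp))
        rw [mul_zero] at h2
        exact h2.congr fun m => (h1 m).symm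
  have hG' : IsGaussianProcess (Sum.elim R fun _ : Unit => Z) Q := by
    classical
    refine hG.of_isGaussianProcess ?_
    rintro (t | u)
    · exact ⟨{Sum.inl t, Sum.inr ()},
        ContinuousLinearMap.proj ⟨Sum.inl t, by simp⟩
          - k t • ContinuousLinearMap.proj ⟨Sum.inr (), by simp⟩, fun y => by simp [hR]⟩
    · exact ⟨{Sum.inr ()}, ContinuousLinearMap.proj ⟨Sum.inr (), by simp⟩, fun y => by simp⟩
  have hvarS : Var[S; Q] = n⁻¹ := by
    have h1 := tendsto_variance hfin hS2 hS0
    have h2 : ∀ m, Var[finComb (c m); Q]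
        = n⁻¹ * ‖Finsupp.linearCombination ℝ φ (c m)‖ ^ 2 := fun m => by
      rw [← H.center_eq, H.variance_finComb_shift MemLp.zero]
    simp_rw [h2] at h1
    have h3 := tendsto_nhds_unique h1 ((hc.norm.pow 2).const_mul _)
    rw [h3, hw]
    simp
  have hcovS : ∀ t, cov[fun y => y t, S; Q] = n⁻¹ * inner ℝ (φ t) w := by
    intro t
    have h1 := tendsto_covariance (X := fun _ => fun y : ι → ℝ => y t) (fun _ => hy2 t) (hy2 t)
      (by simp) hfin hS2 hS0
    have h2 : ∀ m, cov[fun y => y t, finComb (c m); Q]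
        = n⁻¹ * inner ℝ (φ t) (Finsupp.linearCombination ℝ φ (c m)) := fun m => by
      have := H.covariance_finComb (Finsupp.single t 1) (c m)
      simpa [finComb_eq_sum, finComb] using this
    simp_rw [h2] at h1
    exact tendsto_nhds_unique h1 ((tendsto_const_nhds.inner hc).const_mul _)
  have hmeanZ : ∫ y, Z y ∂Q = 0 := by
    rw [hZ, integral_const_mul]
    have h1 := tendsto_integral_of_meanSquare hfin hS2 hS0
    simp_rw [H.integral_finComb] at h1
    rw [tendsto_nhds_unique h1 tendsto_const_nhds, mul_zero]
  have hvarZ : Var[Z; Q] = 1 := by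
    rw [hZ, variance_const_mul, hvarS, sq, hsn, mul_inv_cancel₀ hn.ne']
  have hlawZ : Q.map Z = gaussianReal 0 1 := by
    have h1 : HasGaussianLaw Z Q := hG.hasGaussianLaw_eval (Sum.inr ())
    rw [h1.map_eq_gaussianReal, hmeanZ, hvarZ, Real.toNNReal_one]
  have hcov : ∀ t, cov[R t, Z; Q] = 0 := by
    intro t
    have h1 : R t = (fun y : ι → ℝ => y t) - k t • Z := rfl
    rw [h1, covariance_sub_left (hy2 t) (hZ2.const_smul _) hZ2, covariance_smul_left,
      covariance_self hZm.aemeasurable, hvarZ, hZ, covariance_const_mul_right, hcovS]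
    simp only [k]
    field_simp
    rw [Real.sq_sqrt hn.le]
    ring
  -- `R` is the residual of the regression on `Z`; for jointly Gaussian families, uncorrelated means
  -- independent.
  have hind := hG'.indepFun_of_covariance_eq_zero (fun t => (hRm t).aemeasurable)
    (fun _ => hZm.aemeasurable) (fun t _ => hcov t)
  have hind' : IndepFun (fun y t => R t y) Z Q :=
    hind.comp (φ := id) (ψ := fun g : Unit → ℝ => g ()) measurable_id (measurable_pi_apply _)
  have hRm' : Measurable fun y t => R t y := measurable_pi_lambda _ hRm
  refine ⟨Q.map (fun y t => R t y), Measure.isProbabilityMeasure_map hRm'.aemeasurable, ?_⟩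
  rw [← hlawZ, ← (indepFun_iff_map_prod_eq_prod_map_map hRm'.aemeasurable hZm.aemeasurable).1 hind',
    Measure.map_map (measurable_pi_lambda _ fun t => by fun_prop) (hRm'.prodMk hZm)]
  conv_lhs => rw [← Measure.map_id (μ := Q)]
  congr 1
  funext y t
  simp [hR, k]

/-- Decompose the noise along the unit vector in the direction `g - f`. Passing from `f` to `g` then
translates only the one-dimensional normal coordinate, by `√n ‖g - f‖ = δ`. -/
lemma measure_le_add (H : IsShiftModel n ν P φ Q) (hn : 0 < n) {f g : ι → ℝ}
    (hf : MemLp f 2 ν) (hg : MemLp g 2 ν) {δ : ℝ} (hδ : √n * ‖hg.toLp g - hf.toLp f‖ = δ)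
    {A : Set (ι → ℝ)} (hA : MeasurableSet A) :
    P f A ≤ P g A + ENNReal.ofReal (δ + δ ^ 2 / 2) := by
  rcases eq_or_ne (hg.toLp g - hf.toLp f) 0 with h0 | h0
  · rw [H.shift f hf, H.shift g hg, sub_eq_zero.1 h0]
    exact le_self_add
  · set d := hg.toLp g - hf.toLp f with hd
    have hd0 : 0 < ‖d‖ := norm_pos_iff.2 h0
    have hsn0 : 0 < √n := Real.sqrt_pos.2 hn
    have hδ0 : 0 ≤ δ := hδ ▸ by positivity
    obtain ⟨ρ, hρ, hQ⟩ := H.exists_decomposition hn (w := ‖d‖⁻¹ • d)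
      (by rw [norm_smul, norm_inv, norm_norm, inv_mul_cancel₀ hd0.ne'])
    set Ψ : (ι → ℝ) × ℝ → (ι → ℝ) := fun p t => inner ℝ (φ t) (hf.toLp f)
      + (p.1 t + (√n)⁻¹ * inner ℝ (φ t) (‖d‖⁻¹ • d) * p.2) with hΨ
    have hm : Measurable fun (p : (ι → ℝ) × ℝ) t =>
        p.1 t + (√n)⁻¹ * inner ℝ (φ t) (‖d‖⁻¹ • d) * p.2 :=
      measurable_pi_lambda _ fun t => by fun_prop
    have hΨm : Measurable Ψ := measurable_pi_lambda _ fun t => by fun_prop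
    have e1 : P f = (ρ.prod (gaussianReal 0 1)).map Ψ := by
      rw [H.shift f hf, hQ, Measure.map_map (measurable_shift _) hm]
      rfl
    have e2 : P g = (ρ.prod (gaussianReal 0 1)).map (fun p => Ψ (p.1, p.2 + δ)) := by
      rw [H.shift g hg, hQ, Measure.map_map (measurable_shift _) hm]
      congr 1
      funext p t
      have : hg.toLp g = hf.toLp f + d := by rw [hd]; abel
      simp only [hΨ, Function.comp, this, inner_add_right, real_inner_smul_right, ← hδ]
      field_simp
      ring
    rw [e1, e2]
    exact prod_map_le_shift ρ hΨm hδ0 hA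

/-- Lower bound for the expected length of an interval covering two values. -/
lemma le_expectedLength (H : IsShiftModel n ν P φ Q) (hn : 0 < n) {f g : ι → ℝ}
    (hf : MemLp f 2 ν) (hg : MemLp g 2 ν) {δ α a b : ℝ} (hα1 : α ≤ 1)
    (hδ : √n * ‖hg.toLp g - hf.toLp f‖ ≤ δ) {CI : (ι → ℝ) → Set ℝ} (hCI : IsInterval CI)
    (ha : ENNReal.ofReal (1 - α) ≤ P f {y | a ∈ CI y})
    (hb : ENNReal.ofReal (1 - α) ≤ P g {y | b ∈ CI y}) :
    ENNReal.ofReal ((1 - 2 * α - (δ + δ ^ 2 / 2)) * |b - a|)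
      ≤ ∫⁻ y, volume (CI y) ∂(P f) := by
  have hPf := H.prob hf
  have hPg := H.prob hg
  have hmeas : ∀ x : ℝ, MeasurableSet {y | x ∈ CI y} := fun x =>
    measurable_prodMk_right (y := x) hCI.measurable
  have h0 : 0 ≤ √n * ‖hg.toLp g - hf.toLp f‖ := by positivity
  have h1 : (P g).real {y | b ∈ CI y} ≤ (P f).real {y | b ∈ CI y} + (δ + δ ^ 2 / 2) := by
    have := H.measure_le_add hn hg hf (δ := √n * ‖hg.toLp g - hf.toLp f‖)
      (by rw [norm_sub_rev]) (hmeas b)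
    have h2 : P g {y | b ∈ CI y} ≤ P f {y | b ∈ CI y} + ENNReal.ofReal (δ + δ ^ 2 / 2) := by
      refine this.trans (add_le_add le_rfl (ENNReal.ofReal_le_ofReal ?_))
      gcongr
    have h3 := ENNReal.toReal_mono (by simp) h2
    rw [ENNReal.toReal_add (measure_ne_top _ _) (by simp), ENNReal.toReal_ofReal] at h3
    · exact h3
    · have := h0.trans hδ
      positivity
  have hreal : ∀ {μ : Measure (ι → ℝ)} [IsProbabilityMeasure μ] {s : Set (ι → ℝ)},
      ENNReal.ofReal (1 - α) ≤ μ s → 1 - α ≤ μ.real s := by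
    intro μ _ s h
    have := ENNReal.toReal_mono (measure_ne_top _ _) h
    rwa [ENNReal.toReal_ofReal (by linarith)] at this
  have ha' := hreal ha
  have hb' := hreal hb
  -- On `E` the interval contains the whole segment between `a` and `b`; the union bound under `P f`
  -- gives `E` its probability.
  set E := {y | a ∈ CI y} ∩ {y | b ∈ CI y} with hE
  have hEm : MeasurableSet E := (hmeas a).inter (hmeas b)
  have h4 : 1 - 2 * α - (δ + δ ^ 2 / 2) ≤ (P f).real E := by
    have := measureReal_union_add_inter (μ := P f) (s := {y | a ∈ CI y}) (hmeas b)
    have h5 : (P f).real ({y | a ∈ CI y} ∪ {y | b ∈ CI y}) ≤ 1 := measureReal_le_one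
    linarith
  have h5 : ∀ y ∈ E, ENNReal.ofReal |b - a| ≤ volume (CI y) := by
    intro y hy
    rw [← Real.volume_interval]
    exact measure_mono ((hCI.ordConnected y).uIcc_subset hy.1 hy.2)
  calc ENNReal.ofReal ((1 - 2 * α - (δ + δ ^ 2 / 2)) * |b - a|)
      ≤ ENNReal.ofReal ((P f).real E * |b - a|) :=
        ENNReal.ofReal_le_ofReal (mul_le_mul_of_nonneg_right h4 (abs_nonneg _))
    _ = ∫⁻ _ in E, ENNReal.ofReal |b - a| ∂(P f) := by
        rw [setLIntegral_const, ENNReal.ofReal_mul measureReal_nonneg, ofReal_measureReal, mul_comm]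
    _ ≤ ∫⁻ y in E, volume (CI y) ∂(P f) := setLIntegral_mono' hEm h5
    _ ≤ _ := setLIntegral_le_lintegral _ _

end IsShiftModel

/-! ### The two Gaussian models are shift models -/

lemma isGaussianProcess_map {Ω T : Type*} {mΩ : MeasurableSpace Ω} {μ : Measure Ω}
    {N : T → Ω → ℝ} (hN : IsGaussianProcess N μ) (hm : ∀ t, Measurable (N t)) :
    IsGaussianProcess (fun t (y : T → ℝ) => y t) (μ.map fun ω t => N t ω) where
  hasGaussianLaw I := by
    refine ⟨?_⟩
    rw [Measure.map_map (by exact measurable_pi_lambda _ fun i => measurable_pi_apply _)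
      (measurable_pi_lambda _ hm)]
    exact (hN.hasGaussianLaw I).isGaussian_map

/-- Both models observe integrals of `f` over sets `A t`, with noise covariance `ν (A s ∩ A t)`; the
representers `φ t` are the indicators of these sets. The hypothesis `hsep` says that their span has
trivial orthogonal complement, which is density. -/
lemma isShiftModel_of_indicators {ι : Type} [MeasurableSpace ι] {n : ℝ} (hn : 0 < n)
    {ν : Measure ι} {P : (ι → ℝ) → Measure (ι → ℝ)} {Ω : Type} [MeasurableSpace Ω]
    {μ : Measure Ω} [IsProbabilityMeasure μ] {N : ι → Ω → ℝ} (hm : ∀ t, Measurable (N t))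
    (hN : IsGaussianProcess N μ) (hmean : ∀ t, ∫ ω, N t ω ∂μ = 0) {A : ι → Set ι}
    (hA : ∀ t, MeasurableSet (A t)) (hA' : ∀ t, ν (A t) ≠ ∞)
    (hcov : ∀ s t, cov[N s, N t; μ] = ν.real (A s ∩ A t))
    (hsep : ∀ h : Lp ℝ 2 ν, (∀ t, ∫ x in A t, h x ∂ν = 0) → h = 0)
    (hP : ∀ f, P f = μ.map fun ω t => (∫ x in A t, f x ∂ν) + (√n)⁻¹ * N t ω) :
    ∃ φ Q, IsShiftModel n ν P φ Q := by
  have hinner : ∀ t (h : Lp ℝ 2 ν),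
      inner ℝ (indicatorConstLp 2 (hA t) (hA' t) (1 : ℝ)) h = ∫ x in A t, h x ∂ν := fun t h =>
    L2.inner_indicatorConstLp_one (hA t) (hA' t) h
  have hmN : Measurable fun ω t => (√n)⁻¹ * N t ω :=
    measurable_pi_lambda _ fun t => (hm t).const_mul _
  refine ⟨fun t => indicatorConstLp 2 (hA t) (hA' t) (1 : ℝ), μ.map fun ω t => (√n)⁻¹ * N t ω,
    isGaussianProcess_map (N := fun t ω => (√n)⁻¹ * N t ω) (hN.smul fun _ => (√n)⁻¹)
      fun t => (hm t).const_mul _, fun t => ?_, fun s t => ?_, ?_, fun f hf => ?_⟩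
  · rw [integral_map hmN.aemeasurable (measurable_pi_apply t).aestronglyMeasurable,
      integral_const_mul, hmean, mul_zero]
  · rw [covariance_map_fun (measurable_pi_apply s).aestronglyMeasurable
      (measurable_pi_apply t).aestronglyMeasurable hmN.aemeasurable, covariance_const_mul_left,
      covariance_const_mul_right, hcov, L2.inner_indicatorConstLp_one_indicatorConstLp_one (hμs := hA' s) (hμt := hA' t),
      ← mul_assoc, ← mul_inv, Real.mul_self_sqrt hn.le]
    rfl
  · rw [Submodule.topologicalClosure_eq_top_iff, Submodule.eq_bot_iff]
    intro h hh
    refine hsep h fun t => ?_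
    rw [← hinner]
    exact (Submodule.mem_orthogonal _ _).1 hh _ (Submodule.subset_span ⟨t, rfl⟩)
  · rw [hP, Measure.map_map (IsShiftModel.measurable_shift _) hmN]
    congr 1
    funext ω t
    simp only [Function.comp, hinner]
    congr 1
    exact setIntegral_congr_ae (hA t) (hf.coeFn_toLp.symm.mono fun x hx _ => hx)

lemma lebesgueTime_apply (s : Set TimeInterval) :
    lebesgueTime s = volume (Subtype.val '' s) :=
  (MeasurableEmbedding.subtype_coe measurableSet_Icc).comap_apply _ _

instance : IsFiniteMeasure lebesgueTime where
  measure_univ_lt_top := by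
    rw [lebesgueTime_apply, Set.image_univ, Subtype.range_coe]
    exact measure_Icc_lt_top

lemma lebesgueTime_real_Iic (t : TimeInterval) :
    lebesgueTime.real (Set.Iic t) = t + 1 / 2 := by
  have : Subtype.val '' Set.Iic t = Set.Icc (-(1 / 2) : ℝ) (t : ℝ) := by
    ext x
    constructor
    · rintro ⟨y, hy, rfl⟩
      exact ⟨y.2.1, hy⟩
    · rintro ⟨h1, h2⟩
      exact ⟨⟨x, h1, h2.trans t.2.2⟩, h2, rfl⟩
  rw [measureReal_def, lebesgueTime_apply, this, Real.volume_Icc, ENNReal.toReal_ofReal]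
  · ring
  · linarith [t.2.1]

/-- Initial segments are a π-system generating the Borel sets and include the whole time interval,
so vanishing of the integral extends to all measurable sets. -/
lemma Lp_eq_zero_of_setIntegral_Iic (h : Lp ℝ 2 lebesgueTime)
    (h0 : ∀ t, ∫ x in Set.Iic t, h x ∂lebesgueTime = 0) : h = 0 := by
  have hint : Integrable h lebesgueTime := (Lp.memLp h).integrable (by norm_num)
  have huniv : ∫ x, h x ∂lebesgueTime = 0 := by
    have := h0 ⟨1 / 2, by norm_num, le_rfl⟩
    rwa [show Set.Iic (⟨1 / 2, by norm_num, le_rfl⟩ : TimeInterval) = Set.univ from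
      Set.eq_univ_of_forall fun x => x.2.2, setIntegral_univ] at this
  have hall : ∀ s, MeasurableSet s → ∫ x in s, h x ∂lebesgueTime = 0 := by
    intro s hs
    induction s, hs using MeasurableSpace.induction_on_inter
      (BorelSpace.measurable_eq.trans (borel_eq_generateFrom_Iic TimeInterval)) isPiSystem_Iic with
    | empty => simp
    | basic s hs =>
      obtain ⟨t, rfl⟩ := hs
      exact h0 t
    | compl s hs ih => rw [setIntegral_compl hs hint, ih, huniv, sub_zero]
    | iUnion f hd hf ih =>
      rw [integral_iUnion hf hd hint.integrableOn]
      simp [ih]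
  refine (Lp.eq_zero_iff_ae_eq_zero).2 ?_
  exact hint.ae_eq_zero_of_forall_setIntegral_eq_zero fun s hs _ => hall s hs

/-- Take `A t = Set.Iic t` for white noise, where the Brownian covariance is the length of `A s ∩ A
t`, and `A t = {t}` for sequences, where independence matches counting measure. -/
theorem IsGaussianModel.exists_isShiftModel {n : ℝ} (hn : 0 < n) {ι : Type} [MeasurableSpace ι]
    {ν : Measure ι} {P : (ι → ℝ) → Measure (ι → ℝ)} (h : IsGaussianModel n ι ν P) :
    ∃ φ Q, IsShiftModel n ν P φ Q := by
  cases h with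
  | whiteNoise μ B hmeas hB =>
    refine isShiftModel_of_indicators hn (μ := μ)
      (N := fun t : TimeInterval => B (Real.toNNReal ((t : ℝ) + 1 / 2))) (fun t => hmeas _)
      (hB.isGaussianProcess.comp_right _) (fun t => hB.integral_eval _)
      (A := fun t => Set.Iic t) (fun t => measurableSet_Iic) (fun t => measure_ne_top _ _)
      (fun s t => ?_) Lp_eq_zero_of_setIntegral_Iic (fun f => rfl)
    rw [hB.covariance_eval, Set.Iic_inter_Iic, lebesgueTime_real_Iic]
    have hc : ∀ t : TimeInterval, ((Real.toNNReal ((t : ℝ) + 1 / 2) : ℝ≥0) : ℝ) = t + 1 / 2 :=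
      fun t => Real.coe_toNNReal _ (by linarith [t.2.1])
    rcases le_total s t with h | h
    · have h' : (s : ℝ) ≤ t := h
      rw [min_eq_left (Real.toNNReal_mono (by linarith)), hc, inf_eq_left.2 h]
    · have h' : (t : ℝ) ≤ s := h
      rw [min_eq_right (Real.toNNReal_mono (by linarith)), hc, inf_eq_right.2 h]
  | sequence μ z hmeas hindep hlaw =>
    have hg : ∀ i, HasGaussianLaw (z i) μ := fun i => (hlaw i).hasGaussianLaw
    refine isShiftModel_of_indicators hn (μ := μ) (N := z) hmeas ⟨fun I => ?_⟩
      (fun t => ?_) (A := fun t => {t}) (fun t => measurableSet_singleton t)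
      (fun t => by simp) (fun s t => ?_) (fun h h0 => ?_) (fun f => ?_)
    · exact (hindep.precomp (g := ((↑) : I → ι)) Subtype.val_injective).hasGaussianLaw
        fun i => hg i
    · rw [(hlaw t).integral_eq, integral_id_gaussianReal]
    · rcases eq_or_ne s t with rfl | hst
      · rw [covariance_self (hmeas s).aemeasurable, (hlaw s).variance_eq,
          variance_id_gaussianReal, Set.inter_self, measureReal_def, Measure.count_singleton]
        simp
      · rw [(hindep.indepFun hst).covariance_eq_zero, measureReal_def,
          Set.disjoint_iff_inter_eq_empty.1 (by simpa using hst)]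
        · simp
        · exact (hg s).memLp_two
        · exact (hg t).memLp_two
    · refine (Lp.eq_zero_iff_ae_eq_zero).2 (ae_of_all _ fun t => ?_)
      have := h0 t
      rw [integral_singleton, measureReal_def, Measure.count_singleton] at this
      simpa using this
    · congr 1
      funext ω t
      rw [integral_singleton, measureReal_def, Measure.count_singleton]
      simp [noisySequence]

/-! ### Coverage of a shortest interval -/

section Miss

variable {Ω : Type*} {mΩ : MeasurableSpace Ω} {μ : Measure Ω}

/-- The centre of a pilot interval. -/
noncomputable def midpt (U V : Ω → ℝ) (ω : Ω) : ℝ := (U ω + V ω) / 2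

/-- The half length of a pilot interval. -/
noncomputable def halfLen (κ x : ℝ) (U V : Ω → ℝ) (ω : Ω) : ℝ := max (U ω - V ω) 0 + κ * x

/-- A pair of jointly Gaussian estimators of `τ`: `U` with bias at least `-x / 2`, `V` with bias
at most `x / 2`, and standard deviations at most `x / z`. -/
structure IsPilotPair (μ : Measure Ω) (z τ x : ℝ) (U V : Ω → ℝ) : Prop where
  nonneg : 0 ≤ x
  gaussian : ∀ a b : ℝ, HasGaussianLaw (fun ω => a * U ω + b * V ω) μ
  bias_fst : τ - x / 2 ≤ ∫ ω, U ω ∂μ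
  bias_snd : ∫ ω, V ω ∂μ ≤ τ + x / 2
  var_fst : Var[U; μ] ≤ (x / z) ^ 2
  var_snd : Var[V; μ] ≤ (x / z) ^ 2

namespace IsPilotPair

variable {z τ x κ : ℝ} {U V : Ω → ℝ}

lemma gaussian_fst (h : IsPilotPair μ z τ x U V) : HasGaussianLaw U μ := by
  simpa using h.gaussian 1 0

lemma gaussian_snd (h : IsPilotPair μ z τ x U V) : HasGaussianLaw V μ := by
  simpa using h.gaussian 0 1

lemma integral_comb (h : IsPilotPair μ z τ x U V) (a b : ℝ) :
    ∫ ω, (a * U ω + b * V ω) ∂μ = a * ∫ ω, U ω ∂μ + b * ∫ ω, V ω ∂μ := by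
  rw [integral_add (h.gaussian_fst.integrable.const_mul _) (h.gaussian_snd.integrable.const_mul _),
    integral_const_mul, integral_const_mul]

variable [IsProbabilityMeasure μ]

/-- The combination has standard deviation at most `(|a| + |b|) x / z`, so a margin of `s (|a| +
|b|) x` amounts to at least `s z` deviations. -/
lemma lt_comb_le (h : IsPilotPair μ z τ x U V) (hz : 0 < z) {a b s t : ℝ} (hs : 0 ≤ s)
    (ht : t + s * ((|a| + |b|) * x) ≤ a * ∫ ω, U ω ∂μ + b * ∫ ω, V ω ∂μ) :
    μ.real {ω | a * U ω + b * V ω < t} ≤ normalTail (s * z) := by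
  have hx := h.nonneg
  refine measureReal_lt_le_normalTail (h.gaussian a b) (σ := |a| * (x / z) + |b| * (x / z))
    (by positivity) (by positivity) (variance_linear_comb_le h.gaussian_fst.memLp_two
      h.gaussian_snd.memLp_two (by positivity) (by positivity) h.var_fst h.var_snd a b) ?_
  rw [h.integral_comb, show s * z * (|a| * (x / z) + |b| * (x / z)) = s * ((|a| + |b|) * x) by
    field_simp]
  linarith

lemma comb_lt_le (h : IsPilotPair μ z τ x U V) (hz : 0 < z) {a b s t : ℝ} (hs : 0 ≤ s)
    (ht : a * (∫ ω, U ω ∂μ) + b * (∫ ω, V ω ∂μ) + s * ((|a| + |b|) * x) ≤ t) :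
    μ.real {ω | t < a * U ω + b * V ω} ≤ normalTail (s * z) := by
  have := h.lt_comb_le hz (a := -a) (b := -b) (t := -t) hs (by rw [abs_neg, abs_neg]; linarith)
  refine le_trans (measureReal_mono fun ω hω => ?_) this
  simp only [Set.mem_ofPred_eq] at hω ⊢
  linarith

/-- The event that the pilot interval misses `τ`. -/
def missEvent (κ x τ : ℝ) (U V : Ω → ℝ) : Set Ω :=
  {ω | midpt U V ω + halfLen κ x U V ω < τ} ∪ {ω | τ < midpt U V ω - halfLen κ x U V ω}

/-- For `θ` in `[0, 1]`, `θ (U - V) ≤ (U - V)₊`. Bounding the positive part below this way turns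
each way of missing into a deviation of a linear combination, which is Gaussian; `θ` is then chosen
according to the means. -/
lemma miss_le_of_comb (h : IsPilotPair μ z τ x U V) (hz : 0 < z) {θ s₁ s₂ : ℝ} (hθ0 : 0 ≤ θ)
    (hθ1 : θ ≤ 1) (hs₁ : 0 ≤ s₁) (hs₂ : 0 ≤ s₂)
    (h1 : τ - κ * x + s₁ * ((|1 / 2 + θ| + |1 / 2 - θ|) * x)
      ≤ (1 / 2 + θ) * (∫ ω, U ω ∂μ) + (1 / 2 - θ) * ∫ ω, V ω ∂μ)
    (h2 : (1 / 2 - θ) * (∫ ω, U ω ∂μ) + (1 / 2 + θ) * (∫ ω, V ω ∂μ)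
      + s₂ * ((|1 / 2 + θ| + |1 / 2 - θ|) * x) ≤ τ + κ * x) :
    μ.real (missEvent κ x τ U V) ≤ normalTail (s₁ * z) + normalTail (s₂ * z) := by
  have key : ∀ ω, θ * (U ω - V ω) ≤ max (U ω - V ω) 0 := by
    intro ω
    rcases le_total 0 (U ω - V ω) with h0 | h0
    · rw [max_eq_left h0]
      nlinarith
    · rw [max_eq_right h0]
      nlinarith
  refine (measureReal_union_le _ _).trans (add_le_add ?_ ?_)
  · refine le_trans (measureReal_mono fun ω hω => ?_) (h.lt_comb_le hz hs₁ h1)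
    simp only [Set.mem_ofPred_eq, midpt, halfLen] at hω ⊢
    linarith [key ω]
  · refine le_trans (measureReal_mono fun ω hω => ?_)
      (h.comb_lt_le hz (a := 1 / 2 - θ) (b := 1 / 2 + θ) (t := τ + κ * x) hs₂
        (by rw [add_comm |1 / 2 - θ|]; exact h2))
    simp only [Set.mem_ofPred_eq, midpt, halfLen] at hω ⊢
    linarith [key ω]

/-- Let `p ≥ -1/2` and `q ≤ 1/2` be the biases of `U` and `V` in units of `x`. If `p ≤ q`, the
midpoint (`θ = 0`) has bias in `[-1/2, 1/2]`; otherwise `θ = 1/2` compares `τ` with `U + κx` and `V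
- κx`. The worst case is a bias of one half, by `normalTail_add_normalTail_le`. -/
lemma miss_le (h : IsPilotPair μ z τ x U V) (hz : 0 < z) (hκ : 1 ≤ κ) :
    μ.real (missEvent κ x τ U V)
      ≤ normalTail ((κ - 1 / 2) * z) + normalTail ((κ + 1 / 2) * z) := by
  have hb1 := h.bias_fst
  have hb2 := h.bias_snd
  have hconv : ∀ c : ℝ, |c| ≤ 1 / 2 → normalTail ((κ - c) * z) + normalTail ((κ + c) * z)
      ≤ normalTail ((κ - 1 / 2) * z) + normalTail ((κ + 1 / 2) * z) := by
    intro c hc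
    have := normalTail_add_normalTail_le (x := κ * z) (c := c * z) (h := 1 / 2 * z)
      (by rw [abs_mul, abs_of_pos hz]; gcongr) (by gcongr; linarith)
    simpa only [sub_mul, add_mul] using this
  rcases h.nonneg.eq_or_lt with hx | hx
  · subst hx
    refine h.miss_le_of_comb hz (θ := 1 / 2) (by norm_num) (by norm_num) (by linarith)
      (by linarith) ?_ ?_ <;> norm_num at * <;> linarith
  · set p := (∫ ω, U ω ∂μ - τ) / x
    set q := (∫ ω, V ω ∂μ - τ) / x
    have hp : ∫ ω, U ω ∂μ = τ + p * x := by simp only [p]; field_simp; ring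
    have hq : ∫ ω, V ω ∂μ = τ + q * x := by simp only [q]; field_simp; ring
    have hp' : -(1 / 2) ≤ p := by
      by_contra hlt
      have := mul_lt_mul_of_pos_right (not_le.1 hlt) hx
      linarith
    have hq' : q ≤ 1 / 2 := by
      by_contra hlt
      have := mul_lt_mul_of_pos_right (not_le.1 hlt) hx
      linarith
    rcases le_total p q with hpq | hpq
    · have hc : |(p + q) / 2| ≤ 1 / 2 := abs_le.2 ⟨by linarith, by linarith⟩
      have hc' := abs_le.1 hc
      have := h.miss_le_of_comb (κ := κ) hz (θ := 0) (s₁ := κ + (p + q) / 2)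
        (s₂ := κ - (p + q) / 2) le_rfl zero_le_one (by linarith) (by linarith)
        (by rw [hp, hq]; norm_num; linarith) (by rw [hp, hq]; norm_num; linarith)
      linarith [hconv _ hc]
    · have hm := h.miss_le_of_comb (κ := κ) hz (θ := 1 / 2) (s₁ := κ + p)
        (s₂ := κ - q) (by norm_num) (by norm_num) (by linarith) (by linarith)
        (by rw [hp, hq]; norm_num; linarith) (by rw [hp, hq]; norm_num; linarith)
      refine hm.trans ?_
      rcases le_total (1 / 2) p with h1 | h1
      · rw [add_comm]
        refine add_le_add (normalTail_anti ?_) (normalTail_anti ?_) <;>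
          exact mul_le_mul_of_nonneg_right (by linarith) hz.le
      · refine le_trans ?_ (hconv p (abs_le.2 ⟨by linarith, h1⟩))
        rw [add_comm]
        refine add_le_add (normalTail_anti ?_) le_rfl
        exact mul_le_mul_of_nonneg_right (by linarith) hz.le

/-- With `θ = 1` the combinations are `U + (U - V)/2` and `V - (U - V)/2`, of deviation at most
`2x/z`. The gap of means supplies an extra margin `(M - κx)/2`; as `M ≥ (16/3) κ x 2^r`, the total
margin is at least `2x` times the stated coefficient. -/
lemma miss_far_le (h : IsPilotPair μ z τ x U V) (hz : 0 < z) (hκ : 1 ≤ κ) {M : ℝ} (r : ℕ)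
    (hxM : κ * x * 2 ^ r ≤ 3 / 16 * M)
    (hM : M ≤ max (∫ ω, U ω ∂μ - ∫ ω, V ω ∂μ) 0 + κ * x) :
    μ.real (missEvent κ x τ U V)
      ≤ 2 * normalTail (((κ - 1) / 4 + 4 * κ / 3 * 2 ^ r) * z) := by
  have hb1 := h.bias_fst
  have hb2 := h.bias_snd
  have hx := h.nonneg
  have hr : (1 : ℝ) ≤ 2 ^ r := one_le_pow₀ (by norm_num)
  have hxr : κ * x ≤ κ * x * 2 ^ r := le_mul_of_one_le_right (by positivity) hr
  -- If the positive part vanishes, then `M ≤ κx ≤ 3M/16` forces `x = M = 0`, and the bias bounds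
  -- give the claim.
  have hM' : M ≤ (∫ ω, U ω ∂μ - ∫ ω, V ω ∂μ) + κ * x := by
    rcases le_total 0 (∫ ω, U ω ∂μ - ∫ ω, V ω ∂μ) with h0 | h0
    · rwa [max_eq_left h0] at hM
    · rw [max_eq_right h0, zero_add] at hM
      have : x ≤ κ * x := le_mul_of_one_le_left hx hκ
      linarith
  have hs : 0 ≤ (κ - 1) / 4 + 4 * κ / 3 * 2 ^ r := by
    have : 0 ≤ 4 * κ / 3 * 2 ^ r := by positivity
    linarith
  rw [two_mul]
  refine h.miss_le_of_comb hz (θ := 1) zero_le_one le_rfl hs hs ?_ ?_ <;>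
    norm_num <;> nlinarith

end IsPilotPair

variable [IsProbabilityMeasure μ]

/-- The shortest interval in a doubling family of pilot intervals has the nominal coverage. -/
theorem measure_shortest_misses_le {z τ κ : ℝ}
    (hκz : (κ = 2 ∧ 1.2 ≤ z) ∨ (κ = 3 ∧ 0.65 ≤ z)) {m : ℕ} {x : ℕ → ℝ} {U V : ℕ → Ω → ℝ}
    (h : ∀ i, 1 ≤ i → i ≤ m → IsPilotPair μ z τ (x i) (U i) (V i))
    (hdouble : ∀ i, 1 ≤ i → i < m → 2 * x i ≤ x (i + 1)) :
    μ.real {ω | ∃ i, 1 ≤ i ∧ i ≤ m ∧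
      (∀ b, 1 ≤ b → b ≤ m → halfLen κ (x i) (U i) (V i) ω ≤ halfLen κ (x b) (U b) (V b) ω) ∧
      ω ∈ IsPilotPair.missEvent κ (x i) τ (U i) (V i)} ≤ 2 * normalTail z := by
  have hκ : 1 ≤ κ := by rcases hκz with h | h <;> linarith [h.1]
  have hz : 0 < z := by
    rcases hκz with h | h
    · have := h.2; norm_num at this; linarith
    · have := h.2; norm_num at this; linarith
  rcases Nat.eq_zero_or_pos m with hm | hm
  · rw [show {ω | ∃ i, 1 ≤ i ∧ i ≤ m ∧ (∀ b, 1 ≤ b → b ≤ m → halfLen κ (x i) (U i) (V i) ω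
      ≤ halfLen κ (x b) (U b) (V b) ω) ∧ ω ∈ IsPilotPair.missEvent κ (x i) τ (U i) (V i)} = ∅ by
        ext ω
        simp only [Set.mem_ofPred_eq, Set.mem_empty_iff_false, iff_false]
        rintro ⟨i, h1, h2, -⟩
        omega]
    simpa using normalTail_nonneg z
  -- `W` is the half length with the estimators replaced by their means, `b` minimises it, and `s`
  -- below is the last scale with `κx ≤ 3M`.
  set W : ℕ → ℝ := fun i => max (∫ ω, U i ω ∂μ - ∫ ω, V i ω ∂μ) 0 + κ * x i with hW
  obtain ⟨b, hb, hmin⟩ := (Finset.Icc 1 m).exists_min_image W ⟨1, by simp; omega⟩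
  rw [Finset.mem_Icc] at hb
  set M := W b
  have hxb := (h b hb.1 hb.2).nonneg
  have hMb : κ * x b ≤ M := le_add_of_nonneg_left (le_max_right _ _)
  have hM0 : 0 ≤ M := le_trans (by positivity) hMb
  obtain ⟨s, hs, hsmax⟩ := ((Finset.Icc 1 m).filter fun i => κ * x i ≤ 3 * M).exists_max_image id
    ⟨b, by simp [hb.1, hb.2]; linarith⟩
  simp only [Finset.mem_filter, Finset.mem_Icc, id] at hs hsmax
  have hgrow : ∀ d, d < s → x (s - d) * 2 ^ d ≤ x s := by
    intro d
    induction d with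
    | zero => simp
    | succ d ih =>
      intro hd
      have h1 := hdouble (s - (d + 1)) (by omega) (by omega)
      rw [show s - (d + 1) + 1 = s - d by omega] at h1
      have h2 := ih (by omega)
      have h3 : (0 : ℝ) < 2 ^ d := by positivity
      rw [pow_succ]
      nlinarith
  have hmiss : ∀ d, d < s →
      μ.real (IsPilotPair.missEvent κ (x (s - d)) τ (U (s - d)) (V (s - d)))
        ≤ missBound κ z d := by
    intro d hd
    have hp := h (s - d) (by omega) (by omega)
    rw [missBound]
    split_ifs with hd4
    · exact hp.miss_le hz hκ
    · refine hp.miss_far_le hz hκ (M := M) (d - 4) ?_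
        (hmin (s - d) (Finset.mem_Icc.2 ⟨by omega, by omega⟩))
      have h1 := hgrow d hd
      -- Together with `κ x_s ≤ 3M`, the factor `16` gives the constant `3/16` of `miss_far_le`.
      have h2 : (2 : ℝ) ^ d = 2 ^ (d - 4) * 16 := by
        rw [show (16 : ℝ) = 2 ^ 4 by norm_num, ← pow_add]
        congr 1
        omega
      rw [h2] at h1
      have h3 := mul_le_mul_of_nonneg_left h1 (by linarith : (0 : ℝ) ≤ κ)
      linarith [hs.2]
  -- A shortest interval with `κ x_i > 3M` forces the half length at `b` above `3M`; otherwise `i ≤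
  -- s` and `i` is one of the scales `s - d`.
  have hsub : {ω | ∃ i, 1 ≤ i ∧ i ≤ m ∧ (∀ b, 1 ≤ b → b ≤ m →
      halfLen κ (x i) (U i) (V i) ω ≤ halfLen κ (x b) (U b) (V b) ω) ∧
      ω ∈ IsPilotPair.missEvent κ (x i) τ (U i) (V i)} ⊆
      (⋃ d ∈ Finset.range s, IsPilotPair.missEvent κ (x (s - d)) τ (U (s - d)) (V (s - d)))
        ∪ {ω | 3 * M - κ * x b < 1 * U b ω + (-1) * V b ω} := by
    rintro ω ⟨i, hi1, him, hshort, hmem⟩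
    by_cases hi : κ * x i ≤ 3 * M
    · left
      have := hsmax i ⟨⟨hi1, him⟩, hi⟩
      simp only [Set.mem_iUnion, Finset.mem_range]
      refine ⟨s - i, by omega, ?_⟩
      rwa [show s - (s - i) = i by omega]
    · right
      have h1 := hshort b hb.1 hb.2
      have h2 : 0 ≤ max (U i ω - V i ω) 0 := le_max_right _ _
      simp only [halfLen] at h1
      have h3 : 3 * M - κ * x b < max (U b ω - V b ω) 0 := by linarith [not_le.1 hi]
      rcases lt_max_iff.1 h3 with h4 | h4
      · simp only [Set.mem_ofPred_eq]
        linarith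
      · linarith
  -- The mean of `U_b - V_b` is at most `M - κ x_b`, so the excess is at least `2M ≥ 2κ x_b`, which
  -- is `κz` deviations of at most `2 x_b / z`.
  have hfar : μ.real {ω | 3 * M - κ * x b < 1 * U b ω + (-1) * V b ω} ≤ normalTail (κ * z) := by
    refine (h b hb.1 hb.2).comb_lt_le hz (by linarith) ?_
    have : ∫ ω, U b ω ∂μ - ∫ ω, V b ω ∂μ ≤ M - κ * x b := by
      have h1 := le_max_left (∫ ω, U b ω ∂μ - ∫ ω, V b ω ∂μ) 0
      have h2 : M = max (∫ ω, U b ω ∂μ - ∫ ω, V b ω ∂μ) 0 + κ * x b := rfl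
      linarith
    norm_num
    linarith
  calc _ ≤ _ := measureReal_mono hsub
    _ ≤ _ := measureReal_union_le _ _
    _ ≤ ∑ d ∈ Finset.range s, missBound κ z d + normalTail (κ * z) := by
        refine add_le_add ((measureReal_biUnion_finset_le _ _).trans
          (Finset.sum_le_sum fun d hd => hmiss d (Finset.mem_range.1 hd))) hfar
    _ ≤ _ := sum_missBound_le κ z hκz s

end Miss

/-! ### Moduli of continuity and balanced estimators -/

section Moduli

variable {ι : Type} [MeasurableSpace ι] {ν : Measure ι} {T : (ι → ℝ) →ₗ[ℝ] ℝ} {ε : ℝ}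
  {A B A' B' : Set (ι → ℝ)} {f g : ι → ℝ}

lemma le_orderedModulus (hf : f ∈ A) (hg : g ∈ B)
    (h : eLpNorm (g - f) 2 ν ≤ ENNReal.ofReal ε) :
    ((T g - T f : ℝ) : EReal) ≤ orderedModulus ν T ε A B :=
  le_sSup ⟨f, hf, g, hg, h, rfl⟩

lemma le_betweenModulus (hf : f ∈ A) (hg : g ∈ B)
    (h : eLpNorm (g - f) 2 ν ≤ ENNReal.ofReal ε) :
    ((|T g - T f| : ℝ) : EReal) ≤ betweenModulus ν T ε A B :=
  le_sSup ⟨f, hf, g, hg, h, rfl⟩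

lemma orderedModulus_le_betweenModulus :
    orderedModulus ν T ε A B ≤ betweenModulus ν T ε A B := by
  refine sSup_le ?_
  rintro _ ⟨f, hf, g, hg, h, rfl⟩
  exact (EReal.coe_le_coe_iff.2 (le_abs_self _)).trans (le_betweenModulus hf hg h)

lemma orderedModulus_swap_le_betweenModulus :
    orderedModulus ν T ε B A ≤ betweenModulus ν T ε A B := by
  refine sSup_le ?_
  rintro _ ⟨g, hg, f, hf, h, rfl⟩
  rw [eLpNorm_sub_comm] at h
  refine (EReal.coe_le_coe_iff.2 ?_).trans (le_betweenModulus hf hg h)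
  rw [abs_sub_comm]
  exact le_abs_self _

lemma betweenModulus_le_max :
    betweenModulus ν T ε A B ≤ max (orderedModulus ν T ε A B) (orderedModulus ν T ε B A) := by
  refine sSup_le ?_
  rintro _ ⟨f, hf, g, hg, h, rfl⟩
  rcases abs_cases (T g - T f) with ⟨e, -⟩ | ⟨e, -⟩
  · rw [e]
    exact (le_orderedModulus hf hg h).trans (le_max_left _ _)
  · rw [e, neg_sub]
    rw [eLpNorm_sub_comm] at h
    exact (le_orderedModulus hg hf h).trans (le_max_right _ _)

lemma betweenModulus_mono (hA : A ⊆ A') (hB : B ⊆ B') :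
    betweenModulus ν T ε A B ≤ betweenModulus ν T ε A' B' := by
  refine sSup_le ?_
  rintro _ ⟨f, hf, g, hg, h, rfl⟩
  exact le_betweenModulus (hA hf) (hB hg) h

lemma orderedModulus_nonneg (h : (A ∩ B).Nonempty) : 0 ≤ orderedModulus ν T ε A B := by
  obtain ⟨f, hA, hB⟩ := h
  simpa using le_orderedModulus (ν := ν) (T := T) (ε := ε) hA hB (by simp)

lemma eLpNorm_sub_le_iff (hf : MemLp f 2 ν) (hg : MemLp g 2 ν) (hε : 0 ≤ ε) :
    eLpNorm (g - f) 2 ν ≤ ENNReal.ofReal ε ↔ ‖hg.toLp g - hf.toLp f‖ ≤ ε := by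
  rw [← MemLp.toLp_sub, Lp.norm_toLp, ENNReal.le_ofReal_iff_toReal_le (hg.sub hf).2.ne hε]

/-- If a convex set `K` of pairs `(v, t)` contains the origin and satisfies `t ≤ x` whenever
`‖v‖ < ε`, then `t - ⟪w, v⟫ ≤ x` on `K` for some `w` with `ε ‖w‖ ≤ x`. -/
lemma exists_inner_dominating_of_convex {E : Type*} [NormedAddCommGroup E]
    [InnerProductSpace ℝ E] [CompleteSpace E] {K : Set (E × ℝ)} (hK : Convex ℝ K) (h0K : 0 ∈ K)
    (hε : 0 < ε) {x : ℝ} (hKx : ∀ p ∈ K, ‖p.1‖ < ε → p.2 ≤ x) :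
    ∃ w : E, ε * ‖w‖ ≤ x ∧ ∀ p ∈ K, p.2 - inner ℝ w p.1 ≤ x := by
  have hdisj : Disjoint (Metric.ball (0 : E) ε ×ˢ Set.Ioi x) K := by
    rw [Set.disjoint_left]
    rintro p ⟨h1, h2⟩ hp
    rw [mem_ball_zero_iff] at h1
    exact absurd (hKx p hp h1) (not_le.2 h2)
  obtain ⟨ℓ, u, hO, hC⟩ := geometric_hahn_banach_open
    ((convex_ball (0 : E) ε).prod (convex_Ioi x)) (Metric.isOpen_ball.prod isOpen_Ioi)
    hK hdisj
  have hsplit : ∀ v t, ℓ (v, t) = ℓ (v, 0) + t * ℓ (0, 1) := by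
    intro v t
    rw [← smul_eq_mul, ← map_smul, ← map_add]
    simp
  set β := ℓ (0, 1)
  have hu : u ≤ 0 := by
    have := hC 0 h0K
    rwa [map_zero] at this
  have hx0 : 0 ≤ x := by simpa [hε] using hKx 0 h0K
  -- The separating hyperplane is not vertical, since the box contains a point directly above the
  -- origin of `K`.
  have hβ : β < 0 := by
    have := hO (0, x + 1) ⟨by simpa using hε, by simp⟩
    rw [hsplit, show ((0, 0) : E × ℝ) = 0 from rfl, map_zero] at this
    nlinarith
  have hβ0 : β ≠ 0 := hβ.ne
  -- Let the second coordinate decrease to the excluded edge `x` of the box.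
  have hball : ∀ v : E, ‖v‖ < ε → ℓ (v, 0) + x * β ≤ u := by
    intro v hv
    refine le_of_forall_pos_lt_add fun η hη => ?_
    have := hO (v, x + η / (-β)) ⟨by simpa using hv, by
      have : 0 < η / (-β) := div_pos hη (by linarith)
      rw [Set.mem_Ioi]
      linarith⟩
    rw [hsplit, add_mul, show η / (-β) * β = -η by field_simp] at this
    linarith
  -- Dividing by `-β` gives the second coordinate the coefficient `-1`; the Riesz representer of the
  -- first part is then `w`.
  set L : E →L[ℝ] ℝ := (-β)⁻¹ • ℓ.comp (ContinuousLinearMap.inl ℝ E ℝ)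
  have hL : ∀ v, ℓ (v, 0) = (-β) * L v := by
    intro v
    simp only [L, smul_apply, ContinuousLinearMap.comp_apply, ContinuousLinearMap.inl_apply,
      smul_eq_mul]
    field_simp
  set w := (InnerProductSpace.toDual ℝ E).symm L
  have hw : ∀ v, inner ℝ w v = L v := fun v => InnerProductSpace.toDual_symm_apply
  refine ⟨w, ?_, fun p hp => ?_⟩
  · rcases eq_or_ne w 0 with h0 | h0
    · simpa [h0] using hx0
    · have hw0 : 0 < ‖w‖ := norm_pos_iff.2 h0
      rw [← le_div_iff₀ hw0]
      refine le_of_forall_lt_imp_le_of_dense fun r hr => ?_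
      rcases le_total r 0 with hr0 | hr0
      · exact hr0.trans (by positivity)
      have h1 := hball ((r / ‖w‖) • w) (by
        rw [norm_smul, Real.norm_of_nonneg (by positivity)]
        field_simp
        exact hr)
      rw [hL, ← hw, real_inner_smul_right, real_inner_self_eq_norm_sq] at h1
      have h2 : r / ‖w‖ * ‖w‖ ^ 2 = r * ‖w‖ := by field_simp
      rw [h2] at h1
      rw [le_div_iff₀ hw0]
      nlinarith
  · have h1 := hC p hp
    rw [← Prod.mk.eta (p := p), hsplit, hL, ← hw] at h1
    have h2 := hball 0 (by simpa using hε)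
    rw [hL, map_zero] at h2
    nlinarith

/-- A linear functional whose ordered modulus is at most `x` is dominated, between the two convex
classes, by a continuous linear functional up to `x`. -/
lemma exists_inner_dominating (hA : Convex ℝ A) (hB : Convex ℝ B)
    (hAL : ∀ f ∈ A, MemLp f 2 ν) (hBL : ∀ f ∈ B, MemLp f 2 ν) (hAB : (A ∩ B).Nonempty)
    (hε : 0 < ε) {x : ℝ} (hx : orderedModulus ν T ε A B ≤ (x : EReal)) :
    ∃ w : Lp ℝ 2 ν, ε * ‖w‖ ≤ x ∧ ∀ f (hf : f ∈ A) g (hg : g ∈ B),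
      T g - inner ℝ w ((hBL g hg).toLp g) - (T f - inner ℝ w ((hAL f hf).toLp f)) ≤ x := by
  have hK : Convex ℝ {p : Lp ℝ 2 ν × ℝ | ∃ f, ∃ hf : f ∈ A, ∃ g, ∃ hg : g ∈ B,
      p.1 = (hBL g hg).toLp g - (hAL f hf).toLp f ∧ p.2 = T g - T f} := by
    rintro p ⟨f, hf, g, hg, h1, h2⟩ p' ⟨f', hf', g', hg', h1', h2'⟩ a b ha hb hab
    refine ⟨a • f + b • f', hA hf hf' ha hb hab, a • g + b • g', hB hg hg' ha hb hab, ?_, ?_⟩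
    · rw [MemLp.toLp_add ((hBL g hg).const_smul a) ((hBL g' hg').const_smul b),
        MemLp.toLp_add ((hAL f hf).const_smul a) ((hAL f' hf').const_smul b),
        MemLp.toLp_const_smul a (hBL g hg), MemLp.toLp_const_smul b (hBL g' hg'),
        MemLp.toLp_const_smul a (hAL f hf), MemLp.toLp_const_smul b (hAL f' hf'),
        Prod.fst_add, Prod.smul_fst, Prod.smul_fst, h1, h1', smul_sub, smul_sub]
      exact sub_add_sub_comm _ _ _ _
    · rw [Prod.snd_add, Prod.smul_snd, Prod.smul_snd, h2, h2']
      simp only [map_add, map_smul, smul_eq_mul]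
      ring
  obtain ⟨w, hw, h⟩ := exists_inner_dominating_of_convex hK (x := x) (by
    obtain ⟨f, hf, hf'⟩ := hAB
    exact ⟨f, hf, f, hf', by simp, by simp⟩) hε (by
    rintro p ⟨f, hf, g, hg, h1, h2⟩ hp
    rw [h1] at hp
    rw [h2]
    exact EReal.coe_le_coe_iff.1 ((le_orderedModulus (T := T) hf hg
      ((eLpNorm_sub_le_iff (hAL f hf) (hBL g hg) hε.le).2 hp.le)).trans hx))
  refine ⟨w, hw, fun f hf g hg => ?_⟩
  have := h (_, _) ⟨f, hf, g, hg, rfl, rfl⟩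
  rw [inner_sub_right] at this
  linarith

end Moduli

/-! ### Unions, their hulls, and estimators with balanced bias -/

section Unions

variable {ι : Type} {F : ℕ → Set (ι → ℝ)} {i j k : ℕ}

lemma partialUnion_mono (h : i ≤ j) : partialUnion F i ⊆ partialUnion F j :=
  Set.biUnion_subset_biUnion_left fun l hl => by
    have := Finset.mem_Icc.1 hl
    exact Finset.mem_Icc.2 ⟨this.1, this.2.trans h⟩

lemma subset_partialUnion (hi : 1 ≤ i) (h : i ≤ j) : F i ⊆ partialUnion F j :=
  Set.subset_biUnion_of_mem (u := F) (Finset.mem_Icc.2 ⟨hi, h⟩)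

lemma hullUnion_mono (h : i ≤ j) : hullUnion F i ⊆ hullUnion F j :=
  convexHull_mono (partialUnion_mono h)

lemma partialUnion_subset_hullUnion : partialUnion F i ⊆ hullUnion F i := subset_convexHull ℝ _

lemma hullUnion_inter_nonempty (h1 : (F 1).Nonempty) (hi : 1 ≤ i) (hj : 1 ≤ j) :
    (hullUnion F i ∩ hullUnion F j).Nonempty := by
  obtain ⟨f, hf⟩ := h1
  exact ⟨f, partialUnion_subset_hullUnion (subset_partialUnion le_rfl hi hf),
    partialUnion_subset_hullUnion (subset_partialUnion le_rfl hj hf)⟩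

variable [MeasurableSpace ι] {ν : Measure ι}

lemma memLp_of_mem_hullUnion (hF : ∀ j, 1 ≤ j → j ≤ k → ∀ f ∈ F j, MemLp f 2 ν) (hik : i ≤ k) :
    ∀ f ∈ hullUnion F i, MemLp f 2 ν := by
  have hc : Convex ℝ {f : ι → ℝ | MemLp f 2 ν} := fun f hf g hg a b _ _ _ =>
    MemLp.add (MemLp.const_smul hf a) (MemLp.const_smul hg b)
  refine convexHull_min ?_ hc
  intro f hf
  simp only [partialUnion, Set.mem_iUnion, Finset.mem_Icc] at hf
  obtain ⟨l, hl, hf⟩ := hf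
  exact hF l hl.1 (hl.2.trans hik) f hf

variable {n α : ℝ} {P : (ι → ℝ) → Measure (ι → ℝ)} {φ : ι → Lp ℝ 2 ν} {Q : Measure (ι → ℝ)}
  {T : (ι → ℝ) →ₗ[ℝ] ℝ}

/-- With `w` from `exists_inner_dominating`, `T - ⟪w, ·⟫` on the hull of `G_j` exceeds its values on
the hull of `G_i` by at most `x`, which leaves room for a constant term meeting both bias bounds.
The bound `(z/√n) ‖w‖ ≤ x` is exactly the variance bound. For an infinite modulus there is nothing
to meet, and zero weight serves. -/
lemma IsShiftModel.exists_isBalancedEstimator (H : IsShiftModel n ν P φ Q) (hn : 0 < n)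
    (hz : 0 < zq (α / 2)) (h1 : (F 1).Nonempty)
    (hF : ∀ j, 1 ≤ j → j ≤ k → ∀ f ∈ F j, MemLp f 2 ν)
    (hi : 1 ≤ i) (hik : i ≤ k) (hj : 1 ≤ j) (hjk : j ≤ k) :
    ∃ S, IsBalancedEstimator ν P T n α F i j S := by
  have hne := hullUnion_inter_nonempty h1 hi hj
  have hε : 0 < zq (α / 2) / √n := by positivity
  have h0 : 0 ≤ hullModulus ν T n α F i j := orderedModulus_nonneg hne
  induction hω : hullModulus ν T n α F i j with
  | bot => rw [hω] at h0; simp at h0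
  | top =>
    obtain ⟨S, hS, -⟩ := H.exists_linearEstimator 0 0
    have hz2 : (0 : ℝ) < 1 / zq (α / 2) ^ 2 := by positivity
    have hhalf : ((1 / 2 : ℝ) : EReal) * ⊤ = ⊤ := EReal.coe_mul_top_of_pos (by norm_num)
    refine ⟨S, hS, fun f _ => ?_, fun f _ => ?_, fun f _ => ?_⟩
    · rw [hω, sq (⊤ : EReal), EReal.top_mul_top, EReal.coe_mul_top_of_pos hz2]
      exact le_top
    · rw [hω, hhalf, EReal.neg_top]
      exact bot_le
    · rw [hω, hhalf]
      exact le_top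
  | coe x =>
    rw [hω] at h0
    have hx0 : 0 ≤ x := EReal.coe_nonneg.1 h0
    have hiL := memLp_of_mem_hullUnion hF hik
    have hjL := memLp_of_mem_hullUnion hF hjk
    obtain ⟨w, hw, hdom⟩ := exists_inner_dominating (convex_convexHull ℝ _)
      (convex_convexHull ℝ _) hiL hjL hne hε (x := x) hω.le
    -- The constant term is the supremum of the lower constraints; each upper constraint bounds all
    -- of them.
    obtain ⟨a, ha⟩ : ∃ a, (∀ b : hullUnion F j,
        T b - inner ℝ w ((hjL b b.2).toLp b) - x / 2 ≤ a) ∧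
        ∀ b : hullUnion F i, a ≤ T b - inner ℝ w ((hiL b b.2).toLp b) + x / 2 := by
      have : Nonempty (hullUnion F i) := ⟨⟨_, hne.some_mem.1⟩⟩
      have : Nonempty (hullUnion F j) := ⟨⟨_, hne.some_mem.2⟩⟩
      have hle : ∀ (g : hullUnion F j) (f : hullUnion F i),
          T g - inner ℝ w ((hjL g g.2).toLp g) - x / 2
            ≤ T f - inner ℝ w ((hiL f f.2).toLp f) + x / 2 := fun g f => by
        linarith [hdom f f.2 g g.2]
      refine ⟨⨆ g : hullUnion F j, (T g - inner ℝ w ((hjL g g.2).toLp g) - x / 2), fun b => ?_,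
        fun b => ciSup_le fun g => hle g b⟩
      refine le_ciSup (f := fun g : hullUnion F j =>
        T g - inner ℝ w ((hjL g g.2).toLp g) - x / 2) ?_ b
      exact ⟨_, Set.forall_mem_range.2 fun g => hle g (Classical.arbitrary _)⟩
    obtain ⟨S, hS, hmom⟩ := H.exists_linearEstimator w a
    refine ⟨S, hS, fun f hf => ?_, fun f hf => ?_, fun f hf => ?_⟩
    · rw [hω, (hmom f hf).2, ← EReal.coe_pow, ← EReal.coe_mul, EReal.coe_le_coe_iff]
      have h2 : (zq (α / 2) / √n * ‖w‖) ^ 2 ≤ x ^ 2 := pow_le_pow_left₀ (by positivity) hw 2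
      rw [mul_pow, div_pow, Real.sq_sqrt hn.le] at h2
      rw [one_div, le_inv_mul_iff₀ (by positivity)]
      calc _ = zq (α / 2) ^ 2 / n * ‖w‖ ^ 2 := by ring
        _ ≤ _ := h2
    · have hf' := partialUnion_subset_hullUnion hf
      rw [hω, (hmom f (hjL f hf')).1, ← EReal.coe_mul, ← EReal.coe_neg, EReal.coe_le_coe_iff]
      linarith [ha.1 ⟨f, hf'⟩]
    · have hf' := partialUnion_subset_hullUnion hf
      rw [hω, (hmom f (hiL f hf')).1, ← EReal.coe_mul, EReal.coe_le_coe_iff]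
      linarith [ha.2 ⟨f, hf'⟩]

lemma hullModulus_le_xi : hullModulus ν T n α F j k ≤ xi ν T n α F k j :=
  orderedModulus_le_betweenModulus

lemma hullModulus_swap_le_xi : hullModulus ν T n α F k j ≤ xi ν T n α F k j :=
  orderedModulus_swap_le_betweenModulus

lemma xi_mono (h : i ≤ j) : xi ν T n α F k i ≤ xi ν T n α F k j :=
  betweenModulus_mono (hullUnion_mono h) Set.Subset.rfl

lemma xi_nonneg (h1 : (F 1).Nonempty) (hj : 1 ≤ j) (hk : 1 ≤ k) : 0 ≤ xi ν T n α F k j :=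
  (orderedModulus_nonneg (hullUnion_inter_nonempty h1 hj hk)).trans
    orderedModulus_le_betweenModulus

lemma IsBalancedEstimator.of_le {S : (ι → ℝ) → ℝ} (hz : 0 < zq (α / 2))
    (h : IsBalancedEstimator ν P T n α F i j S) {x : ℝ} (h0 : 0 ≤ hullModulus ν T n α F i j)
    (hx : hullModulus ν T n α F i j ≤ (x : EReal)) :
    0 ≤ x ∧ (∀ f, MemLp f 2 ν → Var[S; P f] ≤ (x / zq (α / 2)) ^ 2) ∧
      (∀ f ∈ partialUnion F j, T f - x / 2 ≤ ∫ y, S y ∂(P f)) ∧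
      ∀ f ∈ partialUnion F i, ∫ y, S y ∂(P f) ≤ T f + x / 2 := by
  lift hullModulus ν T n α F i j to ℝ using
    ⟨(hx.trans_lt (EReal.coe_lt_top x)).ne, fun h => by simp [h] at h0⟩ with ω hω
  rw [EReal.coe_le_coe_iff] at hx
  rw [EReal.coe_nonneg] at h0
  refine ⟨h0.trans hx, fun f hf => ?_, fun f hf => ?_, fun f hf => ?_⟩
  · have := h.variance_le f hf
    rw [← hω, ← EReal.coe_pow, ← EReal.coe_mul, EReal.coe_le_coe_iff] at this
    refine this.trans ?_
    rw [div_pow, one_div, inv_mul_eq_div]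
    gcongr
  · have := h.bias_ge f hf
    rw [← hω, ← EReal.coe_mul, ← EReal.coe_neg, EReal.coe_le_coe_iff] at this
    linarith
  · have := h.bias_le f hf
    rw [← hω, ← EReal.coe_mul, EReal.coe_le_coe_iff] at this
    linarith

/-- The two balanced estimators for the pair `(j, k)` form a pilot pair over the whole union. -/
lemma IsShiftModel.isPilotPair (H : IsShiftModel n ν P φ Q) (hz : 0 < zq (α / 2))
    (h1 : (F 1).Nonempty) (hF : ∀ j, 1 ≤ j → j ≤ k → ∀ f ∈ F j, MemLp f 2 ν) (hj : 1 ≤ j)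
    (hjk : j ≤ k) {U V : (ι → ℝ) → ℝ} (hU : IsBalancedEstimator ν P T n α F j k U)
    (hV : IsBalancedEstimator ν P T n α F k j V) {x : ℝ} (hx : xi ν T n α F k j = x)
    {f : ι → ℝ} (hf : f ∈ partialUnion F k) :
    IsPilotPair (P f) (zq (α / 2)) (T f) x U V := by
  have hne := hullUnion_inter_nonempty h1 hj (hj.trans hjk)
  have hfL := memLp_of_mem_hullUnion hF le_rfl f (partialUnion_subset_hullUnion hf)
  obtain ⟨h0, hv, hb, -⟩ := hU.of_le hz (orderedModulus_nonneg hne) (hullModulus_le_xi.trans hx.le)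
  obtain ⟨-, hv', -, hb'⟩ := hV.of_le hz (orderedModulus_nonneg (Set.inter_comm _ _ ▸ hne))
    (hullModulus_swap_le_xi.trans hx.le)
  exact ⟨h0, fun a b => H.hasGaussianLaw_of_isLinearEstimator
    (hU.linear.linear_comb hV.linear a b) hfL, hb f hf, hb' f hf, hv f hfL, hv' f hfL⟩

/-- These are the reverse bias bounds, valid only on `G_j`. Coverage does not use them; they control
the length. -/
lemma IsShiftModel.bias_pilotPair (hz : 0 < zq (α / 2)) (h1 : (F 1).Nonempty) (hj : 1 ≤ j)
    (hjk : j ≤ k) {U V : (ι → ℝ) → ℝ} (hU : IsBalancedEstimator ν P T n α F j k U)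
    (hV : IsBalancedEstimator ν P T n α F k j V) {x : ℝ} (hx : xi ν T n α F k j = x)
    {f : ι → ℝ} (hf : f ∈ partialUnion F j) :
    ∫ y, U y ∂(P f) ≤ T f + x / 2 ∧ T f - x / 2 ≤ ∫ y, V y ∂(P f) := by
  have hne := hullUnion_inter_nonempty h1 hj (hj.trans hjk)
  exact ⟨(hU.of_le hz (orderedModulus_nonneg hne) (hullModulus_le_xi.trans hx.le)).2.2.2 f hf,
    (hV.of_le hz (orderedModulus_nonneg (Set.inter_comm _ _ ▸ hne))
      (hullModulus_swap_le_xi.trans hx.le)).2.2.1 f hf⟩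

end Unions

/-! ### The adaptive interval: structure and existence -/

lemma widthFactor_pos (α : ℝ) : 0 < widthFactor α := by
  rw [widthFactor]
  split_ifs <;> norm_num

section Doubling

variable {ξ : ℕ → EReal} {k m : ℕ} {J : ℕ → ℕ}

lemma IsDoublingSubsequence.lt_of_lt (h : IsDoublingSubsequence ξ k m J) {a b : ℕ} (hab : a < b)
    (hb : b ≤ m) : J a < J b := by
  induction b, hab using Nat.le_induction with
  | base => exact h.strictMono a (by omega)
  | succ b hb' ih => exact (ih (by omega)).trans (h.strictMono b (by omega))

lemma IsDoublingSubsequence.mem_Icc (h : IsDoublingSubsequence ξ k m J) {i : ℕ} (hi : 1 ≤ i)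
    (him : i ≤ m) : 1 ≤ J i ∧ J i ≤ k := by
  refine ⟨?_, ?_⟩
  · have := h.lt_of_lt (a := 0) hi him
    omega
  · rcases him.eq_or_lt with rfl | him
    · exact h.last.le
    · exact h.last ▸ (h.lt_of_lt him le_rfl).le

lemma IsDoublingSubsequence.one_le (h : IsDoublingSubsequence ξ k m J) (hk : 1 ≤ k) : 1 ≤ m := by
  by_contra hm
  have h1 := h.zero
  have h2 := h.last
  rw [show m = 0 by omega] at h2
  omega

/-- Built backwards from `k`: the predecessor is the largest earlier index `l` with `2 ξ l ≤ ξ k`,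
or `0` if there is none, and its maximality is the gap condition. -/
lemma exists_isDoublingSubsequence (ξ : ℕ → EReal) (k : ℕ) :
    ∃ m J, IsDoublingSubsequence ξ k m J := by
  induction k using Nat.strong_induction_on with
  | _ k ih =>
    rcases Nat.eq_zero_or_pos k with rfl | hk
    · exact ⟨0, fun _ => 0, rfl, rfl, by simp, fun i h1 h2 => by omega, by simp⟩
    classical
    obtain ⟨p, hp, hmax⟩ := ((Finset.range k).filter
      fun l => l = 0 ∨ 2 * ξ l ≤ ξ k).exists_max_image id ⟨0, by simp [hk]⟩
    simp only [Finset.mem_filter, Finset.mem_range, id] at hp hmax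
    obtain ⟨m, J, hJ⟩ := ih p hp.1
    refine ⟨m + 1, fun i => if i ≤ m then J i else k, by simp [hJ.zero], by simp,
      fun i hi => ?_, fun i h1 hi => ?_, fun i hi l => ?_⟩
    · rcases (Nat.lt_succ_iff.1 hi).eq_or_lt with rfl | hi
      · simp [hJ.last, hp.1]
      · simp only [hi.le, if_true, Nat.succ_le_of_lt hi]
        exact hJ.strictMono i hi
    · rcases (Nat.lt_succ_iff.1 hi).eq_or_lt with rfl | hi
      · simp only [le_refl, if_true, add_le_iff_nonpos_right, hJ.last]
        refine hp.2.resolve_left ?_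
        have := hJ.mem_Icc h1 le_rfl
        have := hJ.last
        omega
      · simp only [hi.le, if_true, Nat.succ_le_of_lt hi]
        exact hJ.doubling i h1 hi
    · rcases (Nat.lt_succ_iff.1 hi).eq_or_lt with rfl | hi
      · simp only [le_refl, if_true, add_le_iff_nonpos_right, hJ.last]
        intro h1 h2
        by_contra h3
        have := hmax l ⟨h2, Or.inr (not_lt.1 h3)⟩
        omega
      · simp only [hi.le, if_true, Nat.succ_le_of_lt hi]
        exact hJ.gap i hi l

end Doubling

/-- A measurable selection of a minimiser among finitely many measurable functions. -/
lemma exists_measurable_argmin {Y : Type*} [MeasurableSpace Y] {L : ℕ → Y → ℝ≥0∞} {m : ℕ}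
    (hm : 1 ≤ m) (hL : ∀ i, 1 ≤ i → i ≤ m → Measurable (L i)) :
    ∃ idx : Y → ℕ, Measurable idx ∧ Measurable (fun y => L (idx y) y) ∧
      ∀ y, (1 ≤ idx y ∧ idx y ≤ m) ∧ ∀ i, 1 ≤ i → i ≤ m → L (idx y) y ≤ L i y := by
  induction m, hm using Nat.le_induction with
  | base =>
    refine ⟨fun _ => 1, measurable_const, hL 1 le_rfl le_rfl, fun y => ⟨⟨le_rfl, le_rfl⟩, ?_⟩⟩
    intro i h1 h2
    rw [le_antisymm h2 h1]
  | succ m hm ih =>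
    obtain ⟨idx, h1, h2, h3⟩ := ih fun i hi him => hL i hi (by omega)
    have hlast := hL (m + 1) (by omega) le_rfl
    have hset : MeasurableSet {y | L (m + 1) y < L (idx y) y} := measurableSet_lt hlast h2
    classical
    refine ⟨fun y => if L (m + 1) y < L (idx y) y then m + 1 else idx y,
      Measurable.ite hset measurable_const h1, ?_, fun y => ?_⟩
    · have : (fun y => L (if L (m + 1) y < L (idx y) y then m + 1 else idx y) y)
          = fun y => if L (m + 1) y < L (idx y) y then L (m + 1) y else L (idx y) y := by
        funext y
        split_ifs <;> rfl
      rw [this]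
      exact Measurable.ite hset hlast h2
    · obtain ⟨⟨ha, hb⟩, hc⟩ := h3 y
      beta_reduce
      split_ifs with hlt
      · refine ⟨⟨by omega, le_rfl⟩, fun i hi him => ?_⟩
        rcases him.eq_or_lt with rfl | him
        · exact le_rfl
        · exact hlt.le.trans (hc i hi (by omega))
      · refine ⟨⟨ha, by omega⟩, fun i hi him => ?_⟩
        rcases him.eq_or_lt with rfl | him
        · exact not_lt.1 hlt
        · exact hc i hi (by omega)

lemma isInterval_select {ι : Type} {CI : ℕ → (ι → ℝ) → Set ℝ} {jhat : (ι → ℝ) → ℕ} (hj : Measurable jhat)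
    (h : ∀ y, IsInterval (CI (jhat y))) : IsInterval fun y => CI (jhat y) y := by
  refine ⟨fun y => (h y).ordConnected y, ?_⟩
  have : {p : (ι → ℝ) × ℝ | p.2 ∈ CI (jhat p.1) p.1}
      = ⋃ j ∈ Set.range jhat, {p | jhat p.1 = j} ∩ {p | p.2 ∈ CI j p.1} := by
    ext p
    simp only [Set.mem_ofPred_eq, Set.mem_iUnion, Set.mem_inter_iff, exists_prop]
    exact ⟨fun hp => ⟨_, ⟨p.1, rfl⟩, rfl, hp⟩, fun ⟨j, _, e, hp⟩ => e ▸ hp⟩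
  rw [this]
  refine MeasurableSet.biUnion (Set.to_countable _) ?_
  rintro _ ⟨y, rfl⟩
  exact (measurableSet_eq_fun (by fun_prop) measurable_const).inter (h y).measurable

/-! ### Pilot intervals: infinite and finite scales, measurability, existence -/

section Pilot

variable {ι : Type} [MeasurableSpace ι] {ν : Measure ι} {T : (ι → ℝ) →ₗ[ℝ] ℝ} {n α : ℝ}
  {F : ℕ → Set (ι → ℝ)} {k j : ℕ} {That : ℕ → ℕ → (ι → ℝ) → ℝ}

lemma pilotInterval_of_top (hx : xi ν T n α F k j = ⊤) (y : ι → ℝ) :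
    pilotInterval ν T n α F k That j y = Set.univ := by
  ext t
  simp only [pilotInterval, halfLength, hx, EReal.coe_mul_top_of_pos (widthFactor_pos α),
    EReal.coe_add_top, EReal.sub_top, bot_le, le_top, and_self, Set.mem_univ, Set.mem_ofPred_eq]

lemma pilotInterval_of_coe {x : ℝ} (hx : xi ν T n α F k j = x) (y : ι → ℝ) :
    pilotInterval ν T n α F k That j y =
      Set.Icc (midpt (That j k) (That k j) y - halfLen (widthFactor α) x (That j k) (That k j) y)
        (midpt (That j k) (That k j) y + halfLen (widthFactor α) x (That j k) (That k j) y) := by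
  ext t
  simp only [pilotInterval, halfLength, hx, ← EReal.coe_mul, ← EReal.coe_add, ← EReal.coe_sub,
    EReal.coe_le_coe_iff, Set.mem_ofPred_eq, Set.mem_Icc, midpt, halfLen]

lemma volume_pilotInterval_of_coe {x : ℝ} (hx : xi ν T n α F k j = x) (y : ι → ℝ) :
    volume (pilotInterval ν T n α F k That j y)
      = ENNReal.ofReal (2 * halfLen (widthFactor α) x (That j k) (That k j) y) := by
  rw [pilotInterval_of_coe hx, Real.volume_Icc]
  congr 1
  ring

lemma exists_xi_eq (h0 : 0 ≤ xi ν T n α F k j) :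
    xi ν T n α F k j = ⊤ ∨ ∃ x : ℝ, 0 ≤ x ∧ xi ν T n α F k j = x := by
  induction h : xi ν T n α F k j with
  | bot => simp [h] at h0
  | top => exact Or.inl rfl
  | coe x =>
    rw [h] at h0
    exact Or.inr ⟨x, EReal.coe_nonneg.1 h0, rfl⟩

lemma measurable_halfLen {Ω : Type*} [MeasurableSpace Ω] {κ x : ℝ} {U V : Ω → ℝ}
    (hU : Measurable U) (hV : Measurable V) : Measurable (halfLen κ x U V) := by
  unfold halfLen
  fun_prop

lemma measurable_midpt {Ω : Type*} [MeasurableSpace Ω] {U V : Ω → ℝ}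
    (hU : Measurable U) (hV : Measurable V) : Measurable (midpt U V) := by
  unfold midpt
  fun_prop

lemma measurable_volume_pilotInterval (h0 : 0 ≤ xi ν T n α F k j) (hU : Measurable (That j k))
    (hV : Measurable (That k j)) :
    Measurable fun y => volume (pilotInterval ν T n α F k That j y) := by
  rcases exists_xi_eq h0 with hx | ⟨x, -, hx⟩
  · simp [pilotInterval_of_top hx]
  · simp_rw [volume_pilotInterval_of_coe hx]
    have := measurable_halfLen (κ := widthFactor α) (x := x) hU hV
    fun_prop

lemma isInterval_pilotInterval (h0 : 0 ≤ xi ν T n α F k j) (hU : Measurable (That j k))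
    (hV : Measurable (That k j)) : IsInterval (pilotInterval ν T n α F k That j) := by
  rcases exists_xi_eq h0 with hx | ⟨x, -, hx⟩
  · rw [show pilotInterval ν T n α F k That j = fun _ => Set.univ from
      funext (pilotInterval_of_top hx)]
    exact ⟨fun _ => Set.ordConnected_univ, by simp⟩
  · have h1 := measurable_halfLen (κ := widthFactor α) (x := x) hU hV
    have h2 := measurable_midpt hU hV
    rw [show pilotInterval ν T n α F k That j = _ from funext (pilotInterval_of_coe hx)]
    refine ⟨fun _ => Set.ordConnected_Icc, ?_⟩
    simp only [Set.mem_Icc]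
    exact (measurableSet_le ((h2.sub h1).comp measurable_fst) measurable_snd).inter
      (measurableSet_le measurable_snd ((h2.add h1).comp measurable_fst))

lemma IsShiftModel.exists_isAdaptiveInterval {P : (ι → ℝ) → Measure (ι → ℝ)}
    {φ : ι → Lp ℝ 2 ν} {Q : Measure (ι → ℝ)} (H : IsShiftModel n ν P φ Q) (hn : 0 < n)
    (hz : 0 < zq (α / 2)) (hk : 1 ≤ k) (h1 : (F 1).Nonempty)
    (hF : ∀ j, 1 ≤ j → j ≤ k → ∀ f ∈ F j, MemLp f 2 ν) :
    ∃ CI, IsAdaptiveInterval ν P T n α F k CI := by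
  have hex : ∀ i j, ∃ S, 1 ≤ i → i ≤ k → 1 ≤ j → j ≤ k →
      IsBalancedEstimator ν P T n α F i j S := by
    intro i j
    by_cases h : 1 ≤ i ∧ i ≤ k ∧ 1 ≤ j ∧ j ≤ k
    · obtain ⟨S, hS⟩ := H.exists_isBalancedEstimator (T := T) hn hz h1 hF h.1 h.2.1 h.2.2.1 h.2.2.2
      exact ⟨S, fun _ _ _ _ => hS⟩
    · exact ⟨fun _ => 0, fun a b c d => absurd ⟨a, b, c, d⟩ h⟩
  choose That hThat using hex
  obtain ⟨m, J, hJ⟩ := exists_isDoublingSubsequence (xi ν T n α F k) k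
  have hmeas : ∀ i, 1 ≤ i → i ≤ m →
      Measurable fun y => volume (pilotInterval ν T n α F k That (J i) y) := by
    intro i hi him
    have := hJ.mem_Icc hi him
    exact measurable_volume_pilotInterval (xi_nonneg h1 this.1 hk)
      (hThat _ _ this.1 this.2 hk le_rfl).linear.1 (hThat _ _ hk le_rfl this.1 this.2).linear.1
  obtain ⟨idx, hidx, -, hmin⟩ := exists_measurable_argmin
    (L := fun i y => volume (pilotInterval ν T n α F k That (J i) y)) (hJ.one_le hk) hmeas
  exact ⟨_, That, m, J, fun y => J (idx y), hThat, hJ, (measurable_of_countable J).comp hidx,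
    fun y => ⟨⟨idx y, (hmin y).1.1, (hmin y).1.2, rfl⟩, (hmin y).2⟩, rfl⟩

end Pilot

/-! ### Coverage and length of the adaptive interval -/

lemma halfLen_nonneg {Ω : Type*} {κ x : ℝ} {U V : Ω → ℝ} (hκ : 0 ≤ κ) (hx : 0 ≤ x) (ω : Ω) :
    0 ≤ halfLen κ x U V ω :=
  add_nonneg (le_max_right _ _) (mul_nonneg hκ hx)

lemma IsInterval.measurableSet_mem {ι : Type} {CI : (ι → ℝ) → Set ℝ} (h : IsInterval CI) (t : ℝ) :
    MeasurableSet {y | t ∈ CI y} := by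
  have hm : Measurable fun y : ι → ℝ => (y, t) := by fun_prop
  exact hm h.measurable

section Length

variable {Ω : Type*} {mΩ : MeasurableSpace Ω} {μ : Measure Ω} [IsProbabilityMeasure μ]

/-- The variance of `|X - EX|` is nonnegative, so the squared first absolute moment is at most the
variance. -/
lemma integral_abs_sub_le {X : Ω → ℝ} (hX : MemLp X 2 μ) {σ : ℝ} (hσ : 0 ≤ σ)
    (hv : Var[X; μ] ≤ σ ^ 2) : ∫ ω, |X ω - ∫ ω, X ω ∂μ| ∂μ ≤ σ := by
  have h1 : MemLp (fun ω => |X ω - ∫ ω, X ω ∂μ|) 2 μ := (hX.sub (memLp_const _)).abs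
  have h2 := variance_nonneg (fun ω => |X ω - ∫ ω, X ω ∂μ|) μ
  rw [variance_eq_sub h1] at h2
  have h3 : ∫ ω, ((fun ω => |X ω - ∫ ω, X ω ∂μ|) ^ 2) ω ∂μ = Var[X; μ] := by
    rw [variance_eq_integral hX.aestronglyMeasurable.aemeasurable]
    simp
  rw [h3] at h2
  exact (sq_le_sq₀ (integral_nonneg fun ω => abs_nonneg _) hσ).1 (by linarith)

/-- Two-sided biases give `EU - EV ≤ x`, and each mean absolute deviation is at most `x/z`. -/
lemma IsPilotPair.lintegral_halfLen_le {z τ x κ : ℝ} {U V : Ω → ℝ}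
    (h : IsPilotPair μ z τ x U V) (hz : 0 < z) (hκ : 0 ≤ κ) (hU : ∫ ω, U ω ∂μ ≤ τ + x / 2)
    (hV : τ - x / 2 ≤ ∫ ω, V ω ∂μ) :
    ∫⁻ ω, ENNReal.ofReal (2 * halfLen κ x U V ω) ∂μ
      ≤ ENNReal.ofReal (2 * (1 + 2 / z + κ) * x) := by
  have hx := h.nonneg
  have hUL := h.gaussian_fst.memLp_two
  have hVL := h.gaussian_snd.memLp_two
  have hUi : Integrable (fun ω => |U ω - ∫ ω, U ω ∂μ|) μ :=
    ((hUL.sub (memLp_const _)).abs).integrable one_le_two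
  have hVi : Integrable (fun ω => |V ω - ∫ ω, V ω ∂μ|) μ :=
    ((hVL.sub (memLp_const _)).abs).integrable one_le_two
  have e1 := integral_abs_sub_le hUL (div_nonneg hx hz.le) h.var_fst
  have e2 := integral_abs_sub_le hVL (div_nonneg hx hz.le) h.var_snd
  have hle : ∀ ω, 2 * halfLen κ x U V ω
      ≤ 2 * (|U ω - ∫ ω, U ω ∂μ| + |V ω - ∫ ω, V ω ∂μ| + (1 + κ) * x) := by
    intro ω
    have h1 := le_abs_self (U ω - ∫ ω, U ω ∂μ)
    have h2 := neg_abs_le (V ω - ∫ ω, V ω ∂μ)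
    have h3 : max (U ω - V ω) 0 ≤ |U ω - ∫ ω, U ω ∂μ| + |V ω - ∫ ω, V ω ∂μ| + x :=
      max_le (by linarith) (by positivity)
    simp only [halfLen]
    linarith
  refine (lintegral_mono fun ω => ENNReal.ofReal_le_ofReal (hle ω)).trans ?_
  have hint : Integrable
      (fun ω => 2 * (|U ω - ∫ ω, U ω ∂μ| + |V ω - ∫ ω, V ω ∂μ| + (1 + κ) * x)) μ :=
    ((hUi.add hVi).add (integrable_const _)).const_mul _
  rw [← ofReal_integral_eq_lintegral_ofReal hint (ae_of_all _ fun ω => by positivity)]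
  refine ENNReal.ofReal_le_ofReal ?_
  have hUVi : Integrable
      (fun ω => |U ω - ∫ ω, U ω ∂μ| + |V ω - ∫ ω, V ω ∂μ|) μ := hUi.add hVi
  rw [integral_const_mul, integral_add hUVi (integrable_const _), integral_add hUi hVi]
  rw [integral_const, probReal_univ, one_smul]
  have : 2 * (1 + 2 / z + κ) * x = 2 * (x / z + x / z + (1 + κ) * x) := by ring
  rw [this]
  linarith

end Length

section Adaptive

variable {ι : Type} [MeasurableSpace ι] {ν : Measure ι} {T : (ι → ℝ) →ₗ[ℝ] ℝ} {n α : ℝ}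
  {F : ℕ → Set (ι → ℝ)} {k j : ℕ} {P : (ι → ℝ) → Measure (ι → ℝ)} {φ : ι → Lp ℝ 2 ν}
  {Q : Measure (ι → ℝ)} {CI : (ι → ℝ) → Set ℝ}

lemma zq_half_pos (hα₀ : 0 < α) (hα : α < 1 / 2) : 0 < zq (α / 2) := by
  have := zq_gt_of_lt_quarter (β := α / 2) (by linarith) (by linarith)
  norm_num at this
  linarith

lemma widthFactor_zq (hα₀ : 0 < α) (hα : α < 1 / 2) :
    (widthFactor α = 2 ∧ 1.2 ≤ zq (α / 2)) ∨ (widthFactor α = 3 ∧ 0.65 ≤ zq (α / 2)) := by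
  rw [widthFactor]
  split_ifs with h
  · exact Or.inl ⟨rfl, (zq_gt_of_le_tenth (by linarith) (by linarith)).le⟩
  · exact Or.inr ⟨rfl, (zq_gt_of_lt_quarter (by linarith) (by linarith)).le⟩

/-- Along the subsequence, the indices with `ξ' < ∞` form an initial segment. -/
lemma IsDoublingSubsequence.exists_finite_initial {m : ℕ} {J : ℕ → ℕ}
    (hJ : IsDoublingSubsequence (xi ν T n α F k) k m J) (h1 : (F 1).Nonempty) (hk : 1 ≤ k) :
    ∃ q ≤ m, (∀ i, 1 ≤ i → i ≤ q →
        xi ν T n α F k (J i) = ((xi ν T n α F k (J i)).toReal : ℝ)) ∧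
      ∀ i ≤ m, xi ν T n α F k (J i) ≠ ⊤ → i ≤ q := by
  classical
  set q := Nat.findGreatest (fun i => i = 0 ∨ xi ν T n α F k (J i) ≠ ⊤) m
  have hqm : q ≤ m := Nat.findGreatest_le m
  have hqspec : q = 0 ∨ xi ν T n α F k (J q) ≠ ⊤ :=
    Nat.findGreatest_spec (P := fun i => i = 0 ∨ xi ν T n α F k (J i) ≠ ⊤) (Nat.zero_le m)
      (Or.inl rfl)
  refine ⟨q, hqm, fun i hi hiq => ?_, fun i him hi => Nat.le_findGreatest him (Or.inr hi)⟩
  have hle : xi ν T n α F k (J i) ≤ xi ν T n α F k (J q) := by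
    rcases hiq.eq_or_lt with e | hlt
    · rw [e]
    · exact xi_mono (hJ.lt_of_lt hlt hqm).le
  refine (EReal.coe_toReal ?_ ?_).symm
  · exact (hle.trans_lt (lt_top_iff_ne_top.2 (hqspec.resolve_left (by omega)))).ne
  · exact (EReal.bot_lt_zero.trans_le (xi_nonneg h1 (hJ.mem_Icc hi (hiq.trans hqm)).1 hk)).ne'

/-- An index with infinite `ξ'` yields the whole line and cannot miss, so only the finite initial
segment of the subsequence matters. There `measure_shortest_misses_le` applies to any shortest
interval, however ties are broken, with bound `2 normalTail (zq (α / 2)) = α`. -/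
theorem IsAdaptiveInterval.mem_confidenceIntervals (H : IsShiftModel n ν P φ Q)
    (hα₀ : 0 < α) (hα : α < 1 / 2) (hk : 1 ≤ k) (h1 : (F 1).Nonempty)
    (hF : ∀ j, 1 ≤ j → j ≤ k → ∀ f ∈ F j, MemLp f 2 ν)
    (hCI : IsAdaptiveInterval ν P T n α F k CI) :
    CI ∈ confidenceIntervals P T α (partialUnion F k) := by
  have hz := zq_half_pos hα₀ hα
  obtain ⟨That, m, J, jhat, hB, hJ, hjm, hmin, rfl⟩ := hCI
  have hU : ∀ i, 1 ≤ i → i ≤ m → IsBalancedEstimator ν P T n α F (J i) k (That (J i) k) :=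
    fun i hi him => hB _ _ (hJ.mem_Icc hi him).1 (hJ.mem_Icc hi him).2 hk le_rfl
  have hV : ∀ i, 1 ≤ i → i ≤ m → IsBalancedEstimator ν P T n α F k (J i) (That k (J i)) :=
    fun i hi him => hB _ _ hk le_rfl (hJ.mem_Icc hi him).1 (hJ.mem_Icc hi him).2
  have hx0 : ∀ i, 1 ≤ i → i ≤ m → 0 ≤ xi ν T n α F k (J i) :=
    fun i hi him => xi_nonneg h1 (hJ.mem_Icc hi him).1 hk
  have hInt : IsInterval fun y => pilotInterval ν T n α F k That (jhat y) y := by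
    refine isInterval_select hjm fun y => ?_
    obtain ⟨i, hi, him, e⟩ := (hmin y).1
    rw [e]
    exact isInterval_pilotInterval (hx0 i hi him) (hU i hi him).linear.1 (hV i hi him).linear.1
  refine ⟨hInt, fun f hf => ?_⟩
  have hfL := memLp_of_mem_hullUnion hF le_rfl f (partialUnion_subset_hullUnion hf)
  have := H.prob hfL
  obtain ⟨q, hqm, hfin, hqmax⟩ := hJ.exists_finite_initial (T := T) (n := n) (α := α) h1 hk
  have hmiss := measure_shortest_misses_le (μ := P f) (τ := T f) (widthFactor_zq hα₀ hα) (m := q)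
    (x := fun i => (xi ν T n α F k (J i)).toReal) (U := fun i => That (J i) k)
    (V := fun i => That k (J i))
    (fun i hi hiq => H.isPilotPair hz h1 hF (hJ.mem_Icc hi (hiq.trans hqm)).1
      (hJ.mem_Icc hi (hiq.trans hqm)).2 (hU i hi (hiq.trans hqm)) (hV i hi (hiq.trans hqm))
      (hfin i hi hiq) hf)
    (fun i hi hiq => by
      have := hJ.doubling i hi (by omega)
      rw [hfin i hi hiq.le, hfin (i + 1) (by omega) (by omega)] at this
      exact EReal.coe_le_coe_iff.1 this)
  rw [normalTail_zq (by linarith) (by linarith)] at hmiss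
  have hgood : MeasurableSet {y | T f ∈ pilotInterval ν T n α F k That (jhat y) y} :=
    hInt.measurableSet_mem (T f)
  have hbad : P f {y | T f ∈ pilotInterval ν T n α F k That (jhat y) y}ᶜ
      ≤ ENNReal.ofReal α := by
    rw [← ofReal_measureReal]
    refine ENNReal.ofReal_le_ofReal (le_trans
      (measureReal_mono (fun y hy => ?_) (measure_ne_top _ _))
      (hmiss.trans_eq (mul_div_cancel₀ α two_ne_zero)))
    obtain ⟨i, hi, him, e⟩ := (hmin y).1
    have hy' : T f ∉ pilotInterval ν T n α F k That (J i) y := by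
      rw [← e]
      exact hy
    have hiq : i ≤ q := by
      refine hqmax i him fun htop => hy' ?_
      rw [pilotInterval_of_top htop]
      trivial
    refine ⟨i, hi, hiq, fun b hb hbq => ?_, ?_⟩
    · have := (hmin y).2 b hb (hbq.trans hqm)
      rw [e, volume_pilotInterval_of_coe (hfin i hi hiq),
        volume_pilotInterval_of_coe (hfin b hb hbq), ENNReal.ofReal_le_ofReal_iff] at this
      · linarith
      · have hxb : 0 ≤ (xi ν T n α F k (J b)).toReal :=
          EReal.toReal_nonneg (hx0 b hb (hbq.trans hqm))
        have := halfLen_nonneg (U := That (J b) k) (V := That k (J b)) (widthFactor_pos α).le hxb y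
        linarith
    · rw [pilotInterval_of_coe (hfin i hi hiq), Set.mem_Icc, not_and_or, not_le, not_le] at hy'
      exact hy'.symm
  rw [← compl_compl {y | T f ∈ pilotInterval ν T n α F k That (jhat y) y},
    prob_compl_eq_one_sub hgood.compl, ENNReal.ofReal_sub _ hα₀.le, ENNReal.ofReal_one]
  exact tsub_le_tsub_left hbad 1

/-- Compare with the first subsequence index at or beyond `j`: its union contains `F j`, so its
expected length is of the order of its scale, and the gap condition keeps that scale within a factor
`2` of `ξ'_j`. -/
theorem IsAdaptiveInterval.maxExpectedLength_le (H : IsShiftModel n ν P φ Q)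
    (hα₀ : 0 < α) (hα : α < 1 / 2) (h1 : (F 1).Nonempty)
    (hF : ∀ j, 1 ≤ j → j ≤ k → ∀ f ∈ F j, MemLp f 2 ν)
    (hCI : IsAdaptiveInterval ν P T n α F k CI) (hj : 1 ≤ j) (hjk : j ≤ k) :
    maxExpectedLength P CI (F j)
      ≤ ENNReal.ofReal (4 * (1 + 2 / zq (α / 2) + widthFactor α))
        * (xi ν T n α F k j).toENNReal := by
  have hz := zq_half_pos hα₀ hα
  have hκ := widthFactor_pos α
  have hk := hj.trans hjk
  set K := 1 + 2 / zq (α / 2) + widthFactor α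
  have hK : 0 < K := by positivity
  obtain ⟨That, m, J, jhat, hB, hJ, hjm, hmin, rfl⟩ := hCI
  rcases exists_xi_eq (xi_nonneg (ν := ν) (T := T) (n := n) (α := α) h1 hj hk) with
    hx | ⟨x, hx0, hx⟩
  · rw [hx, EReal.toENNReal_top, ENNReal.mul_top (by simp [hK])]
    exact le_top
  refine iSup₂_le fun f hf => ?_
  have hex : ∃ i, j ≤ J i := ⟨m, hJ.last ▸ hjk⟩
  classical
  obtain ⟨i, hi⟩ : ∃ i, Nat.find hex = i + 1 := by
    refine Nat.exists_eq_succ_of_ne_zero fun h0 => ?_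
    have := Nat.find_spec hex
    rw [h0, hJ.zero] at this
    omega
  have hji : j ≤ J (i + 1) := hi ▸ Nat.find_spec hex
  have hij : J i < j := not_le.1 (Nat.find_min hex (by omega))
  have him : i + 1 ≤ m := hi ▸ Nat.find_min' hex (hJ.last ▸ hjk)
  have hJi := hJ.mem_Icc (Nat.le_add_left 1 i) him
  obtain ⟨x', hx'0, hx', hxx⟩ : ∃ x' : ℝ, 0 ≤ x' ∧ xi ν T n α F k (J (i + 1)) = x' ∧
      x' ≤ 2 * x := by
    rcases hji.eq_or_lt with e | hlt
    · exact ⟨x, hx0, e ▸ hx, by linarith⟩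
    · have hgap := hJ.gap i him j hij hlt
      rw [hx] at hgap
      rcases exists_xi_eq (xi_nonneg (ν := ν) (T := T) (n := n) (α := α) h1 hJi.1 hk) with
        h | ⟨x', h0, h⟩
      · rw [h] at hgap
        exact absurd hgap not_top_lt
      · rw [h] at hgap
        exact ⟨x', h0, h, EReal.coe_le_coe_iff.1 hgap.le⟩
  have hBU := hB _ _ hJi.1 hJi.2 hk le_rfl
  have hBV := hB _ _ hk le_rfl hJi.1 hJi.2
  have := H.prob (hF j hj hjk f hf)
  have hbias := IsShiftModel.bias_pilotPair hz h1 hJi.1 hJi.2 hBU hBV hx'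
    (subset_partialUnion hj hji hf)
  calc ∫⁻ y, volume (pilotInterval ν T n α F k That (jhat y) y) ∂(P f)
      ≤ ∫⁻ y, ENNReal.ofReal (2 * halfLen (widthFactor α) x' (That (J (i + 1)) k)
          (That k (J (i + 1))) y) ∂(P f) := by
        refine lintegral_mono fun y => ?_
        rw [← volume_pilotInterval_of_coe hx']
        exact (hmin y).2 (i + 1) (by omega) him
    _ ≤ ENNReal.ofReal (2 * K * x') :=
        (H.isPilotPair hz h1 hF hJi.1 hJi.2 hBU hBV hx'
          (subset_partialUnion hj hjk hf)).lintegral_halfLen_le hz hκ.le hbias.1 hbias.2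
    _ ≤ ENNReal.ofReal (4 * K * x) := ENNReal.ofReal_le_ofReal (by nlinarith)
    _ = _ := by
        rw [hx, ENNReal.ofReal_mul (by positivity), EReal.toENNReal_of_ne_top (EReal.coe_ne_top x),
          EReal.toReal_coe]

end Adaptive

/-! ### Lower bounds for the expected length -/

section Lower

variable {ι : Type} [MeasurableSpace ι] {ν : Measure ι} {T : (ι → ℝ) →ₗ[ℝ] ℝ} {n α : ℝ}
  {P : (ι → ℝ) → Measure (ι → ℝ)} {φ : ι → Lp ℝ 2 ν} {Q : Measure (ι → ℝ)}
  {CI : (ι → ℝ) → Set ℝ}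

/-- The expected length over `A` is bounded below by the oscillation of `T` between `A` and `B`
at distance `z / √n`, provided that there are pairs at distance `δ / (2 √n)` on which the
oscillation is almost nonnegative. -/
lemma IsShiftModel.le_maxExpectedLength (H : IsShiftModel n ν P φ Q) (hn : 0 < n)
    (hα₀ : 0 < α) (hα : α < 1 / 2) {A B S : Set (ι → ℝ)} (hA : Convex ℝ A) (hB : Convex ℝ B)
    (hAL : ∀ f ∈ A, MemLp f 2 ν) (hBL : ∀ f ∈ B, MemLp f 2 ν) (hAS : A ⊆ S) (hBS : B ⊆ S)
    (hCI : CI ∈ confidenceIntervals P T α S) {s : ℝ} (hs : |s| = 1) {δ z : ℝ} (hδ : 0 < δ)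
    (hδz : δ ≤ z) (hδα : δ ≤ (1 - 2 * α) / 4)
    (hclose : ∀ η, 0 < η → ∃ f ∈ A, ∃ g ∈ B,
      eLpNorm (g - f) 2 ν ≤ ENNReal.ofReal (δ / 2 / √n) ∧ -η < s * (T g - T f))
    {f g : ι → ℝ} (hf : f ∈ A) (hg : g ∈ B)
    (hfg : eLpNorm (g - f) 2 ν ≤ ENNReal.ofReal (z / √n)) :
    ENNReal.ofReal ((1 - 2 * α) / 2 * (δ / (2 * z)) * (s * (T g - T f)))
      ≤ maxExpectedLength P CI A := by
  have hz : 0 < z := hδ.trans_le hδz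
  have hsn : 0 < √n := Real.sqrt_pos.2 hn
  -- With this mixing weight the given pair contributes at most `δ / (2√n)` to the distance; the
  -- auxiliary close pair contributes at most as much.
  set l := δ / (2 * z) with hl
  have hl0 : 0 < l := by positivity
  have hl1 : l ≤ 1 := by
    rw [hl, div_le_one (by positivity)]
    linarith
  have hlz : l * z = δ / 2 := by
    rw [hl]
    field_simp
  rcases eq_or_ne (maxExpectedLength P CI A) ⊤ with htop | htop
  · rw [htop]
    exact le_top
  rw [ENNReal.ofReal_le_iff_le_toReal htop]
  have key : ∀ η, 0 < η → (1 - 2 * α) / 2 * (l * (s * (T g - T f)) - η)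
      ≤ (maxExpectedLength P CI A).toReal := by
    intro η hη
    obtain ⟨f₀, hf₀, g₀, hg₀, hd, hη'⟩ := hclose η hη
    have hfm : (1 - l) • f₀ + l • f ∈ A := hA hf₀ hf (by linarith) hl0.le (by ring)
    have hgm : (1 - l) • g₀ + l • g ∈ B := hB hg₀ hg (by linarith) hl0.le (by ring)
    have hfL := hAL _ hfm
    have hgL := hBL _ hgm
    have hd1 : eLpNorm ((1 - l) • g₀ + l • g - ((1 - l) • f₀ + l • f)) 2 ν
        ≤ ENNReal.ofReal (δ / √n) := by
      have e : (1 - l) • g₀ + l • g - ((1 - l) • f₀ + l • f)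
          = (1 - l) • (g₀ - f₀) + l • (g - f) := by
        rw [smul_sub, smul_sub]
        abel
      have m1 := (((hBL _ hg₀).sub (hAL _ hf₀)).const_smul (1 - l)).aestronglyMeasurable
      have m2 := (((hBL _ hg).sub (hAL _ hf)).const_smul l).aestronglyMeasurable
      rw [e]
      refine (eLpNorm_add_le m1 m2 (by norm_num)).trans ?_
      rw [eLpNorm_const_smul, eLpNorm_const_smul, Real.enorm_of_nonneg (by linarith),
        Real.enorm_of_nonneg hl0.le]
      refine (add_le_add (mul_le_mul_right hd _) (mul_le_mul_right hfg _)).trans ?_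
      rw [← ENNReal.ofReal_mul (by linarith), ← ENNReal.ofReal_mul hl0.le,
        ← ENNReal.ofReal_add (mul_nonneg (by linarith) (by positivity)) (by positivity)]
      refine ENNReal.ofReal_le_ofReal ?_
      rw [show (1 - l) * (δ / 2 / √n) + l * (z / √n) = ((1 - l) * (δ / 2) + l * z) / √n by ring, hlz]
      gcongr
      nlinarith
    rw [eLpNorm_sub_le_iff hfL hgL (by positivity), le_div_iff₀ hsn, mul_comm] at hd1
    have hlen := (H.le_expectedLength hn hfL hgL (by linarith) hd1 hCI.1 (hCI.2 _ (hAS hfm))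
      (hCI.2 _ (hBS hgm))).trans (le_iSup₂ (f := fun f (_ : f ∈ A) => ∫⁻ y, volume (CI y) ∂(P f))
        _ hfm)
    have hlen' := (ENNReal.ofReal_le_iff_le_toReal htop).1 hlen
    refine le_trans ?_ hlen'
    have hgap : l * (s * (T g - T f)) - η
        ≤ |T ((1 - l) • g₀ + l • g) - T ((1 - l) • f₀ + l • f)| := by
      rw [← one_mul |T _ - T _|, ← hs, ← abs_mul]
      refine le_trans ?_ (le_abs_self _)
      simp only [map_add, map_smul, smul_eq_mul]
      nlinarith
    -- Half of the margin `1 - 2α` survives, because `δ ≤ (1 - 2α)/4`.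
    have hδ2 : (1 - 2 * α) / 2 ≤ 1 - 2 * α - (δ + δ ^ 2 / 2) := by nlinarith
    calc _ ≤ (1 - 2 * α) / 2 * |T ((1 - l) • g₀ + l • g) - T ((1 - l) • f₀ + l • f)| :=
          mul_le_mul_of_nonneg_left hgap (by linarith)
      _ ≤ _ := mul_le_mul_of_nonneg_right hδ2 (abs_nonneg _)
  refine le_of_forall_pos_le_add fun η hη => ?_
  have h1 := key η hη
  have h2 : (1 - 2 * α) / 2 * η ≤ η := by nlinarith
  linarith

/-- The factor `C₂` is positive, so the modulus itself lies above `-η`; in particular the supremum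
is not over an empty set. -/
lemma exists_neg_lt_of_nonneg {ε : ℝ} {A B : Set (ι → ℝ)} {C₂ : ℝ} (hC₂ : 0 < C₂)
    (h : 0 ≤ (C₂ : EReal) * orderedModulus ν T ε A B) {η : ℝ} (hη : 0 < η) :
    ∃ f ∈ A, ∃ g ∈ B, eLpNorm (g - f) 2 ν ≤ ENNReal.ofReal ε ∧ -η < T g - T f := by
  have h0 : ((-η : ℝ) : EReal) < orderedModulus ν T ε A B := by
    by_contra hlt
    have h1 := h.trans (mul_le_mul_of_nonneg_left (not_lt.1 hlt)
      (EReal.coe_nonneg.2 hC₂.le))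
    rw [← EReal.coe_mul, EReal.coe_nonneg] at h1
    nlinarith
  obtain ⟨_, ⟨f, hf, g, hg, hd, rfl⟩, hx⟩ := lt_sSup_iff.1 h0
  exact ⟨f, hf, g, hg, hd, EReal.coe_lt_coe_iff.1 hx⟩

variable {F : ℕ → Set (ι → ℝ)} {k j : ℕ} {C₁ C₂ ε₀ ε : ℝ}

/-- The hulls share the points of `F 1`, so their moduli are nonnegative at every `ε`; Condition C
carries this to `F j` and `F k`, which need not meet. -/
lemma ConditionC.nonneg (hC : ConditionC ν T F k C₁ C₂ ε₀) (h1 : (F 1).Nonempty) (hj : 1 ≤ j)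
    (hjk : j ≤ k) (hε : 0 < ε) (hε₀ : ε < ε₀) :
    0 ≤ (C₂ : EReal) * orderedModulus ν T ε (F j) (F k) ∧
      0 ≤ (C₂ : EReal) * orderedModulus ν T ε (F k) (F j) := by
  obtain ⟨⟨a, b⟩, c, d⟩ := hC j hj hjk ε hε hε₀
  have hk := hj.trans hjk
  exact ⟨(orderedModulus_nonneg (hullUnion_inter_nonempty h1 hj hk)).trans (a.trans b),
    (orderedModulus_nonneg (hullUnion_inter_nonempty h1 hk hj)).trans (c.trans d)⟩

lemma ConditionC.betweenModulus_hullUnion_le (hC : ConditionC ν T F k C₁ C₂ ε₀) (hC₂ : 0 < C₂)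
    (hj : 1 ≤ j) (hjk : j ≤ k) (hε : 0 < ε) (hε₀ : ε < ε₀) :
    betweenModulus ν T ε (hullUnion F j) (hullUnion F k)
      ≤ (C₂ : EReal) * betweenModulus ν T ε (F j) (F k) := by
  obtain ⟨⟨a, b⟩, c, d⟩ := hC j hj hjk ε hε hε₀
  have h0 : (0 : EReal) ≤ C₂ := EReal.coe_nonneg.2 hC₂.le
  refine betweenModulus_le_max.trans (max_le ((a.trans b).trans ?_) ((c.trans d).trans ?_))
  · exact mul_le_mul_of_nonneg_left orderedModulus_le_betweenModulus h0
  · exact mul_le_mul_of_nonneg_left orderedModulus_swap_le_betweenModulus h0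

/-- Each sign of `T g - T f` uses its own half of Condition C, at radius `δ / (2√n)`, to supply the
almost nonnegative close pairs. -/
lemma IsShiftModel.betweenModulus_le_maxExpectedLength (H : IsShiftModel n ν P φ Q) (hn : 0 < n)
    (hα₀ : 0 < α) (hα : α < 1 / 2) (hC : ConditionC ν T F k C₁ C₂ ε₀) (hC₂ : 0 < C₂)
    (hF : ∀ j, 1 ≤ j → j ≤ k → (F j).Nonempty ∧ Convex ℝ (F j) ∧ ∀ f ∈ F j, MemLp f 2 ν)
    (hj : 1 ≤ j) (hjk : j ≤ k) (hCI : CI ∈ confidenceIntervals P T α (partialUnion F k))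
    {δ z : ℝ} (hδ : 0 < δ) (hδz : δ ≤ z) (hδα : δ ≤ (1 - 2 * α) / 4) (hz : z / √n < ε₀) :
    ENNReal.ofReal ((1 - 2 * α) / 2 * (δ / (2 * z)))
        * (betweenModulus ν T (z / √n) (F j) (F k)).toENNReal
      ≤ maxExpectedLength P CI (F j) := by
  have hk := hj.trans hjk
  have hz0 : 0 < z := hδ.trans_le hδz
  have hsn : 0 < √n := Real.sqrt_pos.2 hn
  set c := (1 - 2 * α) / 2 * (δ / (2 * z))
  have hc : 0 < c := mul_pos (by linarith) (by positivity)
  have hε : δ / 2 / √n < ε₀ := lt_of_le_of_lt (by gcongr; linarith) hz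
  obtain ⟨hn1, hn2⟩ := hC.nonneg (hF 1 le_rfl hk).1 hj hjk (by positivity) hε
  obtain ⟨-, hA, hAL⟩ := hF j hj hjk
  obtain ⟨-, hB, hBL⟩ := hF k hk le_rfl
  have hAS : F j ⊆ partialUnion F k := subset_partialUnion hj hjk
  have hBS : F k ⊆ partialUnion F k := subset_partialUnion hk le_rfl
  have hpair : ∀ f ∈ F j, ∀ g ∈ F k, eLpNorm (g - f) 2 ν ≤ ENNReal.ofReal (z / √n) →
      ENNReal.ofReal (c * |T g - T f|) ≤ maxExpectedLength P CI (F j) := by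
    intro f hf g hg hfg
    rcases abs_cases (T g - T f) with ⟨e, -⟩ | ⟨e, -⟩
    · rw [e]
      have := H.le_maxExpectedLength hn hα₀ hα hA hB hAL hBL hAS hBS hCI (s := 1) abs_one hδ hδz
        hδα (fun η hη => by simpa only [one_mul] using exists_neg_lt_of_nonneg hC₂ hn1 hη) hf hg hfg
      simpa only [one_mul] using this
    · rw [e]
      have := H.le_maxExpectedLength hn hα₀ hα hA hB hAL hBL hAS hBS hCI (s := -1) (by simp) hδ hδz
        hδα (fun η hη => by
          obtain ⟨g, hg, f, hf, hd, hlt⟩ := exists_neg_lt_of_nonneg hC₂ hn2 hη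
          exact ⟨f, hf, g, hg, eLpNorm_sub_comm f g 2 ν ▸ hd, by linarith⟩) hf hg hfg
      simpa only [neg_mul, one_mul] using this
  have hbound : betweenModulus ν T (z / √n) (F j) (F k)
      ≤ ((maxExpectedLength P CI (F j) / ENNReal.ofReal c : ℝ≥0∞) : EReal) := by
    refine sSup_le ?_
    rintro _ ⟨f, hf, g, hg, hfg, rfl⟩
    rw [← max_eq_left (abs_nonneg (T g - T f)), ← EReal.coe_ennreal_ofReal,
      EReal.coe_ennreal_le_coe_ennreal_iff, ENNReal.le_div_iff_mul_le (by simp [hc]) (by simp),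
      ← ENNReal.ofReal_mul (abs_nonneg _), mul_comm]
    exact hpair f hf g hg hfg
  have := EReal.toENNReal_le_toENNReal hbound
  rwa [EReal.toENNReal_coe, ENNReal.le_div_iff_mul_le (by simp [hc]) (by simp), mul_comm] at this

end Lower

end NearlyNested


/-! ### Assembly: both bounds in terms of the modulus between `F_j` and `F_k` -/

theorem proposition3 (α : ℝ) (hα₀ : 0 < α) (hα : α < 1 / 2) (C₂ : ℝ) (hC₂ : 0 < C₂) :
    ∃ c C : ℝ, 0 < c ∧ 0 < C ∧
      ∀ (n : ℝ), 0 < n →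
      ∀ (ι : Type) [MeasurableSpace ι] (ν : Measure ι) (P : (ι → ℝ) → Measure (ι → ℝ)),
        NearlyNested.IsGaussianModel n ι ν P →
      ∀ (T : (ι → ℝ) →ₗ[ℝ] ℝ) (k : ℕ) (F : ℕ → Set (ι → ℝ)), 1 ≤ k →
        (∀ j, 1 ≤ j → j ≤ k → (F j).Nonempty ∧ Convex ℝ (F j) ∧ ∀ f ∈ F j, MemLp f 2 ν) →
      ∀ (C₁ ε₀ : ℝ), 0 < C₁ → C₁ ≤ C₂ →
        NearlyNested.ConditionC ν T F k C₁ C₂ ε₀ →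
        NearlyNested.zq (α / 2) / Real.sqrt n < ε₀ →
        (∃ CI, NearlyNested.IsAdaptiveInterval ν P T n α F k CI) ∧
        ∀ CI, NearlyNested.IsAdaptiveInterval ν P T n α F k CI →
          CI ∈ NearlyNested.confidenceIntervals P T α (NearlyNested.partialUnion F k) ∧
          ∀ j, 1 ≤ j → j ≤ k →
            (NearlyNested.optimalLength P T α (F j) (NearlyNested.partialUnion F k)
                ≤ NearlyNested.maxExpectedLength P CI (F j) ∧
              NearlyNested.maxExpectedLength P CI (F j)
                ≤ ENNReal.ofReal C *
                  NearlyNested.optimalLength P T α (F j) (NearlyNested.partialUnion F k)) ∧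
            (ENNReal.ofReal c *
                  (NearlyNested.betweenModulus ν T (NearlyNested.zq (α / 2) / Real.sqrt n)
                    (F j) (NearlyNested.partialUnion F k)).toENNReal
                ≤ NearlyNested.maxExpectedLength P CI (F j) ∧
              NearlyNested.maxExpectedLength P CI (F j)
                ≤ ENNReal.ofReal C *
                  (NearlyNested.betweenModulus ν T (NearlyNested.zq (α / 2) / Real.sqrt n)
                    (F j) (NearlyNested.partialUnion F k)).toENNReal) := by
  have hz := NearlyNested.zq_half_pos hα₀ hα
  have hκ := NearlyNested.widthFactor_pos α
  set z := NearlyNested.zq (α / 2)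
  set δ := min ((1 - 2 * α) / 4) z
  have hδ : 0 < δ := lt_min (by linarith) hz
  set c₀ := (1 - 2 * α) / 2 * (δ / (2 * z))
  have hc₀ : 0 < c₀ := mul_pos (by linarith) (by positivity)
  set K := 4 * (1 + 2 / z + NearlyNested.widthFactor α)
  have hK : 0 < K := by positivity
  -- With `M` the modulus between `F_j` and `F_k`, optimal lengths are at least `c₀ M` and the
  -- adaptive length is at most `K C₂ M`. The modulus between `F_j` and the full union lies between
  -- `M` and `C₂ M`, whence the division by `C₂`.
  refine ⟨c₀ / C₂, max (K * C₂) (K * C₂ / c₀), by positivity, by positivity, ?_⟩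
  intro n hn ι _ ν P hP T k F hk hF C₁ ε₀ hC₁ hC₁₂ hC hε₀
  obtain ⟨φ, Q, H⟩ := hP.exists_isShiftModel hn
  have h1 := (hF 1 le_rfl hk).1
  have hL := fun j hj hjk => (hF j hj hjk).2.2
  refine ⟨H.exists_isAdaptiveInterval hn hz hk h1 hL, fun CI hCI => ?_⟩
  have hmem := hCI.mem_confidenceIntervals H hα₀ hα hk h1 hL
  refine ⟨hmem, fun j hj hjk => ?_⟩
  set M := (NearlyNested.betweenModulus ν T (z / √n) (F j) (F k)).toENNReal
  have hlow : ENNReal.ofReal c₀ * M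
      ≤ NearlyNested.optimalLength P T α (F j) (NearlyNested.partialUnion F k) :=
    le_iInf₂ fun CI' hCI' => H.betweenModulus_le_maxExpectedLength hn hα₀ hα hC hC₂ hF hj hjk
      hCI' hδ (min_le_right _ _) (min_le_left _ _) hε₀
  have hopt : NearlyNested.optimalLength P T α (F j) (NearlyNested.partialUnion F k)
      ≤ NearlyNested.maxExpectedLength P CI (F j) := iInf₂_le CI hmem
  have hxi : (NearlyNested.xi ν T n α F k j).toENNReal ≤ ENNReal.ofReal C₂ * M := by
    have := EReal.toENNReal_le_toENNReal
      (hC.betweenModulus_hullUnion_le hC₂ hj hjk (by positivity) hε₀)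
    rwa [EReal.toENNReal_mul (EReal.coe_nonneg.2 hC₂.le), EReal.real_coe_toENNReal] at this
  have hup : NearlyNested.maxExpectedLength P CI (F j) ≤ ENNReal.ofReal (K * C₂) * M := by
    refine (hCI.maxExpectedLength_le H hα₀ hα h1 hL hj hjk).trans ?_
    rw [ENNReal.ofReal_mul hK.le, mul_assoc]
    exact mul_le_mul_right hxi _
  have hM : M ≤ (NearlyNested.betweenModulus ν T (z / √n) (F j)
      (NearlyNested.partialUnion F k)).toENNReal :=
    EReal.toENNReal_le_toENNReal (NearlyNested.betweenModulus_mono Set.Subset.rfl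
      (NearlyNested.subset_partialUnion hk le_rfl))
  have hM' : (NearlyNested.betweenModulus ν T (z / √n) (F j)
      (NearlyNested.partialUnion F k)).toENNReal ≤ ENNReal.ofReal C₂ * M :=
    (EReal.toENNReal_le_toENNReal (NearlyNested.betweenModulus_mono
      ((NearlyNested.subset_partialUnion hj le_rfl).trans
        NearlyNested.partialUnion_subset_hullUnion)
      NearlyNested.partialUnion_subset_hullUnion)).trans hxi
  refine ⟨⟨hopt, ?_⟩, ?_, ?_⟩
  · calc _ ≤ ENNReal.ofReal (K * C₂) * M := hup
      _ = ENNReal.ofReal (K * C₂ / c₀) * (ENNReal.ofReal c₀ * M) := by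
        rw [← mul_assoc, ← ENNReal.ofReal_mul (by positivity), div_mul_cancel₀ _ hc₀.ne']
      _ ≤ _ := mul_le_mul' (ENNReal.ofReal_le_ofReal (le_max_right _ _)) hlow
  · calc _ ≤ ENNReal.ofReal (c₀ / C₂) * (ENNReal.ofReal C₂ * M) := mul_le_mul_right hM' _
      _ = ENNReal.ofReal c₀ * M := by
        rw [← mul_assoc, ← ENNReal.ofReal_mul (by positivity), div_mul_cancel₀ _ hC₂.ne']
      _ ≤ _ := hlow.trans hopt
  · exact hup.trans (mul_le_mul' (ENNReal.ofReal_le_ofReal (le_max_left _ _)) hM)
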